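/- **Setting.** Let $\sigma,\rho>0$. Consider Brownian point particles on the line with hard-core repulsion. The non-interacting particles are $Y_j(t)=y_j+\tfrac{\sigma}{\sqrt2}W_j(t)$, $j\in\mathbb Z$, where $(W_j)$ are independent standard Brownian motions (so the free displacement has variance $\sigma^2/2$ per unit time), and the initial positions, labelled by rank, satisfy $\cdots\le y_{-1}\le y_0=0\le y_1\le\cdots$. The impenetrable particles $X_k$, $k\in\mathbb Z$, are obtained by interchanging labels whenever two trajectories meet: almost surely, each $X_k$ is continuous in $t$ with $X_k(0)=y_k$, one has $X_k(t)\le X_{k+1}(t)$ for all $k,t$, and for each $t$ there is a permutation $\pi$ of $\mathbb Z$ with $X_k(t)=Y_{\pi(k)}(t)$ for all $k$. The tracer is $x(t)=X_0(t)$. Put $\kappa=\kappa(\rho)=\dfrac{\sigma}{2\rho\sqrt\pi}$. * *Annealed case*: the initial positions other than $y_0=0$ form a Poisson point process of uniform intensity $\rho$, independent of the Brownian motions; averages are over the initial positions and the evolution. * *Quenched case*: $(y_j)$ is a deterministic configuration with macroscopically uniform density $\rho$, i.e. $y_n/n\to1/\rho$ and $-y_{-n}/n\to1/\rho$ as $n\to\infty$;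 averages are over the evolution. Write $\mathrm{Cov}(x(t_1),x(t_2))$ for the second cumulant, i.e. the coefficient $\partial_{\lambda_1}\partial_{\lambda_2}$ at $0$ of the cumulant generating function of $(x(t_1),x(t_2))$. **Statement.** In both cases $x(t)$ is square integrable for every $t\ge 0$. Fix $\tau_1,\tau_2>0$ and let $t_j=\tau_jt$. As $t\to\infty$ (where $A\sim B$ means $A/B\to1$): 1. in the annealed case, both $\mathrm{Cov}(x(t_1),x(t_2))$ and $\langle x(t_1)x(t_2)\rangle$ are $$\sim\ \kappa(\rho)\Big[\sqrt{t_1}+\sqrt{t_2}-\sqrt{|t_2-t_1|}\Big];$$ 2. in the quenched case, $$\mathrm{Cov}(x(t_1),x(t_2))\ \sim\ \kappa(\rho)\Big[\sqrt{t_1+t_2}-\sqrt{|t_2-t_1|}\Big],$$ and for equally spaced particles, $y_j=j/\rho$, the same holds for $\langle x(t_1)x(t_2)\rangle$. -/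

import Mathlib

open MeasureTheory ProbabilityTheory Filter Topology Asymptotics
open scoped NNReal ENNReal

namespace SingleFile

/-- A family of independent standard Brownian motions indexed by the particles. -/
structure IsBrownianFamily {Ω : Type*} [MeasurableSpace Ω]
    (W : ℤ → ℝ≥0 → Ω → ℝ) (P : Measure Ω) : Prop where
  measurable : ∀ j t, Measurable (W j t)
  brownian : ∀ j, IsBrownianReal (W j) P
  indep : iIndepFun (fun (j : ℤ) (ω : Ω) (t : ℝ≥0) => W j t ω) P

/-- The trajectories of the non-interacting particles (they may cross each other): particle `j`
starts at `y j` and diffuses with displacement variance `σ ^ 2 / 2` per unit time, `w j` being a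
path of a standard Brownian motion. -/
noncomputable def freePaths (σ : ℝ) (y : ℤ → ℝ) (w : ℤ → ℝ≥0 → ℝ) (j : ℤ) (t : ℝ≥0) : ℝ :=
  y j + σ / √2 * w j t

/-- `X` is the history of impenetrable point particles that belongs to the history `Y` of
non-interacting ones: labels are interchanged whenever two trajectories of `Y` meet, so that
each `X k` is a continuous trajectory, the order of the particles is preserved, and at each time
the particles of `X` occupy the same positions (with multiplicity) as those of `Y`. -/
structure IsSingleFileHistory (Y X : ℤ → ℝ≥0 → ℝ) : Prop where
  start : ∀ k, X k 0 = Y k 0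
  continuous : ∀ k, Continuous (X k)
  ordered : ∀ t, Monotone fun k => X k t
  relabelling : ∀ t, ∃ π : Equiv.Perm ℤ, ∀ k, X k t = Y (π k) t

/-- The system of Brownian point particles with hard-core repulsion: random initial positions `y`,
driving Brownian motions `W`, positions `X k t` of the impenetrable particles. The tracer is the
particle of rank `0`, with position `X 0 t` at time `t`. -/
structure IsSingleFileSystem {Ω : Type*} [MeasurableSpace Ω] (σ : ℝ) (y : Ω → ℤ → ℝ)
    (W X : ℤ → ℝ≥0 → Ω → ℝ) (P : Measure Ω) : Prop where
  measurable : ∀ k t, Measurable (X k t)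
  history : ∀ᵐ ω ∂P,
    IsSingleFileHistory (freePaths σ (y ω) fun j t => W j t ω) (fun k t => X k t ω)

/-- The number of particles other than the tracer that lie in `A`. -/
noncomputable def countIn (y : ℤ → ℝ) (A : Set ℝ) : ℕ∞ :=
  {j : ℤ | j ≠ 0 ∧ y j ∈ A}.encard

/-- Annealed initial state: the tracer sits at the origin, the other particles form a Poisson point
process on the line with uniform intensity `ρ`, and the labels are the ranks of the particles. -/
structure IsAnnealedInitial {Ω : Type*} [MeasurableSpace Ω] (ρ : ℝ) (y : Ω → ℤ → ℝ)
    (P : Measure Ω) : Prop where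
  measurable : Measurable y
  origin : ∀ᵐ ω ∂P, y ω 0 = 0
  ordered : ∀ᵐ ω ∂P, Monotone (y ω)
  poisson : ∀ A : Set ℝ, MeasurableSet A → volume A ≠ ∞ →
    HasLaw (fun ω => countIn (y ω) A)
      ((poissonMeasure (ρ * volume.real A).toNNReal).map (fun n : ℕ => (n : ℕ∞))) P
  indep : ∀ A : ℕ → Set ℝ, (∀ i, MeasurableSet (A i)) → Pairwise (Function.onFun Disjoint A) →
    iIndepFun (fun (i : ℕ) (ω : Ω) => countIn (y ω) (A i)) P

/-- Quenched initial state: a deterministic configuration, labelled by rank, with the tracer at the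
origin and with macroscopically uniform density `ρ` on both sides. -/
structure IsQuenchedInitial (ρ : ℝ) (y : ℤ → ℝ) : Prop where
  origin : y 0 = 0
  ordered : Monotone y
  density_right : Tendsto (fun n : ℕ => y n / n) atTop (𝓝 (1 / ρ))
  density_left : Tendsto (fun n : ℕ => -y (-(n : ℤ)) / n) atTop (𝓝 (1 / ρ))

/-- The prefactor of the two-time correlation. -/
noncomputable def kappa (σ ρ : ℝ) : ℝ := σ / (2 * ρ * √Real.pi)

/-- The predicted two-time correlation in the annealed case. -/
noncomputable def annealedCorr (σ ρ t₁ t₂ : ℝ) : ℝ :=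
  kappa σ ρ * (√t₁ + √t₂ - √|t₂ - t₁|)

/-- The predicted two-time correlation in the quenched case. -/
noncomputable def quenchedCorr (σ ρ t₁ t₂ : ℝ) : ℝ :=
  kappa σ ρ * (√(t₁ + t₂) - √|t₂ - t₁|)

end SingleFile

/-! The collisions can be eliminated. Let N_t(u) be the number of free particles at or below u at
time t, minus the number of negative labels, with the infinite parts cancelled (`crossing`,
`freeCrossing`). Relabelling at collisions does not change this number, so X_0(t) ≤ u forces N_t(u)
≥ 1 and u < X_0(t) forces N_t(u) ≤ 0 (`IsSingleFileHistory.tracer_le_iff`). Conservation holds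
because the signed counts of X and Y differ by an integer that depends continuously on time and
vanishes at time 0. Summability requires that particles do not come in from infinity: Brownian
suprema on a bounded time interval grow sublinearly in the label, by a Borel–Cantelli argument.

For a fixed initial configuration N_t(u) is a sum of independent bounded terms. An exponential
moment bound gives sixth central moments of order t^{3/2} near the relevant level, and increments of
N_t over distances of order t^{1/4} equal ρ times the distance up to o(t^{1/4}) in L². Inverting the
count therefore gives X_0(t) = q_t - N_t(q_t)/ρ + o(t^{1/4}) in L²
(`eventually_lintegral_inverse_add_le`, `IsTracerExpansion`). In the annealed case q_t = 0. In the
quenched case q_t is a zero of the mean count for large t; it is only known to be o(√t), which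
disappears from covariances but not from raw second moments. For equal spacing q_t is eventually
bounded, so the raw moment has the same asymptotics.

The covariances of the counts come from an exact formula (`IsNoisePair.covariance_crossing`). With n
the initial counting function, ξ the displacements at time s and η those at time t, Cov(N_s(u),
N_t(v)) = E n(min(u-ξ_0, v-η_0)) - E n(min(u-ξ_0, v-η_1)). Since n(x) is close to ρx and min(a,b) =
(a+b-|a-b|)/2, this is about (ρ/2)(E|ξ_0-η_1| - E|ξ_0-η_0|). These are absolute moments of centred
Gaussians of variance (σ²/2)(s+t) and (σ²/2)|t-s|, which produces √(s+t) - √|t-s|.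

In the annealed case the conditional means of the counts fluctuate as well. The Poisson covariance
(ρ/2)(|a|+|b|-|a-b|), taken at independent displacements, adds (ρ/2)(E|ξ_0|+E|η_1|-E|ξ_0-η_1|). The
terms E|ξ_0-η_1| cancel and √(s+t) is replaced by √s+√t. -/

namespace SingleFile

/-! ### Signed rank counts -/

/-- The contribution of particle `j`, located at `x`, to the signed count of the particles that
lie in `(-∞, u]`, relative to the particles with negative label. -/
noncomputable def stepTerm (u : ℝ) (j : ℤ) (x : ℝ) : ℝ :=
  (if x ≤ u then 1 else 0) - (if j < 0 then 1 else 0)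

/-- The number of particles of `z` in `(-∞, u]` minus the number of negative labels, with the
infinite parts cancelled. -/
noncomputable def crossing (z : ℤ → ℝ) (u : ℝ) : ℝ := ∑' j : ℤ, stepTerm u j (z j)

lemma abs_stepTerm_le_one (u : ℝ) (j : ℤ) (x : ℝ) : |stepTerm u j x| ≤ 1 := by
  unfold stepTerm
  split_ifs <;> simp

lemma stepTerm_sub_stepTerm (a b : ℝ) (j : ℤ) (x : ℝ) :
    stepTerm b j x - stepTerm a j x = (if x ≤ b then 1 else 0) - (if x ≤ a then 1 else 0) := by
  unfold stepTerm; ring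

lemma stepTerm_add (u : ℝ) (j : ℤ) (x e : ℝ) : stepTerm u j (x + e) = stepTerm (u - e) j x := by
  unfold stepTerm
  simp only [le_sub_iff_add_le]

lemma measurable_stepTerm (j : ℤ) : Measurable fun p : ℝ × ℝ => stepTerm p.1 j p.2 := by
  unfold stepTerm
  exact (Measurable.ite (measurableSet_le measurable_snd measurable_fst) measurable_const
    measurable_const).sub measurable_const

lemma measurable_crossing : Measurable fun p : (ℤ → ℝ) × ℝ => crossing p.1 p.2 := by
  unfold crossing
  refine Measurable.tsum fun j => ?_
  exact (measurable_stepTerm j).comp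
    (measurable_snd.prodMk ((measurable_pi_apply j).comp measurable_fst))

/-- The terms are the difference of the indicators of j < k and j < 0: they have a constant sign and
are supported on the finite interval between 0 and k. Hence the sum of absolute values is the
absolute value of the sum. -/
lemma hasSum_stepTerm_of_rank {z : ℤ → ℝ} {u : ℝ} {k : ℤ} (h : ∀ j, z j ≤ u ↔ j < k) :
    HasSum (fun j => stepTerm u j (z j)) k ∧ HasSum (fun j => |stepTerm u j (z j)|) |(k : ℝ)| := by
  have hterm : ∀ j, stepTerm u j (z j) = (if j < k then 1 else 0) - (if j < 0 then 1 else 0) := by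
    intro j; simp only [stepTerm, h]
  rcases le_total 0 k with hk | hk
  · have h1 : ∀ j, stepTerm u j (z j) = if j ∈ Finset.Ico 0 k then 1 else 0 := by
      intro j; simp only [hterm, Finset.mem_Ico]
      split_ifs <;> first | omega | norm_num
    have h3 : (∑ j ∈ Finset.Ico 0 k, (if j ∈ Finset.Ico 0 k then (1 : ℝ) else 0)) = k := by
      rw [Finset.sum_congr rfl (fun j hj => if_pos hj)]
      simp only [Finset.sum_const, Int.card_Ico, nsmul_eq_mul, mul_one, sub_zero]
      exact_mod_cast Int.toNat_of_nonneg hk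
    have h2 : HasSum (fun j : ℤ => if j ∈ Finset.Ico 0 k then (1 : ℝ) else 0) k := by
      rw [← h3]
      exact hasSum_sum_of_ne_finset_zero fun j hj => if_neg hj
    have hk' : |(k : ℝ)| = k := abs_of_nonneg (by exact_mod_cast hk)
    rw [hk']
    refine ⟨by simpa only [h1] using h2, ?_⟩
    convert h2 using 2 with j
    rw [h1]; split_ifs <;> simp
  · have h1 : ∀ j, stepTerm u j (z j) = -(if j ∈ Finset.Ico k 0 then 1 else 0) := by
      intro j; simp only [hterm, Finset.mem_Ico]
      split_ifs <;> first | omega | norm_num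
    have h3 : (∑ j ∈ Finset.Ico k 0, (if j ∈ Finset.Ico k 0 then (1 : ℝ) else 0)) = -k := by
      rw [Finset.sum_congr rfl (fun j hj => if_pos hj)]
      simp only [Finset.sum_const, Int.card_Ico, nsmul_eq_mul, mul_one, zero_sub]
      exact_mod_cast Int.toNat_of_nonneg (neg_nonneg.2 hk)
    have h2 : HasSum (fun j : ℤ => if j ∈ Finset.Ico k 0 then (1 : ℝ) else 0) (-k) := by
      rw [← h3]
      exact hasSum_sum_of_ne_finset_zero fun j hj => if_neg hj
    have hk' : |(k : ℝ)| = -k := abs_of_nonpos (by exact_mod_cast hk)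
    rw [hk']
    refine ⟨by simpa only [h1, neg_neg] using h2.neg, ?_⟩
    convert h2 using 2 with j
    rw [h1]; split_ifs <;> simp

lemma crossing_eq_of_rank {z : ℤ → ℝ} {u : ℝ} {k : ℤ} (h : ∀ j, z j ≤ u ↔ j < k) :
    crossing z u = k := (hasSum_stepTerm_of_rank h).1.tsum_eq

/-- A monotone configuration whose labels grow at most linearly with the distance. -/
structure IsNice (y : ℤ → ℝ) : Prop where
  mono : Monotone y
  zero : y 0 = 0
  growth : ∃ C : ℝ, 0 < C ∧ ∀ j : ℤ, |(j : ℝ)| ≤ C * (1 + |y j|)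

/-- The rank is one more than the largest label at or below the level. This offset is why the
criterion for particle 0 is a count of at least 1. -/
lemma exists_rank_of_monotone {y : ℤ → ℝ} (hy : Monotone y) (h1 : ∀ v, ∃ j, v < y j)
    (h2 : ∀ v, ∃ j, y j ≤ v) (v : ℝ) : ∃ k : ℤ, ∀ j, y j ≤ v ↔ j < k := by
  obtain ⟨b, hb⟩ := h1 v
  obtain ⟨a, ha⟩ := h2 v
  obtain ⟨m, hm, hmax⟩ := Int.exists_greatest_of_bdd (P := fun j => y j ≤ v)
    ⟨b, fun z hz => by
      by_contra! hlt
      exact absurd (hy hlt.le) (not_le.2 (hz.trans_lt hb))⟩ ⟨a, ha⟩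
  refine ⟨m + 1, fun j => ⟨fun hj => Int.lt_add_one_iff.2 (hmax j hj), fun hj => ?_⟩⟩
  exact (hy (Int.lt_add_one_iff.1 hj)).trans hm

namespace IsNice

variable {y : ℤ → ℝ}

lemma nonneg (hy : IsNice y) {j : ℤ} (hj : 0 ≤ j) : 0 ≤ y j := hy.zero ▸ hy.mono hj

lemma nonpos (hy : IsNice y) {j : ℤ} (hj : j ≤ 0) : y j ≤ 0 := hy.zero ▸ hy.mono hj

lemma exists_gt (hy : IsNice y) (v : ℝ) : ∃ j, v < y j := by
  obtain ⟨C, hC, h⟩ := hy.growth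
  obtain ⟨n, hn⟩ := exists_nat_gt (C * (1 + |v|))
  refine ⟨n, ?_⟩
  have h1 := h n
  rw [abs_of_nonneg (hy.nonneg (Int.natCast_nonneg n))] at h1
  have h2 : C * (1 + |v|) < C * (1 + y n) :=
    hn.trans_le ((le_abs_self _).trans (by exact_mod_cast h1))
  have := (mul_lt_mul_iff_right₀ hC).1 h2
  linarith [le_abs_self v]

lemma exists_le (hy : IsNice y) (v : ℝ) : ∃ j, y j ≤ v := by
  obtain ⟨C, hC, h⟩ := hy.growth
  obtain ⟨n, hn⟩ := exists_nat_gt (C * (1 + |v|))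
  refine ⟨-n, ?_⟩
  have h1 := h (-n)
  rw [abs_of_nonpos (hy.nonpos (by omega))] at h1
  have h2 : C * (1 + |v|) < C * (1 + -y (-n)) :=
    hn.trans_le (le_trans (by push_cast; rw [abs_neg]; exact le_abs_self _) h1)
  have := (mul_lt_mul_iff_right₀ hC).1 h2
  linarith [neg_abs_le v]

lemma exists_rank (hy : IsNice y) (v : ℝ) : ∃ k : ℤ, ∀ j, y j ≤ v ↔ j < k :=
  exists_rank_of_monotone hy.mono hy.exists_gt hy.exists_le v

lemma hasSum_stepTerm (hy : IsNice y) (v : ℝ) :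
    HasSum (fun j => stepTerm v j (y j)) (crossing y v) := by
  obtain ⟨k, hk⟩ := hy.exists_rank v
  rw [crossing_eq_of_rank hk]
  exact (hasSum_stepTerm_of_rank hk).1

lemma hasSum_abs_stepTerm (hy : IsNice y) (v : ℝ) :
    HasSum (fun j => |stepTerm v j (y j)|) |crossing y v| := by
  obtain ⟨k, hk⟩ := hy.exists_rank v
  rw [crossing_eq_of_rank hk]
  exact (hasSum_stepTerm_of_rank hk).2

lemma monotone_crossing (hy : IsNice y) : Monotone (crossing y) := by
  intro a b hab
  refine hasSum_le (fun j => ?_) (hy.hasSum_stepTerm a) (hy.hasSum_stepTerm b)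
  have : stepTerm b j (y j) - stepTerm a j (y j) ≥ 0 := by
    rw [stepTerm_sub_stepTerm]
    split_ifs <;> linarith
  linarith

/-- A level with rank k lies between particles k-1 and k. Whichever of the two lies between the
origin and the level (k-1 if k is positive, k otherwise) is no farther from the origin than the
level, so linear growth of the labels bounds k. -/
lemma abs_crossing_le (hy : IsNice y) : ∃ C : ℝ, 0 < C ∧ ∀ v, |crossing y v| ≤ C * (1 + |v|) := by
  obtain ⟨C, hC, h⟩ := hy.growth
  refine ⟨C + 1, by linarith, fun v => ?_⟩
  obtain ⟨k, hk⟩ := hy.exists_rank v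
  rw [crossing_eq_of_rank hk]
  rcases lt_or_ge 0 k with hk0 | hk0
  · have h1 := (hk (k - 1)).2 (by omega)
    have h2 := h (k - 1)
    have h3 : 0 ≤ y (k - 1) := hy.nonneg (by omega)
    rw [abs_of_nonneg h3] at h2
    have h4 : |(k : ℝ)| ≤ |((k - 1 : ℤ) : ℝ)| + 1 := by
      push_cast
      calc |(k : ℝ)| = |((k : ℝ) - 1) + 1| := by ring_nf
        _ ≤ _ := (abs_add_le _ _).trans (by simp)
    have h5 : y (k - 1) ≤ |v| := h1.trans (le_abs_self v)
    nlinarith [abs_nonneg v]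
  · have h1 : v < y k := by
      by_contra! hc
      exact lt_irrefl k ((hk k).1 hc)
    have h2 := h k
    rw [abs_of_nonpos (hy.nonpos hk0)] at h2
    have h5 : -y k ≤ |v| := by linarith [neg_abs_le v]
    nlinarith [abs_nonneg v]

end IsNice

/-- Beyond some index the error is at most ε times the label, by convergence of the ratios; the
finitely many remaining errors are absorbed in a constant, namely their sum. -/
lemma IsQuenchedInitial.abs_sub_le {ρ : ℝ} {y : ℤ → ℝ} (hy : IsQuenchedInitial ρ y) {ε : ℝ}
    (hε : 0 < ε) : ∃ C : ℝ, 0 ≤ C ∧ ∀ j : ℤ, |y j - j / ρ| ≤ ε * |(j : ℝ)| + C := by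
  have key : ∀ x : ℕ → ℝ, Tendsto (fun n : ℕ => x n / n) atTop (𝓝 (1 / ρ)) →
      ∃ C : ℝ, 0 ≤ C ∧ ∀ n : ℕ, |x n - n / ρ| ≤ ε * n + C := by
    intro x hx
    obtain ⟨n₀, hn₀⟩ := (Metric.tendsto_atTop.1 hx) ε hε
    refine ⟨∑ n ∈ Finset.range (n₀ + 1), |x n - n / ρ|, Finset.sum_nonneg fun _ _ => abs_nonneg _,
      fun n => ?_⟩
    rcases lt_or_ge n (n₀ + 1) with hn | hn
    · have := Finset.single_le_sum (f := fun n : ℕ => |x n - n / ρ|) (fun _ _ => abs_nonneg _)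
        (Finset.mem_range.2 hn)
      have h2 : 0 ≤ ε * n := by positivity
      linarith
    · have hpos : (0 : ℝ) < n := by exact_mod_cast (by omega : 0 < n)
      have h1 := (hn₀ n (by omega)).le
      rw [Real.dist_eq] at h1
      have h2 : x n - n / ρ = (x n / n - 1 / ρ) * n := by field_simp
      rw [h2, abs_mul, abs_of_pos hpos]
      have h3 : 0 ≤ ∑ n ∈ Finset.range (n₀ + 1), |x n - n / ρ| :=
        Finset.sum_nonneg fun _ _ => abs_nonneg _
      nlinarith
  obtain ⟨C₁, hC₁, h₁⟩ := key _ hy.density_right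
  obtain ⟨C₂, hC₂, h₂⟩ := key _ hy.density_left
  refine ⟨C₁ + C₂, by linarith, fun j => ?_⟩
  obtain ⟨n, rfl | rfl⟩ := j.eq_nat_or_neg
  · have := h₁ n
    simp only [Int.cast_natCast, Nat.abs_cast]
    linarith
  · have := h₂ n
    simp only [Int.cast_neg, Int.cast_natCast, abs_neg, Nat.abs_cast]
    rw [show y (-(n : ℤ)) - -(n : ℝ) / ρ = -(-y (-(n : ℤ)) - n / ρ) by ring, abs_neg]
    linarith

lemma IsQuenchedInitial.isNice {ρ : ℝ} {y : ℤ → ℝ} (hρ : 0 < ρ) (hy : IsQuenchedInitial ρ y) :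
    IsNice y := by
  refine ⟨hy.ordered, hy.origin, ?_⟩
  -- Half the asymptotic spacing is given up to the error, which leaves |y j| ≥ |j| / (2ρ) - C.
  obtain ⟨C, hC, h⟩ := hy.abs_sub_le (ε := 1 / (2 * ρ)) (by positivity)
  refine ⟨2 * ρ * (1 + C), by positivity, fun j => ?_⟩
  have h1 := h j
  have h2 : |(j : ℝ) / ρ| ≤ |y j| + |y j - j / ρ| := by
    have := abs_sub_abs_le_abs_sub ((j : ℝ) / ρ) (y j)
    rw [abs_sub_comm] at this
    linarith
  rw [abs_div, abs_of_pos hρ] at h2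
  have h3 : |(j : ℝ)| / ρ ≤ |y j| + (1 / (2 * ρ) * |(j : ℝ)| + C) := by linarith
  have h4 : |(j : ℝ)| / ρ = 2 * (1 / (2 * ρ) * |(j : ℝ)|) := by field_simp
  have h5 : |(j : ℝ)| = 2 * ρ * (1 / (2 * ρ) * |(j : ℝ)|) := by field_simp
  rw [h5]
  have : 1 / (2 * ρ) * |(j : ℝ)| ≤ (1 + C) * (1 + |y j|) := by nlinarith [abs_nonneg (y j)]
  nlinarith

/-- Inversion of the estimate on positions: y (k-1) ≤ v < y k pins k/ρ to v. The tolerance ε/(Kρ)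
per label becomes ε per unit of length after |k| ≤ K(1+|v|) and multiplication by ρ. -/
lemma IsQuenchedInitial.abs_crossing_sub_le {ρ : ℝ} {y : ℤ → ℝ} (hρ : 0 < ρ)
    (hy : IsQuenchedInitial ρ y) {ε : ℝ} (hε : 0 < ε) :
    ∃ C : ℝ, 0 ≤ C ∧ ∀ v, |crossing y v - ρ * v| ≤ ε * |v| + C := by
  have hn := hy.isNice hρ
  obtain ⟨K, hK, hKv⟩ := hn.abs_crossing_le
  obtain ⟨C, hC, h⟩ := hy.abs_sub_le (ε := ε / (K * ρ)) (by positivity)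
  refine ⟨ε + ρ * (1 / ρ + ε / (K * ρ) + C), by positivity, fun v => ?_⟩
  obtain ⟨k, hk⟩ := hn.exists_rank v
  have hkv := hKv v
  rw [crossing_eq_of_rank hk] at hkv ⊢
  have h1 : y (k - 1) ≤ v := (hk (k - 1)).2 (by omega)
  have h2 : v < y k := by
    by_contra! hc
    exact lt_irrefl k ((hk k).1 hc)
  have h3 := abs_le.1 (h k)
  have h4 := abs_le.1 (h (k - 1))
  have h5 : |((k - 1 : ℤ) : ℝ)| ≤ |(k : ℝ)| + 1 := by
    push_cast; exact (abs_sub _ _).trans (by simp)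
  have h6 : ε / (K * ρ) * |(k : ℝ)| ≤ ε / ρ * (1 + |v|) := by
    calc _ ≤ ε / (K * ρ) * (K * (1 + |v|)) := by gcongr
      _ = _ := by field_simp
  have h7 : ε / (K * ρ) * |((k - 1 : ℤ) : ℝ)| ≤ ε / (K * ρ) * (|(k : ℝ)| + 1) := by gcongr
  have h8 : |(k : ℝ) / ρ - v| ≤ ε / ρ * (1 + |v|) + (1 / ρ + ε / (K * ρ) + C) := by
    have hp : 0 < 1 / ρ := by positivity
    have hp2 : 0 < ε / (K * ρ) := by positivity
    have h9 : ((k - 1 : ℤ) : ℝ) / ρ = k / ρ - 1 / ρ := by push_cast; ring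
    rw [h9] at h4
    rw [abs_le]; constructor <;> nlinarith
  calc |(k : ℝ) - ρ * v| = ρ * |(k : ℝ) / ρ - v| := by
        rw [← abs_of_pos hρ, ← abs_mul, abs_of_pos hρ]; congr 1; field_simp
    _ ≤ ρ * (ε / ρ * (1 + |v|) + (1 / ρ + ε / (K * ρ) + C)) := by gcongr
    _ = _ := by field_simp; ring

/-- The rank of the level v is ⌊ρ v⌋ + 1. A bounded error, instead of a sublinear one, is what later
keeps the mean position of the tracer under control. -/
lemma abs_crossing_equispaced_sub_le {ρ : ℝ} (hρ : 0 < ρ) {y : ℤ → ℝ} (hy : ∀ j : ℤ, y j = j / ρ)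
    (v : ℝ) : |crossing y v - ρ * v| ≤ 1 := by
  have hk : ∀ j : ℤ, y j ≤ v ↔ j < ⌊ρ * v⌋ + 1 := by
    intro j
    rw [hy, div_le_iff₀ hρ, Int.lt_add_one_iff, Int.le_floor, mul_comm]
  rw [crossing_eq_of_rank hk, abs_le]
  push_cast
  constructor <;> linarith [Int.floor_le (ρ * v), Int.lt_floor_add_one (ρ * v)]

end SingleFile

namespace SingleFile

/-! ### Identification of the tracer -/

/-- The indicator of the negative labels. -/
noncomputable def negLabel (j : ℤ) : ℝ := if j < 0 then 1 else 0

lemma finite_support_sub_negLabel {z : ℤ → ℝ} (h1 : Tendsto z atTop atTop)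
    (h2 : Tendsto z atBot atBot) {g : ℝ → ℝ} {A : ℝ} (hg0 : ∀ x, A < x → g x = 0)
    (hg1 : ∀ x, x < -A → g x = 1) :
    (Function.support fun j => g (z j) - negLabel j).Finite := by
  have : ∀ᶠ j in cofinite, ¬ (g (z j) - negLabel j ≠ 0) := by
    rw [Int.cofinite_eq, eventually_sup]
    constructor
    · filter_upwards [h2.eventually_lt_atBot (-A), eventually_lt_atBot 0] with j hj hj0
      simp [hg1 _ hj, negLabel, hj0]
    · filter_upwards [h1.eventually_gt_atTop A, eventually_ge_atTop 0] with j hj hj0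
      simp [hg0 _ hj, negLabel, not_lt.2 hj0]
  exact (eventually_cofinite.1 this).subset fun j hj => not_not.2 hj

/-- After reindexing the second sum by the permutation, the values of the test function cancel. The
discrepancy thus depends on the permutation only, so a continuous test function and a sharp
indicator see the same number. -/
lemma tsum_sub_negLabel_comp_perm {z : ℤ → ℝ} (h1 : Tendsto z atTop atTop)
    (h2 : Tendsto z atBot atBot) {π : Equiv.Perm ℤ} (h3 : Tendsto (z ∘ π) atTop atTop)
    (h4 : Tendsto (z ∘ π) atBot atBot) {g : ℝ → ℝ} {A : ℝ} (hg0 : ∀ x, A < x → g x = 0)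
    (hg1 : ∀ x, x < -A → g x = 1) :
    (∑' k, (g (z (π k)) - negLabel k)) - ∑' j, (g (z j) - negLabel j) =
      ∑' k, (negLabel (π k) - negLabel k) := by
  have hs1 : Summable fun j => g (z j) - negLabel j := summable_of_hasFiniteSupport (finite_support_sub_negLabel h1 h2 hg0 hg1)
  have hs2 : Summable fun k => g (z (π k)) - negLabel k := summable_of_hasFiniteSupport (finite_support_sub_negLabel h3 h4 hg0 hg1)
  have hs3 : Summable fun k => g (z (π k)) - negLabel (π k) :=
    (π.summable_iff (f := fun j => g (z j) - negLabel j)).2 hs1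
  rw [← π.tsum_eq (fun j => g (z j) - negLabel j), ← hs2.tsum_sub hs3]
  refine tsum_congr fun k => ?_
  ring

/-- A summable family of integers tends to 0, hence is finitely supported and has an integer sum. -/
lemma exists_int_tsum_negLabel_sub (π : Equiv.Perm ℤ) :
    ∃ m : ℤ, ∑' k, (negLabel (π k) - negLabel k) = (m : ℝ) := by
  by_cases h : Summable fun k => negLabel (π k) - negLabel k
  · have hint : ∀ k, ∃ m : ℤ, negLabel (π k) - negLabel k = m := by
      intro k
      unfold negLabel
      refine ⟨(if π k < 0 then 1 else 0) - (if k < 0 then 1 else 0), ?_⟩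
      push_cast
      rfl
    choose f hf using hint
    simp only [hf] at h ⊢
    have h0 : Tendsto (fun k => (f k : ℝ)) cofinite (𝓝 0) := h.tendsto_cofinite_zero
    have hfin : f.HasFiniteSupport := by
      have : ∀ᶠ k in cofinite, ¬ (f k ≠ 0) := by
        filter_upwards [h0.eventually (Metric.ball_mem_nhds 0 one_pos)] with k hk
        rw [dist_zero_right, Real.norm_eq_abs] at hk
        have : |f k| < 1 := by exact_mod_cast hk
        simpa using Int.abs_lt_one_iff.1 this
      exact (eventually_cofinite.1 this).subset fun j hj => not_not.2 hj
    refine ⟨∑' k, f k, ?_⟩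
    have hsum : Summable f := summable_of_hasFiniteSupport hfin
    have := hsum.hasSum.map (Int.castAddHom ℝ)
      continuous_of_discreteTopology
    exact this.tsum_eq
  -- Without summability the sum takes its default value 0, which is again an integer.
  · exact ⟨0, by simpa using tsum_eq_zero_of_not_summable h⟩

/-- The trajectories leave every bounded set, locally uniformly in time, on the side given by
the sign of their label. -/
structure IsLocallyDivergent (Y : ℤ → ℝ≥0 → ℝ) : Prop where
  right : ∀ (T : ℝ≥0) (A : ℝ), ∃ J : ℤ, ∀ j ≥ J, ∀ t ≤ T, A < Y j t
  left : ∀ (T : ℝ≥0) (A : ℝ), ∃ J : ℤ, ∀ j ≤ J, ∀ t ≤ T, Y j t < A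

namespace IsLocallyDivergent

variable {Y X : ℤ → ℝ≥0 → ℝ}

lemma tendsto_atTop (hY : IsLocallyDivergent Y) (t : ℝ≥0) :
    Tendsto (fun j => Y j t) atTop atTop := by
  refine Filter.tendsto_atTop.2 fun A => ?_
  obtain ⟨J, hJ⟩ := hY.right t A
  filter_upwards [eventually_ge_atTop J] with j hj using (hJ j hj t le_rfl).le

lemma tendsto_atBot (hY : IsLocallyDivergent Y) (t : ℝ≥0) :
    Tendsto (fun j => Y j t) atBot atBot := by
  refine Filter.tendsto_atBot.2 fun A => ?_
  obtain ⟨J, hJ⟩ := hY.left t A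
  filter_upwards [eventually_le_atBot J] with j hj using (hJ j hj t le_rfl).le

/-- Up to time t+1 all terms vanish outside one finite set of labels, the same for every such time,
so near t the series is a finite sum of continuous functions. -/
lemma continuous_tsum (hY : IsLocallyDivergent Y) (hc : ∀ j, Continuous (Y j)) {g : ℝ → ℝ}
    (hg : Continuous g) {A : ℝ} (hg0 : ∀ x, A < x → g x = 0) (hg1 : ∀ x, x < -A → g x = 1) :
    Continuous fun t => ∑' j, (g (Y j t) - negLabel j) := by
  rw [continuous_iff_continuousAt]
  intro t
  obtain ⟨J₁, h₁⟩ := hY.right (t + 1) A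
  obtain ⟨J₂, h₂⟩ := hY.left (t + 1) (-A)
  have heq : ∀ s ≤ t + 1, ∑' j, (g (Y j s) - negLabel j) =
      ∑ j ∈ Finset.Ico (min J₂ 0) (max J₁ 0), (g (Y j s) - negLabel j) := by
    intro s hs
    refine tsum_eq_sum fun j hj => ?_
    rw [Finset.mem_Ico, not_and_or, not_le, not_lt] at hj
    rcases hj with hj | hj
    · have h3 : j < 0 := hj.trans_le (min_le_right _ _)
      simp [hg1 _ (h₂ j (hj.le.trans (min_le_left _ _)) s hs), negLabel, h3]
    · have h3 : ¬ j < 0 := not_lt.2 ((le_max_right _ _).trans hj)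
      simp [hg0 _ (h₁ j ((le_max_left _ _).trans hj) s hs), negLabel, h3]
  have hcont : ContinuousAt
      (fun s => ∑ j ∈ Finset.Ico (min J₂ 0) (max J₁ 0), (g (Y j s) - negLabel j)) t := by
    refine Continuous.continuousAt (continuous_finsetSum _ fun j _ => ?_)
    exact (hg.comp (hc j)).sub continuous_const
  refine hcont.congr ?_
  filter_upwards [Iic_mem_nhds (lt_add_one t)] with s hs using (heq s hs).symm

/-- At each single time some X k exceeds A, because X and Y occupy the same positions. By order
preservation the open sets of times with A < X k t increase with k, so by compactness one label
serves the whole time interval. -/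
lemma of_isSingleFileHistory (hY : IsLocallyDivergent Y) (h : IsSingleFileHistory Y X) :
    IsLocallyDivergent X := by
  have hr : ∀ t A, ∃ k, A < X k t := by
    intro t A
    obtain ⟨J, hJ⟩ := hY.right t A
    obtain ⟨π, hπ⟩ := h.relabelling t
    exact ⟨π.symm J, by rw [hπ, Equiv.apply_symm_apply]; exact hJ J le_rfl t le_rfl⟩
  have hl : ∀ t A, ∃ k, X k t < A := by
    intro t A
    obtain ⟨J, hJ⟩ := hY.left t A
    obtain ⟨π, hπ⟩ := h.relabelling t
    exact ⟨π.symm J, by rw [hπ, Equiv.apply_symm_apply]; exact hJ J le_rfl t le_rfl⟩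
  constructor
  · intro T A
    obtain ⟨K, hK⟩ := (isCompact_Icc (a := (0 : ℝ≥0)) (b := T)).elim_directed_cover
      (fun k : ℤ => {t | A < X k t})
      (fun k => isOpen_lt continuous_const (h.continuous k))
      (fun t _ => Set.mem_iUnion.2 (hr t A))
      (Monotone.directed_le fun i j hij t (ht : A < X i t) => ht.trans_le (h.ordered t hij))
    exact ⟨K, fun j hj t ht => (hK ⟨zero_le, ht⟩ : A < X K t).trans_le (h.ordered t hj)⟩
  · intro T A
    obtain ⟨K, hK⟩ := (isCompact_Icc (a := (0 : ℝ≥0)) (b := T)).elim_directed_cover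
      (fun k : ℤ => {t | X k t < A})
      (fun k => isOpen_lt (h.continuous k) continuous_const)
      (fun t _ => Set.mem_iUnion.2 (hl t A))
      (directed_of_isDirected_ge fun i j hij t (ht : X j t < A) => lt_of_le_of_lt (h.ordered t hij) ht)
    exact ⟨K, fun j hj t ht => lt_of_le_of_lt (h.ordered t hj) (hK ⟨zero_le, ht⟩ : X K t < A)⟩

end IsLocallyDivergent

/-- For a continuous cutoff the discrepancy between the two signed counts is continuous in time and
integer valued, hence constant, and it vanishes at time 0. As it does not depend on the cutoff, it
also vanishes for the indicator of (-∞, u]. -/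
lemma IsSingleFileHistory.crossing_eq {Y X : ℤ → ℝ≥0 → ℝ} (h : IsSingleFileHistory Y X)
    (hY : IsLocallyDivergent Y) (hc : ∀ j, Continuous (Y j)) (t : ℝ≥0) (u : ℝ) :
    crossing (fun k => X k t) u = crossing (fun j => Y j t) u := by
  have hX := hY.of_isSingleFileHistory h
  choose π hπ using h.relabelling
  have hcomp : ∀ t, (fun k => X k t) = (fun j => Y j t) ∘ π t := fun t => funext (hπ t)
  have key : ∀ t (g : ℝ → ℝ) (A : ℝ), (∀ x, A < x → g x = 0) → (∀ x, x < -A → g x = 1) →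
      (∑' k, (g (X k t) - negLabel k)) - ∑' j, (g (Y j t) - negLabel j) =
        ∑' k, (negLabel (π t k) - negLabel k) := by
    intro t g A hg0 hg1
    have := tsum_sub_negLabel_comp_perm (hY.tendsto_atTop t) (hY.tendsto_atBot t) (π := π t)
      (by rw [← hcomp]; exact hX.tendsto_atTop t) (by rw [← hcomp]; exact hX.tendsto_atBot t)
      hg0 hg1
    simpa only [hπ t] using this
  -- A continuous ramp, equal to 1 to the left of -1 and to 0 to the right of 0.
  let f : ℝ → ℝ := fun x => max 0 (min 1 (-x))
  have hf : Continuous f := by fun_prop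
  have hf0 : ∀ x, (1 : ℝ) < x → f x = 0 := fun x hx =>
    max_eq_left ((min_le_right _ _).trans (by linarith))
  have hf1 : ∀ x, x < -(1 : ℝ) → f x = 1 := fun x hx => by
    simp only [f]; rw [min_eq_left (by linarith)]; norm_num
  have hD : Continuous fun t => ∑' k, (negLabel (π t k) - negLabel k) := by
    simp only [← key _ f 1 hf0 hf1]
    exact (hX.continuous_tsum h.continuous hf hf0 hf1).sub (hY.continuous_tsum hc hf hf0 hf1)
  choose m hm using fun t => exists_int_tsum_negLabel_sub (π t)
  simp only [hm] at hD key
  have hmc : Continuous m := Int.isClosedEmbedding_coe_real.isEmbedding.continuous_iff.2 hD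
  have hm0 : m 0 = 0 := by
    have := key 0 f 1 hf0 hf1
    simp only [h.start, sub_self] at this
    exact_mod_cast this.symm
  have hmt : m t = 0 := by
    rw [← hm0]; exact PreconnectedSpace.constant inferInstance hmc
  have := key t (fun x => if x ≤ u then 1 else 0) (|u|)
    (fun x hx => if_neg (not_le.2 ((le_abs_self u).trans_lt hx)))
    (fun x hx => if_pos (hx.le.trans (neg_abs_le u)))
  rw [hmt, Int.cast_zero, sub_eq_zero] at this
  exact this

/-- The interacting particles are ordered, so their signed count at u is the rank k of u, and
particle 0 lies at or below u exactly when 0 < k. The count may then be evaluated on the free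
particles. -/
lemma IsSingleFileHistory.tracer_le_iff {Y X : ℤ → ℝ≥0 → ℝ} (h : IsSingleFileHistory Y X)
    (hY : IsLocallyDivergent Y) (hc : ∀ j, Continuous (Y j)) (t : ℝ≥0) (u : ℝ) :
    (X 0 t ≤ u → 1 ≤ crossing (fun j => Y j t) u) ∧
      (u < X 0 t → crossing (fun j => Y j t) u ≤ 0) := by
  have hX := hY.of_isSingleFileHistory h
  obtain ⟨k, hk⟩ := exists_rank_of_monotone (h.ordered t)
    (fun v => (((hX.tendsto_atTop t).eventually_gt_atTop v).exists))
    (fun v => (((hX.tendsto_atBot t).eventually_le_atBot v).exists)) u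
  rw [← h.crossing_eq hY hc, crossing_eq_of_rank hk]
  refine ⟨fun h0 => ?_, fun h0 => ?_⟩
  · have := (hk 0).1 h0
    exact_mod_cast (by omega : 1 ≤ k)
  · have := mt (hk 0).2 (not_le.2 h0)
    exact_mod_cast not_lt.1 this

/-- The initial position of particle j has modulus at least |j|/C - 1, and its displacement up to
time T is at most |j|/(2C) for all but finitely many j; half of the initial distance survives. -/
lemma isLocallyDivergent_freePaths {σ : ℝ} {y : ℤ → ℝ} (hy : IsNice y) {w : ℤ → ℝ≥0 → ℝ}
    (hw : ∀ (T : ℝ≥0) (δ : ℝ), 0 < δ → ∀ᶠ j : ℤ in cofinite, ∀ t ≤ T, |w j t| ≤ δ * |(j : ℝ)|) :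
    IsLocallyDivergent (freePaths σ y w) := by
  obtain ⟨C, hC, hg⟩ := hy.growth
  have key : ∀ T : ℝ≥0, ∀ᶠ j : ℤ in cofinite, ∀ t ≤ T,
      |σ / √2 * w j t| ≤ |(j : ℝ)| / (2 * C) := by
    intro T
    have hpos : 0 < 1 / (2 * C * (|σ / √2| + 1)) := by positivity
    filter_upwards [hw T _ hpos] with j hj t ht
    rw [abs_mul]
    calc |σ / √2| * |w j t| ≤ (|σ / √2| + 1) * (1 / (2 * C * (|σ / √2| + 1)) * |(j : ℝ)|) := by
          gcongr
          · linarith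
          · exact hj t ht
      _ = _ := by field_simp
  have hlow : ∀ j : ℤ, |(j : ℝ)| / C - 1 ≤ |y j| := fun j => by
    rw [sub_le_iff_le_add', div_le_iff₀ hC, mul_comm]; exact hg j
  have hhalf : ∀ j : ℤ, |(j : ℝ)| / C - 1 - |(j : ℝ)| / (2 * C) = |(j : ℝ)| / (2 * C) - 1 :=
    fun j => by field_simp; ring
  have hev : ∀ T : ℝ≥0, (∀ᶠ j : ℤ in atBot, ∀ t ≤ T, |σ / √2 * w j t| ≤ |(j : ℝ)| / (2 * C)) ∧
      (∀ᶠ j : ℤ in atTop, ∀ t ≤ T, |σ / √2 * w j t| ≤ |(j : ℝ)| / (2 * C)) := by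
    intro T
    have := key T
    rwa [Int.cofinite_eq, eventually_sup] at this
  constructor
  · intro T A
    have h1 : ∀ᶠ j : ℤ in atTop, (2 * C) * (A + 1) < (j : ℝ) :=
      (tendsto_intCast_atTop_atTop (R := ℝ)).eventually_gt_atTop _
    obtain ⟨J, hJ⟩ := eventually_atTop.1
      (((hev T).2.and h1).and (eventually_ge_atTop (0 : ℤ)))
    refine ⟨J, fun j hj t ht => ?_⟩
    obtain ⟨⟨h2, h3⟩, h4⟩ := hJ j hj
    have h5 := hlow j
    rw [abs_of_nonneg (hy.nonneg h4)] at h5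
    have h6 := hhalf j
    have h7 := neg_le_of_abs_le (h2 t ht)
    have h8 : A + 1 < |(j : ℝ)| / (2 * C) := by
      rw [lt_div_iff₀ (by positivity), mul_comm]; exact h3.trans_le (le_abs_self _)
    unfold freePaths
    linarith
  · intro T A
    have h1 : ∀ᶠ j : ℤ in atBot, (j : ℝ) < (2 * C) * (A - 1) :=
      (tendsto_intCast_atBot_iff.2 tendsto_id).eventually_lt_atBot _
    obtain ⟨J, hJ⟩ := eventually_atBot.1
      (((hev T).1.and h1).and (eventually_le_atBot (0 : ℤ)))
    refine ⟨J, fun j hj t ht => ?_⟩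
    obtain ⟨⟨h2, h3⟩, h4⟩ := hJ j hj
    have h5 := hlow j
    rw [abs_of_nonpos (hy.nonpos h4)] at h5
    have h6 := hhalf j
    have h7 := le_of_abs_le (h2 t ht)
    have h8 : -A + 1 < |(j : ℝ)| / (2 * C) := by
      rw [lt_div_iff₀ (by positivity), mul_comm]
      linarith [neg_abs_le (j : ℝ)]
    unfold freePaths
    linarith

end SingleFile

namespace SingleFile

/-! ### Brownian paths grow sublinearly in the label -/

variable {Ω : Type*} [MeasurableSpace Ω] {P : Measure Ω}

/-- The fourth moment of a standard Gaussian variable. -/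
noncomputable def gaussianFourth : ℝ≥0∞ := ∫⁻ x, ENNReal.ofReal (x ^ 4) ∂(gaussianReal 0 1)

lemma gaussianFourth_ne_top : gaussianFourth ≠ ∞ := by
  have h := (memLp_id_gaussianReal (μ := 0) (v := 1) 4).integrable_norm_pow (by norm_num)
  have h2 : Integrable (fun x : ℝ => x ^ 4) (gaussianReal 0 1) := by
    refine h.congr (ae_of_all _ fun x => ?_)
    simp only [id, Real.norm_eq_abs]
    exact Even.pow_abs (by decide) x
  exact (hasFiniteIntegral_iff_ofReal (ae_of_all _ fun x => by positivity)).1 h2.2 |>.ne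

lemma lintegral_pow_four_gaussianReal (v : ℝ≥0) :
    ∫⁻ x, ENNReal.ofReal (x ^ 4) ∂(gaussianReal 0 v) =
      ENNReal.ofReal ((v : ℝ) ^ 2) * gaussianFourth := by
  have h := gaussianReal_map_const_mul (μ := 0) (v := 1) (√(v : ℝ))
  have hv : NNReal.mk (√(v : ℝ) ^ 2) (sq_nonneg _) * 1 = v := by
    ext; simp
  rw [mul_zero, hv] at h
  rw [← h, lintegral_map (by fun_prop) (by fun_prop), gaussianFourth,
    ← lintegral_const_mul _ (by fun_prop)]
  refine lintegral_congr fun x => ?_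
  rw [← ENNReal.ofReal_mul (by positivity), mul_pow]
  congr 2
  rw [show (4 : ℕ) = 2 * 2 from rfl, pow_mul, Real.sq_sqrt v.coe_nonneg]

/-- Markov's inequality with the fourth moment, because it is quadratic in the time step: a union
bound over 2^n increments of length proportional to 2^{-n} still decays. -/
lemma measure_lt_abs_sub_le {B : ℝ≥0 → Ω → ℝ} (hB : IsBrownianReal B P) (s t : ℝ≥0) {a : ℝ}
    (ha : 0 < a) : P {ω | a < |B s ω - B t ω|} ≤
      ENNReal.ofReal (((s : ℝ) - t) ^ 2 / a ^ 4) * gaussianFourth := by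
  have hl := hB.hasLaw_sub s t
  have h1 : ∫⁻ ω, ENNReal.ofReal ((B s ω - B t ω) ^ 4) ∂P =
      ENNReal.ofReal (((s : ℝ) - t) ^ 2) * gaussianFourth := by
    have h2 := hl.lintegral_comp (f := fun x => ENNReal.ofReal (x ^ 4)) (by fun_prop)
    simp only [Pi.sub_apply] at h2
    rw [h2, lintegral_pow_four_gaussianReal]
    congr 2
    rw [coe_nndist, NNReal.val_eq_coe, NNReal.val_eq_coe, Real.dist_eq, sq_abs]
  have h3 : P {ω | a < |B s ω - B t ω|} ≤
      P {ω | ENNReal.ofReal (a ^ 4) ≤ ENNReal.ofReal ((B s ω - B t ω) ^ 4)} := by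
    refine measure_mono fun ω (hω : a < _) => ?_
    refine ENNReal.ofReal_le_ofReal ?_
    rw [← Even.pow_abs (by decide : Even 4) (B s ω - B t ω)]
    gcongr
  refine h3.trans ?_
  refine (meas_ge_le_lintegral_div ?_ (ENNReal.ofReal_pos.2 (pow_pos ha 4)).ne' ENNReal.ofReal_ne_top).trans ?_
  · have := hl.aemeasurable
    simp only [Pi.sub_def] at this
    fun_prop
  · rw [h1, ENNReal.ofReal_div_of_pos (by positivity), ENNReal.div_eq_inv_mul,
      ENNReal.div_eq_inv_mul, mul_assoc]

/-- Chaining: a point of the grid of level n+1 is a point of level n or one increment away from one.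
The allowed increments form a geometric series of total a, and continuity extends the bound from
dyadic points to the interval. -/
lemma abs_le_of_dyadic_increments {b : ℝ≥0 → ℝ} (hb : Continuous b) (h0 : b 0 = 0) {T : ℝ≥0}
    (hT : 0 < T) {a : ℝ} (ha : 0 ≤ a)
    (h : ∀ n k : ℕ, k < 2 ^ n →
      |b ((k + 1 : ℕ) * T / 2 ^ n) - b (k * T / 2 ^ n)| ≤ a / 10 * (9 / 10) ^ n)
    {t : ℝ≥0} (ht : t ≤ T) : |b t| ≤ a := by
  have grid : ∀ n k : ℕ, k ≤ 2 ^ n →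
      |b (k * T / 2 ^ n)| ≤ a / 10 * ∑ i ∈ Finset.range (n + 1), (9 / 10 : ℝ) ^ i := by
    intro n
    induction n with
    | zero =>
      intro k hk
      have hk' : k = 0 ∨ k = 1 := by simp at hk; omega
      rcases hk' with rfl | rfl
      · simp [h0]; positivity
      · have := h 0 0 (by norm_num)
        simpa [h0] using this
    | succ n ih =>
      intro k hk
      rw [Finset.sum_range_succ, mul_add]
      obtain ⟨m, rfl | rfl⟩ := Nat.even_or_odd' k
      · have h1 : ((2 * m : ℕ) : ℝ≥0) * T / 2 ^ (n + 1) = m * T / 2 ^ n := by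
          push_cast; field_simp; ring
        rw [h1]
        have := ih m (by rw [pow_succ] at hk; omega)
        have h2 : 0 ≤ a / 10 * (9 / 10 : ℝ) ^ (n + 1) := by positivity
        linarith
      · have h1 : ((2 * m : ℕ) : ℝ≥0) * T / 2 ^ (n + 1) = m * T / 2 ^ n := by
          push_cast; field_simp; ring
        have h3 := h (n + 1) (2 * m) (by omega)
        rw [h1] at h3
        have h4 := ih m (by rw [pow_succ] at hk; omega)
        calc _ = |b ((2 * m + 1 : ℕ) * T / 2 ^ (n + 1)) - b (m * T / 2 ^ n) + b (m * T / 2 ^ n)| := by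
              ring_nf
          _ ≤ _ := (abs_add_le _ _).trans (by linarith)
  have grid' : ∀ n k : ℕ, k ≤ 2 ^ n → |b (k * T / 2 ^ n)| ≤ a := by
    intro n k hk
    refine (grid n k hk).trans ?_
    have h1 : ∑ i ∈ Finset.range (n + 1), (9 / 10 : ℝ) ^ i ≤ 10 := by
      rw [geom_sum_eq (by norm_num), div_le_iff_of_neg (by norm_num)]
      have : (0 : ℝ) ≤ (9 / 10) ^ (n + 1) := by positivity
      linarith
    nlinarith
  have hT' : (0 : ℝ) < T := hT
  have hlim : Tendsto (fun n : ℕ => ((⌊(t : ℝ) * (2 ^ n / T)⌋₊ : ℕ) : ℝ≥0) * T / 2 ^ n) atTop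
      (𝓝 t) := by
    have h1 : Tendsto (fun n : ℕ => (2 : ℝ) ^ n / T) atTop atTop :=
      (tendsto_pow_atTop_atTop_of_one_lt one_lt_two).atTop_div_const hT'
    have h2 := (tendsto_nat_floor_mul_div_atTop (a := (t : ℝ)) t.2).comp h1
    refine NNReal.tendsto_coe.1 (h2.congr fun n => ?_)
    simp only [Function.comp]
    push_cast
    field_simp
  refine le_of_tendsto ((hb.abs.tendsto t).comp hlim) (Eventually.of_forall fun n => ?_)
  refine grid' n _ (Nat.floor_le_of_le ?_)
  have h1 : (t : ℝ) / T ≤ 1 := by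
    rw [div_le_one hT']; exact_mod_cast ht
  push_cast
  calc (t : ℝ) * (2 ^ n / T) = t / T * 2 ^ n := by ring
    _ ≤ 1 * 2 ^ n := by gcongr
    _ = _ := one_mul _

lemma exists_measure_sup_le (T : ℝ≥0) (hT : 0 < T) : ∃ K : ℝ, 0 ≤ K ∧
    ∀ (B : ℝ≥0 → Ω → ℝ), IsBrownianReal B P → ∀ a : ℝ, 0 < a →
      P {ω | ∃ t ≤ T, a < |B t ω|} ≤ ENNReal.ofReal (K / a ^ 4) := by
  -- The ratio of the union bounds at consecutive levels: twice as many increments, each with half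
  -- the time step squared, against thresholds shrunk by 9/10 to the fourth power. The value 9/10 is
  -- close enough to 1 for q < 1.
  let q : ℝ := 1 / (2 * (9 / 10) ^ 4)
  have hq0 : 0 ≤ q := by positivity
  have hq1 : q < 1 := by norm_num [q]
  refine ⟨10 ^ 4 * (T : ℝ) ^ 2 * gaussianFourth.toReal * (1 - q)⁻¹, ?_, fun B hB a ha => ?_⟩
  · have : 0 < 1 - q := by linarith
    positivity
  let bad : ℕ → Set Ω := fun n => ⋃ k ∈ Finset.range (2 ^ n),
    {ω | a / 10 * (9 / 10) ^ n < |B ((k + 1 : ℕ) * T / 2 ^ n) ω - B (k * T / 2 ^ n) ω|}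
  have hbad : ∀ n, P (bad n) ≤
      ENNReal.ofReal (10 ^ 4 * (T : ℝ) ^ 2 * gaussianFourth.toReal / a ^ 4 * q ^ n) := by
    intro n
    have h1 : ∀ k ∈ Finset.range (2 ^ n),
        P {ω | a / 10 * (9 / 10) ^ n < |B ((k + 1 : ℕ) * T / 2 ^ n) ω - B (k * T / 2 ^ n) ω|} ≤
        ENNReal.ofReal (((T : ℝ) / 2 ^ n) ^ 2 / (a / 10 * (9 / 10) ^ n) ^ 4 *
          gaussianFourth.toReal) := by
      intro k _
      refine (measure_lt_abs_sub_le hB _ _ (by positivity)).trans (le_of_eq ?_)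
      rw [ENNReal.ofReal_mul (by positivity), ENNReal.ofReal_toReal gaussianFourth_ne_top]
      congr 4
      push_cast
      ring
    refine (measure_biUnion_finset_le _ _).trans ((Finset.sum_le_sum h1).trans ?_)
    rw [Finset.sum_const, Finset.card_range, nsmul_eq_mul, ← ENNReal.ofReal_natCast,
      ← ENNReal.ofReal_mul (by positivity)]
    refine ENNReal.ofReal_le_ofReal (le_of_eq ?_)
    have hq : q ^ n = 1 / (2 ^ n * ((9 / 10) ^ n) ^ 4) := by
      simp only [q]
      rw [div_pow, one_pow, mul_pow, ← pow_mul, mul_comm 4 n, pow_mul]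
    have hx : (0 : ℝ) < (9 / 10) ^ n := by positivity
    rw [hq]
    generalize (9 / 10 : ℝ) ^ n = x at hx ⊢
    push_cast
    field_simp
  have hsub : P {ω | ∃ t ≤ T, a < |B t ω|} ≤ P (⋃ n, bad n) := by
    refine measure_mono_ae ?_
    filter_upwards [hB.cont, hB.eval_zero_ae_eq_zero] with ω hc h0 hω
    obtain ⟨t, ht, hat⟩ := hω
    change ω ∈ ⋃ n, bad n
    by_contra hn
    refine absurd hat (not_lt.2 (abs_le_of_dyadic_increments hc h0 hT ha.le ?_ ht))
    intro n k hk
    by_contra! hlt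
    exact hn (Set.mem_iUnion.2 ⟨n, Set.mem_biUnion (Finset.mem_coe.2 (Finset.mem_range.2 hk)) hlt⟩)
  refine hsub.trans ((measure_iUnion_le _).trans ((ENNReal.tsum_le_tsum hbad).trans ?_))
  rw [← ENNReal.ofReal_tsum_of_nonneg (fun n => by positivity)
    ((summable_geometric_of_lt_one hq0 hq1).mul_left _), tsum_mul_left,
    tsum_geometric_of_lt_one hq0 hq1]
  exact ENNReal.ofReal_le_ofReal (le_of_eq (by ring))

/-- The probability that path j exceeds δ|j| before time T is of order j^{-4}, which is summable, so
Borel–Cantelli applies. Countably many δ = 1/(m+1) and T = n+1 suffice by monotonicity. -/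
lemma IsBrownianFamily.ae_sublinear {W : ℤ → ℝ≥0 → Ω → ℝ} (hW : IsBrownianFamily W P) :
    ∀ᵐ ω ∂P, ∀ (T : ℝ≥0) (δ : ℝ), 0 < δ →
      ∀ᶠ j : ℤ in cofinite, ∀ t ≤ T, |W j t ω| ≤ δ * |(j : ℝ)| := by
  have key : ∀ m n : ℕ, ∀ᵐ ω ∂P, ∀ᶠ j : ℤ in cofinite, ∀ t ≤ (n + 1 : ℝ≥0),
      |W j t ω| ≤ (1 / (m + 1 : ℝ)) * |(j : ℝ)| := by
    intro m n
    obtain ⟨K, hK, hKb⟩ := exists_measure_sup_le (P := P) (n + 1 : ℝ≥0) (by positivity)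
    -- The label 0 is excluded since its threshold is zero.
    let s : ℤ → Set Ω := fun j =>
      {ω | j ≠ 0 ∧ ∃ t ≤ (n + 1 : ℝ≥0), 1 / (m + 1 : ℝ) * |(j : ℝ)| < |W j t ω|}
    have hs : ∀ j, P (s j) ≤ ENNReal.ofReal (K * (m + 1) ^ 4 * (1 / (j : ℝ) ^ 4)) := by
      intro j
      by_cases hj : j = 0
      · simp [s, hj]
      · have hpos : 0 < |(j : ℝ)| := by positivity
        refine (measure_mono fun ω hω => hω.2).trans
          ((hKb (W j) (hW.brownian j) _ (by positivity)).trans (le_of_eq ?_))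
        congr 1
        rw [mul_pow, Even.pow_abs (by decide)]
        field_simp
    have hsum : ∑' j, P (s j) ≠ ∞ := by
      refine ne_top_of_le_ne_top ?_ (ENNReal.tsum_le_tsum hs)
      have hsm : Summable fun j : ℤ => K * (m + 1 : ℝ) ^ 4 * (1 / (j : ℝ) ^ 4) :=
        (Real.summable_one_div_int_pow.2 (by norm_num)).mul_left _
      rw [← ENNReal.ofReal_tsum_of_nonneg (fun j => by positivity) hsm]
      exact ENNReal.ofReal_ne_top
    filter_upwards [ae_finite_setOfPred_mem hsum] with ω hω
    have h0 : ∀ᶠ j : ℤ in cofinite, j ≠ 0 := (Set.finite_singleton 0).subset (by simp)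
    have h1 : ∀ᶠ j : ℤ in cofinite, ω ∉ s j := eventually_cofinite.2 (by simpa using hω)
    filter_upwards [h0, h1] with j hj0 hj t ht
    by_contra! hlt
    exact hj ⟨hj0, t, ht, hlt⟩
  filter_upwards [ae_all_iff.2 fun m => ae_all_iff.2 (key m)] with ω hω T δ hδ
  obtain ⟨m, hm⟩ := exists_nat_one_div_lt hδ
  obtain ⟨n, hn⟩ := exists_nat_ge T
  filter_upwards [hω m n] with j hj t ht
  refine (hj t (ht.trans (hn.trans (by simp)))).trans ?_
  gcongr

end SingleFile

namespace SingleFile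

/-! ### Sums of independent bounded variables -/

variable {Ω : Type*} [MeasurableSpace Ω] {P : Measure Ω}

lemma lintegral_tsum_enorm_ne_top {ι : Type*} [Countable ι] {F : ι → Ω → ℝ}
    (hF : ∀ i, Integrable (F i) P) (hs : Summable fun i => ∫ ω, ‖F i ω‖ ∂P) :
    ∫⁻ ω, ∑' i, ‖F i ω‖ₑ ∂P ≠ ∞ := by
  rw [lintegral_tsum fun i => (hF i).1.enorm]
  have (i : ι) : ∫⁻ ω, ‖F i ω‖ₑ ∂P = ENNReal.ofReal (∫ ω, ‖F i ω‖ ∂P) :=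
    (ofReal_integral_norm_eq_lintegral_enorm (hF i)).symm
  simp only [this]
  rw [← ENNReal.ofReal_tsum_of_nonneg (fun i => integral_nonneg fun _ => norm_nonneg _) hs]
  exact ENNReal.ofReal_ne_top

lemma ae_summable_norm_of_summable_integral {ι : Type*} [Countable ι] {F : ι → Ω → ℝ}
    (hF : ∀ i, Integrable (F i) P) (hs : Summable fun i => ∫ ω, ‖F i ω‖ ∂P) :
    ∀ᵐ ω ∂P, Summable fun i => ‖F i ω‖ := by
  filter_upwards [ae_lt_top' (AEMeasurable.tsum fun i => (hF i).1.enorm)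
    (lintegral_tsum_enorm_ne_top hF hs)] with ω hω
  exact tsum_enorm_ne_top_iff_summable_norm.1 hω.ne

/-- A Chernoff-type bound on the moment generating function near `0` controls the sixth moment. -/
lemma lintegral_pow_six_le {Z : Ω → ℝ} (hZ : AEMeasurable Z P) {K : ℝ} (hK : 0 ≤ K)
    (h : ∀ l : ℝ, |l| ≤ 1 →
      ∫⁻ ω, ENNReal.ofReal (Real.exp (l * Z ω)) ∂P ≤ ENNReal.ofReal (Real.exp (K * l ^ 2))) :
    ∫⁻ ω, ENNReal.ofReal (Z ω ^ 6) ∂P ≤ ENNReal.ofReal (4320 * (1 + K) ^ 3) := by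
  -- With this l the exponent K l² is at most 1, so both exponential moments are at most e < 3,
  -- while x^6 ≤ 6! l^{-6} exp|lx|. This gives 720 · 6 = 4320.
  set l : ℝ := 1 / √(1 + K) with hl
  have hs : 0 < √(1 + K) := Real.sqrt_pos.2 (by linarith)
  have hs1 : 1 ≤ √(1 + K) := by rw [Real.one_le_sqrt]; linarith
  have hsq : √(1 + K) ^ 2 = 1 + K := Real.sq_sqrt (by linarith)
  have hl0 : 0 < l := by positivity
  have hl1 : |l| ≤ 1 := by
    rw [abs_of_pos hl0, hl, div_le_one hs]; exact hs1
  have hexp : Real.exp (K * l ^ 2) ≤ 3 := by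
    have : K * l ^ 2 ≤ 1 := by
      rw [hl, div_pow, one_pow, hsq, mul_one_div, div_le_one (by linarith)]; linarith
    exact (Real.exp_le_exp.2 this).trans (Real.exp_one_lt_d9.le.trans (by norm_num))
  have hpt : ∀ x : ℝ, x ^ 6 ≤ 720 * (1 + K) ^ 3 * (Real.exp (l * x) + Real.exp (-l * x)) := by
    intro x
    have h1 := Real.pow_div_factorial_le_exp _ (abs_nonneg (l * x)) 6
    rw [Even.pow_abs (by decide : Even 6)] at h1
    have h2 : Real.exp |l * x| ≤ Real.exp (l * x) + Real.exp (-l * x) := by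
      rcases abs_cases (l * x) with ⟨h, _⟩ | ⟨h, _⟩
      · rw [h]; linarith [Real.exp_pos (-l * x)]
      · rw [h, ← neg_mul]; linarith [Real.exp_pos (l * x)]
    have h3 : (l * x) ^ 6 = x ^ 6 / (1 + K) ^ 3 := by
      rw [← hsq, ← pow_mul, hl]; field_simp; ring
    have h4 : ((6).factorial : ℝ) = 720 := by norm_num [Nat.factorial]
    rw [h3, h4, div_div] at h1
    have h5 : (0 : ℝ) < (1 + K) ^ 3 * 720 := by positivity
    rw [div_le_iff₀ h5] at h1
    calc _ ≤ _ := h1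
      _ ≤ (Real.exp (l * x) + Real.exp (-l * x)) * ((1 + K) ^ 3 * 720) := by gcongr
      _ = _ := by ring
  calc ∫⁻ ω, ENNReal.ofReal (Z ω ^ 6) ∂P
      ≤ ∫⁻ ω, ENNReal.ofReal (720 * (1 + K) ^ 3) * (ENNReal.ofReal (Real.exp (l * Z ω)) +
          ENNReal.ofReal (Real.exp (-l * Z ω))) ∂P := by
        refine lintegral_mono fun ω => ?_
        rw [← ENNReal.ofReal_add (Real.exp_pos _).le (Real.exp_pos _).le,
          ← ENNReal.ofReal_mul (by positivity)]
        exact ENNReal.ofReal_le_ofReal (hpt _)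
    _ = ENNReal.ofReal (720 * (1 + K) ^ 3) * (∫⁻ ω, ENNReal.ofReal (Real.exp (l * Z ω)) ∂P +
          ∫⁻ ω, ENNReal.ofReal (Real.exp (-l * Z ω)) ∂P) := by
        rw [lintegral_const_mul'' _ (by fun_prop), lintegral_add_left' (by fun_prop)]
    _ ≤ ENNReal.ofReal (720 * (1 + K) ^ 3) * (ENNReal.ofReal 3 + ENNReal.ofReal 3) := by
        gcongr
        · exact (h l hl1).trans (ENNReal.ofReal_le_ofReal hexp)
        · refine (h (-l) (by rwa [abs_neg])).trans (ENNReal.ofReal_le_ofReal ?_)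
          rwa [neg_sq]
    _ = _ := by
        rw [← ENNReal.ofReal_add (by norm_num) (by norm_num), ← ENNReal.ofReal_mul (by positivity)]
        congr 1; ring

lemma integrable_of_abs_le_one [IsFiniteMeasure P] {Z : Ω → ℝ} (hm : AEMeasurable Z P)
    (h1 : ∀ ω, |Z ω| ≤ 1) : Integrable Z P :=
  Integrable.of_bound hm.aestronglyMeasurable 1 (ae_of_all _ h1)

/-- From exp x ≤ 1 + x + x² for |x| ≤ 1: the linear term vanishes by centering and the variance is
at most E Z² ≤ E|Z|. The unit interval keeps the centred variable, not only Z, bounded by 1. -/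
lemma lintegral_exp_centered_le [IsProbabilityMeasure P] {Z : Ω → ℝ} (hm : Measurable Z) {c : ℝ}
    (hc : ∀ ω, Z ω ∈ Set.Icc c (c + 1)) (h1 : ∀ ω, |Z ω| ≤ 1) {l : ℝ} (hl : |l| ≤ 1) :
    mgf (fun ω => Z ω - ∫ ω, Z ω ∂P) P l ≤ Real.exp (l ^ 2 * ∫ ω, |Z ω| ∂P) := by
  have hi := integrable_of_abs_le_one (P := P) hm.aemeasurable h1
  set m := ∫ ω, Z ω ∂P with hmdef
  have hm1 : c ≤ m := by
    have := integral_mono (integrable_const c) hi fun ω => (hc ω).1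
    simpa using this
  have hm2 : m ≤ c + 1 := by
    have := integral_mono hi (integrable_const (c + 1)) fun ω => (hc ω).2
    simpa using this
  have hb : ∀ ω, |Z ω - m| ≤ 1 := fun ω => by
    rw [abs_le]; constructor <;> linarith [(hc ω).1, (hc ω).2]
  have hic : Integrable (fun ω => Z ω - m) P := hi.sub (integrable_const _)
  have hisq : Integrable (fun ω => (Z ω - m) ^ 2) P :=
    Integrable.of_bound ((hm.sub_const _).pow_const 2).aestronglyMeasurable 1
      (ae_of_all _ fun ω => by
        rw [Real.norm_eq_abs, abs_pow]; exact pow_le_one₀ (abs_nonneg _) (hb ω))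
  have hisq2 : Integrable (fun ω => (Z ω) ^ 2) P :=
    Integrable.of_bound (hm.pow_const 2).aestronglyMeasurable 1
      (ae_of_all _ fun ω => by
        rw [Real.norm_eq_abs, abs_pow]; exact pow_le_one₀ (abs_nonneg _) (h1 ω))
  have hpt : ∀ ω, Real.exp (l * (Z ω - m)) ≤ 1 + l * (Z ω - m) + l ^ 2 * (Z ω - m) ^ 2 := by
    intro ω
    have h2 : |l * (Z ω - m)| ≤ 1 := by
      rw [abs_mul]; exact mul_le_one₀ hl (abs_nonneg _) (hb ω)
    have := (abs_le.1 (Real.abs_exp_sub_one_sub_id_le h2)).2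
    nlinarith
  have hie : Integrable (fun ω => Real.exp (l * (Z ω - m))) P := by
    refine Integrable.of_bound ((hm.sub_const m).const_mul l).exp.aestronglyMeasurable (Real.exp 1) (ae_of_all _ fun ω => ?_)
    rw [Real.norm_eq_abs, abs_of_pos (Real.exp_pos _), Real.exp_le_exp]
    refine (le_abs_self _).trans ?_
    rw [abs_mul]; exact mul_le_one₀ hl (abs_nonneg _) (hb ω)
  have hvar : ∫ ω, (Z ω - m) ^ 2 ∂P ≤ ∫ ω, |Z ω| ∂P := by
    have h3 : ∫ ω, (Z ω - m) ^ 2 ∂P = ∫ ω, (Z ω) ^ 2 ∂P - m ^ 2 := by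
      have : ∀ ω, (Z ω - m) ^ 2 = (Z ω) ^ 2 - (2 * m * Z ω - m ^ 2) := fun ω => by ring
      simp only [this]
      have e1 : Integrable (fun ω => 2 * m * Z ω - m ^ 2) P :=
        (hi.const_mul _).sub (integrable_const _)
      rw [integral_sub hisq2 e1, integral_sub (hi.const_mul _) (integrable_const _), integral_const_mul, ← hmdef]
      simp; ring
    rw [h3]
    have h4 : ∫ ω, (Z ω) ^ 2 ∂P ≤ ∫ ω, |Z ω| ∂P := by
      refine integral_mono hisq2 hi.abs fun ω => ?_
      have := h1 ω
      have h0 := abs_nonneg (Z ω)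
      simp only
      rw [← sq_abs]; nlinarith
    nlinarith [sq_nonneg m]
  calc mgf (fun ω => Z ω - m) P l
      ≤ ∫ ω, (1 + l * (Z ω - m) + l ^ 2 * (Z ω - m) ^ 2) ∂P :=
        integral_mono hie (((integrable_const _).add (hic.const_mul _)).add (hisq.const_mul _)) hpt
    _ = 1 + l ^ 2 * ∫ ω, (Z ω - m) ^ 2 ∂P := by
        have e2 : Integrable (fun ω => 1 + l * (Z ω - m)) P :=
          (integrable_const _).add (hic.const_mul _)
        rw [integral_add e2 (hisq.const_mul _),
          integral_add (integrable_const _) (hic.const_mul _), integral_const_mul,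
          integral_const_mul, integral_sub hi (integrable_const _), ← hmdef]
        simp
    _ ≤ 1 + l ^ 2 * ∫ ω, |Z ω| ∂P := by gcongr
    _ ≤ _ := by
        have := Real.add_one_le_exp (l ^ 2 * ∫ ω, |Z ω| ∂P)
        linarith

/-- Sixth central moment of a sum of independent variables, each with values in an interval of
length one that contains `0`. -/
lemma lintegral_tsum_sub_pow_six_le [IsProbabilityMeasure P] {Z : ℤ → Ω → ℝ}
    (hm : ∀ j, Measurable (Z j)) {c : ℤ → ℝ} (hc : ∀ j ω, Z j ω ∈ Set.Icc (c j) (c j + 1))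
    (h1 : ∀ j ω, |Z j ω| ≤ 1) (hind : iIndepFun Z P) (hs : Summable fun j => ∫ ω, |Z j ω| ∂P) :
    ∫⁻ ω, ENNReal.ofReal ((∑' j, Z j ω - ∑' j, ∫ ω, Z j ω ∂P) ^ 6) ∂P ≤
      ENNReal.ofReal (4320 * (1 + ∑' j, ∫ ω, |Z j ω| ∂P) ^ 3) := by
  have hi : ∀ j, Integrable (Z j) P := fun j =>
    integrable_of_abs_le_one (hm j).aemeasurable (h1 j)
  have hnn : ∀ j, 0 ≤ ∫ ω, |Z j ω| ∂P := fun j => integral_nonneg fun _ => abs_nonneg _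
  have hsm : Summable fun j => ∫ ω, Z j ω ∂P :=
    hs.of_norm_bounded fun j => norm_integral_le_integral_norm _
  refine lintegral_pow_six_le ((AEMeasurable.tsum fun j => (hm j).aemeasurable).sub_const _)
    (tsum_nonneg hnn) fun l hl => ?_
  have hfin : ∀ F : Finset ℤ, ∫⁻ ω, ENNReal.ofReal (Real.exp (l * ∑ j ∈ F,
      (Z j ω - ∫ ω, Z j ω ∂P))) ∂P ≤ ENNReal.ofReal (Real.exp ((∑' j, ∫ ω, |Z j ω| ∂P) * l ^ 2)) := by
    intro F
    have hind' : iIndepFun (fun j ω => Z j ω - ∫ ω, Z j ω ∂P) P :=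
      hind.comp (fun j x => x - ∫ ω, Z j ω ∂P) (fun j => by fun_prop)
    have hmgf := hind'.mgf_sum (t := l) (fun j => (hm j).sub_const _) F
    have hint : Integrable (fun ω => Real.exp (l * ∑ j ∈ F, (Z j ω - ∫ ω, Z j ω ∂P))) P := by
      have hmeas : Measurable fun ω => ∑ j ∈ F, (Z j ω - ∫ ω, Z j ω ∂P) :=
        Finset.measurable_sum _ fun j _ => (hm j).sub_const _
      refine Integrable.of_bound (hmeas.const_mul l).exp.aestronglyMeasurable
        (Real.exp (∑ j ∈ F, (1 + |∫ ω, Z j ω ∂P|))) (ae_of_all _ fun ω => ?_)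
      rw [Real.norm_eq_abs, abs_of_pos (Real.exp_pos _), Real.exp_le_exp]
      refine (le_abs_self _).trans ?_
      rw [abs_mul]
      refine (mul_le_of_le_one_left (abs_nonneg _) hl).trans
        ((Finset.abs_sum_le_sum_abs _ _).trans (Finset.sum_le_sum fun j _ => ?_))
      exact (abs_sub _ _).trans (by gcongr; exact h1 j ω)
    rw [← ofReal_integral_eq_lintegral_ofReal hint (ae_of_all _ fun _ => (Real.exp_pos _).le)]
    refine ENNReal.ofReal_le_ofReal ?_
    have h2 : ∫ ω, Real.exp (l * ∑ j ∈ F, (Z j ω - ∫ ω, Z j ω ∂P)) ∂P =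
        ∏ j ∈ F, mgf (fun ω => Z j ω - ∫ ω, Z j ω ∂P) P l := by
      rw [← hmgf]; simp [mgf, Finset.sum_apply]
    rw [h2]
    calc _ ≤ ∏ j ∈ F, Real.exp (l ^ 2 * ∫ ω, |Z j ω| ∂P) :=
          Finset.prod_le_prod (fun _ _ => mgf_nonneg)
            fun j _ => lintegral_exp_centered_le (hm j) (hc j) (h1 j) hl
      _ = Real.exp (l ^ 2 * ∑ j ∈ F, ∫ ω, |Z j ω| ∂P) := by
          rw [← Real.exp_sum, Finset.mul_sum]
      _ ≤ _ := by
          rw [mul_comm (l ^ 2)]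
          gcongr
          exact hs.sum_le_tsum _ fun j _ => hnn j
  -- Fatou's lemma carries the uniform exponential bound from finite partial sums to the series.
  calc _ ≤ ∫⁻ ω, liminf (fun F : Finset ℤ => ENNReal.ofReal (Real.exp (l * ∑ j ∈ F,
      (Z j ω - ∫ ω, Z j ω ∂P)))) atTop ∂P := by
        refine lintegral_mono_ae ?_
        filter_upwards [ae_summable_norm_of_summable_integral hi hs] with ω hω
        have h3 : Tendsto (fun F : Finset ℤ => ENNReal.ofReal (Real.exp (l * ∑ j ∈ F,
            (Z j ω - ∫ ω, Z j ω ∂P)))) atTop (𝓝 (ENNReal.ofReal (Real.exp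
              (l * (∑' j, Z j ω - ∑' j, ∫ ω, Z j ω ∂P))))) := by
          refine (ENNReal.continuous_ofReal.tendsto _).comp ((Real.continuous_exp.tendsto _).comp
            (Tendsto.const_mul _ ?_))
          exact hω.of_norm.hasSum.sub hsm.hasSum
        exact h3.liminf_eq.ge
    _ ≤ liminf (fun F : Finset ℤ => ∫⁻ ω, ENNReal.ofReal (Real.exp (l * ∑ j ∈ F,
      (Z j ω - ∫ ω, Z j ω ∂P))) ∂P) atTop := by
        refine lintegral_liminf_le fun F => ?_
        have hmeas : Measurable fun ω => ∑ j ∈ F, (Z j ω - ∫ ω, Z j ω ∂P) :=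
          Finset.measurable_sum _ fun j _ => (hm j).sub_const _
        exact (hmeas.const_mul l).exp.ennreal_ofReal
    _ ≤ _ := by
        refine (liminf_le_liminf (Eventually.of_forall hfin)).trans ?_
        simp

/-- The covariance of two sums of variables that are independent for different labels. -/
lemma hasSum_integral_mul_sub [IsProbabilityMeasure P] {Z Z' : ℤ → Ω → ℝ}
    (hm : ∀ j, Measurable (Z j)) (hm' : ∀ j, Measurable (Z' j)) (h1 : ∀ j ω, |Z j ω| ≤ 1)
    (h1' : ∀ j ω, |Z' j ω| ≤ 1) (hind : ∀ i j, i ≠ j → IndepFun (Z i) (Z' j) P)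
    (hs : Summable fun j => ∫ ω, |Z j ω| ∂P) (hs' : Summable fun j => ∫ ω, |Z' j ω| ∂P) :
    HasSum (fun j => ∫ ω, Z j ω * Z' j ω ∂P - (∫ ω, Z j ω ∂P) * ∫ ω, Z' j ω ∂P)
      (∫ ω, (∑' j, Z j ω) * (∑' j, Z' j ω) ∂P -
        (∫ ω, ∑' j, Z j ω ∂P) * ∫ ω, ∑' j, Z' j ω ∂P) := by
  have hi : ∀ j, Integrable (Z j) P := fun j =>
    integrable_of_abs_le_one (hm j).aemeasurable (h1 j)
  have hi' : ∀ j, Integrable (Z' j) P := fun j =>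
    integrable_of_abs_le_one (hm' j).aemeasurable (h1' j)
  have hnn : ∀ j, 0 ≤ ∫ ω, |Z j ω| ∂P := fun j => integral_nonneg fun _ => abs_nonneg _
  have hnn' : ∀ j, 0 ≤ ∫ ω, |Z' j ω| ∂P := fun j => integral_nonneg fun _ => abs_nonneg _
  have habs : ∀ i j ω, |Z i ω * Z' j ω| ≤ 1 := fun i j ω => by
    rw [abs_mul]; exact mul_le_one₀ (h1 i ω) (abs_nonneg _) (h1' j ω)
  have hii : ∀ p : ℤ × ℤ, Integrable (fun ω => Z p.1 ω * Z' p.2 ω) P := fun p =>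
    integrable_of_abs_le_one ((hm _).mul (hm' _)).aemeasurable (habs _ _)
  have hprod : ∀ p : ℤ × ℤ, p.1 ≠ p.2 → ∫ ω, ‖Z p.1 ω * Z' p.2 ω‖ ∂P =
      (∫ ω, |Z p.1 ω| ∂P) * ∫ ω, |Z' p.2 ω| ∂P := by
    intro p hp
    simp only [Real.norm_eq_abs, abs_mul]
    exact ((hind _ _ hp).comp measurable_norm measurable_norm).integral_fun_mul_eq_mul_integral
      (hi _).abs.1 (hi' _).abs.1
  have hsp : Summable fun p : ℤ × ℤ => (∫ ω, |Z p.1 ω| ∂P) * ∫ ω, |Z' p.2 ω| ∂P :=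
    hs.mul_of_nonneg hs' hnn hnn'
  have hdiag : Summable fun p : ℤ × ℤ => if p.1 = p.2 then ∫ ω, |Z p.1 ω| ∂P else 0 := by
    have hinj : Function.Injective fun j : ℤ => (j, j) := fun a b h => (Prod.ext_iff.1 h).1
    refine (hinj.summable_iff (f := fun p : ℤ × ℤ =>
      if p.1 = p.2 then ∫ ω, |Z p.1 ω| ∂P else 0) ?_).1 (by simpa [Function.comp_def] using hs)
    rintro ⟨a, b⟩ hx
    simp only
    refine if_neg fun hab => hx ⟨a, by simp [hab]⟩
  -- Absolute convergence of the double series: off the diagonal the moments factor by independence,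
  -- and on the diagonal one factor is bounded by 1.
  have hsum : Summable fun p : ℤ × ℤ => ∫ ω, ‖Z p.1 ω * Z' p.2 ω‖ ∂P := by
    refine Summable.of_nonneg_of_le (fun p => integral_nonneg fun _ => norm_nonneg _)
      (fun p => ?_) (hsp.add hdiag)
    by_cases hp : p.1 = p.2
    · rw [if_pos hp]
      have : ∫ ω, ‖Z p.1 ω * Z' p.2 ω‖ ∂P ≤ ∫ ω, |Z p.1 ω| ∂P := by
        refine integral_mono (hii p).norm (hi _).abs fun ω => ?_
        simp only [Real.norm_eq_abs, abs_mul]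
        exact mul_le_of_le_one_right (abs_nonneg _) (h1' _ _)
      have := mul_nonneg (hnn p.1) (hnn' p.2)
      linarith
    · rw [if_neg hp, hprod p hp, add_zero]
  have hA := hasSum_integral_of_summable_integral_norm hii hsum
  have hB := hasSum_integral_of_summable_integral_norm hi hs
  have hB' := hasSum_integral_of_summable_integral_norm hi' hs'
  have hsZ : Summable fun j => ‖∫ ω, Z j ω ∂P‖ :=
    Summable.of_nonneg_of_le (fun _ => norm_nonneg _)
      (fun j => norm_integral_le_integral_norm _) hs
  have hsZ' : Summable fun j => ‖∫ ω, Z' j ω ∂P‖ :=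
    Summable.of_nonneg_of_le (fun _ => norm_nonneg _)
      (fun j => norm_integral_le_integral_norm _) hs'
  have hC := hB.mul hB' (summable_mul_of_summable_norm hsZ hsZ')
  have hD := hA.sub hC
  have hE : ∫ ω, ∑' p : ℤ × ℤ, Z p.1 ω * Z' p.2 ω ∂P =
      ∫ ω, (∑' j, Z j ω) * (∑' j, Z' j ω) ∂P := by
    refine integral_congr_ae ?_
    filter_upwards [ae_summable_norm_of_summable_integral hi hs,
      ae_summable_norm_of_summable_integral hi' hs'] with ω h2 h3
    exact (tsum_mul_tsum_of_summable_norm h2 h3).symm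
  rw [hE] at hD
  have hinj : Function.Injective fun j : ℤ => (j, j) := fun a b h => (Prod.ext_iff.1 h).1
  -- Off-diagonal covariances vanish, so the double sum reduces to the diagonal.
  refine (hinj.hasSum_iff (f := fun p : ℤ × ℤ => ∫ ω, Z p.1 ω * Z' p.2 ω ∂P -
    (∫ ω, Z p.1 ω ∂P) * ∫ ω, Z' p.2 ω ∂P) ?_).2 hD
  rintro ⟨a, b⟩ hx
  have hab : a ≠ b := fun hab => hx ⟨a, by simp [hab]⟩
  simp only
  rw [(hind a b hab).integral_fun_mul_eq_mul_integral (hi _).1 (hi' _).1, sub_self]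

lemma memLp_two_of_lintegral_pow_six [IsFiniteMeasure P] {Z : Ω → ℝ} (hm : AEMeasurable Z P)
    (h : ∫⁻ ω, ENNReal.ofReal (Z ω ^ 6) ∂P ≠ ∞) : MemLp Z 2 P := by
  rw [memLp_two_iff_integrable_sq hm.aestronglyMeasurable]
  have h6 : Integrable (fun ω => Z ω ^ 6) P := by
    refine ⟨(hm.pow_const 6).aestronglyMeasurable, ?_⟩
    rw [hasFiniteIntegral_iff_ofReal (ae_of_all _ fun ω => by positivity)]
    exact h.lt_top
  refine ((integrable_const (1 : ℝ)).add h6).mono' (hm.pow_const 2).aestronglyMeasurable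
    (ae_of_all _ fun ω => ?_)
  rw [Real.norm_eq_abs, abs_of_nonneg (sq_nonneg _)]
  simp only [Pi.add_apply]
  have : Z ω ^ 6 = (Z ω ^ 2) ^ 3 := by ring
  rw [this]
  nlinarith [sq_nonneg (Z ω), sq_nonneg (Z ω ^ 2 - 1)]

end SingleFile

namespace SingleFile

/-! ### Moments of the signed count for a fixed initial configuration -/

variable {Ω : Type*} [MeasurableSpace Ω] {P : Measure Ω}

/-- Displacements of the non-interacting particles at two times: they are independent and
identically distributed with respect to the label. -/
structure IsNoisePair (ξ η : ℤ → Ω → ℝ) (P : Measure Ω) : Prop where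
  measurable_left : ∀ j, Measurable (ξ j)
  measurable_right : ∀ j, Measurable (η j)
  indep : iIndepFun (fun j ω => (ξ j ω, η j ω)) P
  ident : ∀ j, IdentDistrib (fun ω => (ξ j ω, η j ω)) (fun ω => (ξ 0 ω, η 0 ω)) P P
  integrable_left : Integrable (ξ 0) P
  integrable_right : Integrable (η 0) P

lemma IsNoisePair.swap {ξ η : ℤ → Ω → ℝ} (h : IsNoisePair ξ η P) : IsNoisePair η ξ P where
  measurable_left := h.measurable_right
  measurable_right := h.measurable_left
  indep := h.indep.comp (fun _ p => (p.2, p.1)) (fun _ => by fun_prop)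
  ident j := (h.ident j).comp (u := fun p : ℝ × ℝ => (p.2, p.1)) (by fun_prop)
  integrable_left := h.integrable_right
  integrable_right := h.integrable_left

lemma measurable_stepTerm_comp {u x : Ω → ℝ} (hu : Measurable u) (hx : Measurable x) (j : ℤ) :
    Measurable fun ω => stepTerm (u ω) j (x ω) :=
  (measurable_stepTerm j).comp (hu.prodMk hx)

lemma measurable_crossing_comp {u : Ω → ℝ} (hu : Measurable u) (y : ℤ → ℝ) :
    Measurable fun ω => crossing y (u ω) :=
  measurable_crossing.comp (measurable_const.prodMk hu)

lemma IsNice.integrable_crossing [IsFiniteMeasure P] {y : ℤ → ℝ} (hy : IsNice y) {V : Ω → ℝ}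
    (hV : Measurable V) (hVi : Integrable V P) : Integrable (fun ω => crossing y (V ω)) P := by
  obtain ⟨C, hC, h⟩ := hy.abs_crossing_le
  exact (((integrable_const (1 : ℝ)).add hVi.abs).const_mul C).mono'
    (measurable_crossing_comp hV y).aestronglyMeasurable (ae_of_all _ fun ω => h _)

lemma IsNice.hasSum_integral_stepTerm [IsFiniteMeasure P] {y : ℤ → ℝ} (hy : IsNice y)
    {V : Ω → ℝ} (hV : Measurable V) (hVi : Integrable V P) :
    HasSum (fun j => ∫ ω, stepTerm (V ω) j (y j) ∂P) (∫ ω, crossing y (V ω) ∂P) ∧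
      HasSum (fun j => ∫ ω, |stepTerm (V ω) j (y j)| ∂P) (∫ ω, |crossing y (V ω)| ∂P) := by
  have hi := (hy.integrable_crossing hV hVi).abs
  have ht : ∀ ω, ∑' j, |stepTerm (V ω) j (y j)| = |crossing y (V ω)| := fun ω =>
    (hy.hasSum_abs_stepTerm (V ω)).tsum_eq
  constructor
  · refine hasSum_integral_of_dominated_convergence (fun j ω => |stepTerm (V ω) j (y j)|)
      (fun j => (measurable_stepTerm_comp hV measurable_const j).aestronglyMeasurable)
      (fun j => ae_of_all _ fun ω => le_rfl)
      (ae_of_all _ fun ω => (hy.hasSum_abs_stepTerm (V ω)).summable) ?_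
      (ae_of_all _ fun ω => hy.hasSum_stepTerm (V ω))
    simpa only [ht] using hi
  · refine hasSum_integral_of_dominated_convergence (fun j ω => |stepTerm (V ω) j (y j)|)
      (fun j => (measurable_stepTerm_comp hV measurable_const j).abs.aestronglyMeasurable)
      (fun j => ae_of_all _ fun ω => by simp)
      (ae_of_all _ fun ω => (hy.hasSum_abs_stepTerm (V ω)).summable) ?_
      (ae_of_all _ fun ω => hy.hasSum_abs_stepTerm (V ω))
    simpa only [ht] using hi

section Fixed

variable {y : ℤ → ℝ} {ξ η : ℤ → Ω → ℝ}

/-- Shifting a particle amounts to shifting the level the other way, and all displacements have the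
same law. Every label may thus use the displacement of particle 0, and sums over labels become the
initial counting function at one random level. -/
lemma IsNoisePair.integral_stepTerm (h : IsNoisePair ξ η P) (f : ℝ → ℝ) (hf : Measurable f)
    (u x : ℝ) (j : ℤ) :
    ∫ ω, f (stepTerm u j (x + ξ j ω)) ∂P = ∫ ω, f (stepTerm (u - ξ 0 ω) j x) ∂P := by
  have h1 : ∀ e, stepTerm u j (x + e) = stepTerm (u - e) j x := stepTerm_add u j x
  have hm : Measurable fun e : ℝ => f (stepTerm u j (x + e)) :=
    hf.comp (measurable_stepTerm_comp measurable_const (measurable_const_add x) j)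
  have h2 := (((h.ident j).comp measurable_fst).comp hm).integral_eq
  simp only [Function.comp_def] at h2
  rw [h2]
  simp only [h1]

lemma IsNoisePair.measurable_term (h : IsNoisePair ξ η P) (u x : ℝ) (j : ℤ) :
    Measurable fun ω => stepTerm u j (x + ξ j ω) :=
  measurable_stepTerm_comp measurable_const ((h.measurable_left j).const_add x) j

lemma IsNoisePair.measurable_crossing (h : IsNoisePair ξ η P) (u : ℝ) :
    Measurable fun ω => crossing (fun j => y j + ξ j ω) u :=
  SingleFile.measurable_crossing.comp
    ((measurable_pi_lambda _ fun j => (h.measurable_left j).const_add (y j)).prodMk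
      measurable_const)

variable [IsProbabilityMeasure P]

lemma IsNoisePair.hasSum_stepTerm (h : IsNoisePair ξ η P) (hy : IsNice y) (u : ℝ) :
    HasSum (fun j => ∫ ω, stepTerm u j (y j + ξ j ω) ∂P) (∫ ω, crossing y (u - ξ 0 ω) ∂P) ∧
      HasSum (fun j => ∫ ω, |stepTerm u j (y j + ξ j ω)| ∂P)
        (∫ ω, |crossing y (u - ξ 0 ω)| ∂P) := by
  have hs := hy.hasSum_integral_stepTerm (P := P) (V := fun ω => u - ξ 0 ω)
    ((h.measurable_left 0).const_sub u) ((integrable_const u).sub h.integrable_left)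
  have h1 := fun j => h.integral_stepTerm id measurable_id u (y j) j
  have h2 := fun j => h.integral_stepTerm (fun x => |x|) measurable_norm u (y j) j
  simp only [id] at h1
  simpa only [h1, h2] using hs

lemma IsNoisePair.integrable_term (h : IsNoisePair ξ η P) (u x : ℝ) (j : ℤ) :
    Integrable (fun ω => stepTerm u j (x + ξ j ω)) P :=
  integrable_of_abs_le_one (h.measurable_term u x j).aemeasurable fun _ => abs_stepTerm_le_one _ _ _

lemma IsNoisePair.integral_crossing (h : IsNoisePair ξ η P) (hy : IsNice y) (u : ℝ) :
    ∫ ω, crossing (fun j => y j + ξ j ω) u ∂P = ∫ ω, crossing y (u - ξ 0 ω) ∂P := by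
  have h1 := hasSum_integral_of_summable_integral_norm (fun j => h.integrable_term u (y j) j)
    (h.hasSum_stepTerm hy u).2.summable
  exact h1.unique (h.hasSum_stepTerm hy u).1

lemma IsNoisePair.lintegral_pow_six_le (h : IsNoisePair ξ η P) (hy : IsNice y) (u : ℝ) :
    ∫⁻ ω, ENNReal.ofReal ((crossing (fun j => y j + ξ j ω) u -
        ∫ ω, crossing y (u - ξ 0 ω) ∂P) ^ 6) ∂P ≤
      ENNReal.ofReal (4320 * (1 + ∫ ω, |crossing y (u - ξ 0 ω)| ∂P) ^ 3) := by
  have hs := h.hasSum_stepTerm hy u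
  have hind : iIndepFun (fun j ω => stepTerm u j (y j + ξ j ω)) P :=
    h.indep.comp (fun j p => stepTerm u j (y j + p.1)) fun j =>
      measurable_stepTerm_comp measurable_const (measurable_fst.const_add _) j
  have := lintegral_tsum_sub_pow_six_le (P := P) (fun j => h.measurable_term u (y j) j)
    (c := fun j => if j < 0 then -1 else 0) (fun j ω => ?_) (fun j ω => abs_stepTerm_le_one _ _ _)
    hind hs.2.summable
  · rwa [hs.1.tsum_eq, hs.2.tsum_eq] at this
  · unfold stepTerm
    split_ifs <;> constructor <;> norm_num

lemma IsNoisePair.memLp_crossing (h : IsNoisePair ξ η P) (hy : IsNice y) (u : ℝ) :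
    MemLp (fun ω => crossing (fun j => y j + ξ j ω) u) 2 P := by
  have h1 := memLp_two_of_lintegral_pow_six (P := P)
    (Z := fun ω => crossing (fun j => y j + ξ j ω) u - ∫ ω, crossing y (u - ξ 0 ω) ∂P)
    ((h.measurable_crossing u).sub_const _).aemeasurable
    (ne_top_of_le_ne_top ENNReal.ofReal_ne_top (h.lintegral_pow_six_le hy u))
  have h2 := h1.add (memLp_const (∫ ω, crossing y (u - ξ 0 ω) ∂P))
  refine h2.ae_eq (ae_of_all _ fun ω => ?_)
  simp

/-- Only equal labels contribute. For label j, a product of indicators of half-lines is the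
indicator at the minimum of the levels, and the product of means has the same form with the
independent copy η 1 in place of η 0. Summing over j gives the initial counting function at the two
random minima. -/
lemma IsNoisePair.covariance_crossing (h : IsNoisePair ξ η P) (hy : IsNice y) (u v : ℝ) :
    ∫ ω, crossing (fun j => y j + ξ j ω) u * crossing (fun j => y j + η j ω) v ∂P -
        (∫ ω, crossing (fun j => y j + ξ j ω) u ∂P) *
          ∫ ω, crossing (fun j => y j + η j ω) v ∂P =
      ∫ ω, crossing y (min (u - ξ 0 ω) (v - η 0 ω)) ∂P -
        ∫ ω, crossing y (min (u - ξ 0 ω) (v - η 1 ω)) ∂P := by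
  have hmξ := h.measurable_left
  have hmη := h.measurable_right
  have hη1 : Integrable (η 1) P :=
    (((h.ident 1).comp measurable_snd).integrable_iff).2 h.integrable_right
  have hS := hasSum_integral_mul_sub (P := P) (fun j => h.measurable_term u (y j) j)
    (fun j => h.swap.measurable_term v (y j) j) (fun j ω => abs_stepTerm_le_one _ _ _)
    (fun j ω => abs_stepTerm_le_one _ _ _)
    (fun i j hij => (h.indep.indepFun hij).comp (φ := fun p : ℝ × ℝ => stepTerm u i (y i + p.1))
      (ψ := fun p : ℝ × ℝ => stepTerm v j (y j + p.2))
      (measurable_stepTerm_comp measurable_const (measurable_fst.const_add _) i)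
      (measurable_stepTerm_comp measurable_const (measurable_snd.const_add _) j))
    (h.hasSum_stepTerm hy u).2.summable (h.swap.hasSum_stepTerm hy v).2.summable
  have hm1 : Measurable fun ω => min (u - ξ 0 ω) (v - η 0 ω) :=
    ((hmξ 0).const_sub u).min ((hmη 0).const_sub v)
  have hm2 : Measurable fun ω => min (u - ξ 0 ω) (v - η 1 ω) :=
    ((hmξ 0).const_sub u).min ((hmη 1).const_sub v)
  have hA := (hy.hasSum_integral_stepTerm (P := P) hm1
    (((integrable_const u).sub h.integrable_left).inf
      ((integrable_const v).sub h.integrable_right))).1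
  have hB := (hy.hasSum_integral_stepTerm (P := P) hm2
    (((integrable_const u).sub h.integrable_left).inf ((integrable_const v).sub hη1))).1
  refine hS.unique ((hA.sub hB).congr_fun ?_)
  intro j
  -- Adding b turns a step term into a genuine indicator, for which products become minima.
  set b : ℝ := if j < 0 then 1 else 0 with hb
  have hst : ∀ a x, stepTerm a j x = (if x ≤ a then 1 else 0) - b := fun a x => rfl
  have hprod : ∀ a c x, (stepTerm a j x + b) * (stepTerm c j x + b) =
      stepTerm (min a c) j x + b := by
    intro a c x
    simp only [hst, le_min_iff]
    by_cases h1 : x ≤ a <;> by_cases h2 : x ≤ c <;> simp [h1, h2]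
  have hI : ∀ (V : Ω → ℝ), Measurable V → Integrable (fun ω => stepTerm (V ω) j (y j)) P :=
    fun V hV => integrable_of_abs_le_one
      (measurable_stepTerm_comp hV measurable_const j).aemeasurable
        fun _ => abs_stepTerm_le_one _ _ _
  have hmu : Measurable fun ω => u - ξ 0 ω := (hmξ 0).const_sub u
  have hmv : ∀ i, Measurable fun ω => v - η i ω := fun i => (hmη i).const_sub v
  -- both products reduce to the particle with label `0`
  have e1 : ∫ ω, stepTerm u j (y j + ξ j ω) * stepTerm v j (y j + η j ω) ∂P =
      ∫ ω, stepTerm (u - ξ 0 ω) j (y j) * stepTerm (v - η 0 ω) j (y j) ∂P := by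
    have hm : Measurable fun p : ℝ × ℝ => stepTerm u j (y j + p.1) * stepTerm v j (y j + p.2) :=
      (measurable_stepTerm_comp measurable_const (measurable_fst.const_add _) j).mul
        (measurable_stepTerm_comp measurable_const (measurable_snd.const_add _) j)
    have := ((h.ident j).comp hm).integral_eq
    simp only [Function.comp_def] at this
    rw [this]
    simp only [stepTerm_add]
  have e2 : ∫ ω, stepTerm u j (y j + ξ j ω) ∂P = ∫ ω, stepTerm (u - ξ 0 ω) j (y j) ∂P :=
    h.integral_stepTerm id measurable_id u (y j) j
  have e3 : ∫ ω, stepTerm v j (y j + η j ω) ∂P = ∫ ω, stepTerm (v - η 0 ω) j (y j) ∂P :=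
    h.swap.integral_stepTerm id measurable_id v (y j) j
  -- Passing to η 1 makes the second factor independent of ξ 0, so the product of the means becomes
  -- the mean of a product.
  have e4 : ∫ ω, stepTerm (v - η 0 ω) j (y j) ∂P = ∫ ω, stepTerm (v - η 1 ω) j (y j) ∂P := by
    have hm : Measurable fun e : ℝ => stepTerm (v - e) j (y j) :=
      measurable_stepTerm_comp (measurable_id.const_sub v) measurable_const j
    exact (((h.ident 1).comp measurable_snd).comp hm).integral_eq.symm
  have e5 : (∫ ω, stepTerm (u - ξ 0 ω) j (y j) ∂P) * ∫ ω, stepTerm (v - η 1 ω) j (y j) ∂P =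
      ∫ ω, stepTerm (u - ξ 0 ω) j (y j) * stepTerm (v - η 1 ω) j (y j) ∂P := by
    have hi := (h.indep.indepFun (zero_ne_one (α := ℤ))).comp
      (φ := fun p : ℝ × ℝ => stepTerm (u - p.1) j (y j))
      (ψ := fun p : ℝ × ℝ => stepTerm (v - p.2) j (y j))
      (measurable_stepTerm_comp (measurable_fst.const_sub _) measurable_const j)
      (measurable_stepTerm_comp (measurable_snd.const_sub _) measurable_const j)
    exact (hi.integral_fun_mul_eq_mul_integral (hI _ hmu).1 (hI _ (hmv 1)).1).symm
  have e6 : ∀ i, ∫ ω, stepTerm (u - ξ 0 ω) j (y j) * stepTerm (v - η i ω) j (y j) ∂P =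
      ∫ ω, stepTerm (min (u - ξ 0 ω) (v - η i ω)) j (y j) ∂P + b -
        b * ∫ ω, stepTerm (u - ξ 0 ω) j (y j) ∂P - b * ∫ ω, stepTerm (v - η i ω) j (y j) ∂P -
        b ^ 2 := by
    intro i
    have hpt : ∀ ω, stepTerm (u - ξ 0 ω) j (y j) * stepTerm (v - η i ω) j (y j) =
        stepTerm (min (u - ξ 0 ω) (v - η i ω)) j (y j) + (b - b ^ 2) -
          b * stepTerm (u - ξ 0 ω) j (y j) - b * stepTerm (v - η i ω) j (y j) := by
      intro ω
      have := hprod (u - ξ 0 ω) (v - η i ω) (y j)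
      linarith
    have i1 := hI _ hmu
    have i2 := hI _ (hmv i)
    have i3 := hI _ (hmu.min (hmv i))
    have i4 : Integrable (fun ω => stepTerm (min (u - ξ 0 ω) (v - η i ω)) j (y j) + (b - b ^ 2))
      P := i3.add (integrable_const _)
    have i5 : Integrable (fun ω => stepTerm (min (u - ξ 0 ω) (v - η i ω)) j (y j) + (b - b ^ 2) -
      b * stepTerm (u - ξ 0 ω) j (y j)) P := i4.sub (i1.const_mul b)
    simp only [hpt]
    rw [integral_sub i5 (i2.const_mul b), integral_sub i4 (i1.const_mul b),
      integral_add i3 (integrable_const _), integral_const_mul, integral_const_mul]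
    simp
    ring
  rw [e1, e2, e3, e4, e5, e6, e6, e4]
  ring

/-- The increment counts the particles in (a, b], a sum of independent 0-1 variables, and each
variance p(1-p) is at most the mean p. -/
lemma IsNoisePair.variance_increment_le (h : IsNoisePair ξ η P) (hy : IsNice y) {a b : ℝ}
    (hab : a ≤ b) :
    ∫ ω, (crossing (fun j => y j + ξ j ω) b - crossing (fun j => y j + ξ j ω) a -
        (∫ ω, crossing y (b - ξ 0 ω) ∂P - ∫ ω, crossing y (a - ξ 0 ω) ∂P)) ^ 2 ∂P ≤
      ∫ ω, crossing y (b - ξ 0 ω) ∂P - ∫ ω, crossing y (a - ξ 0 ω) ∂P := by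
  obtain ⟨Z, hZ⟩ : ∃ Z : ℤ → Ω → ℝ,
      ∀ j ω, Z j ω = stepTerm b j (y j + ξ j ω) - stepTerm a j (y j + ξ j ω) :=
    ⟨_, fun _ _ => rfl⟩
  have hZf : ∀ j, Z j = fun ω => stepTerm b j (y j + ξ j ω) - stepTerm a j (y j + ξ j ω) :=
    fun j => funext (hZ j)
  have hZ01 : ∀ j ω, Z j ω = 0 ∨ Z j ω = 1 := by
    intro j ω
    simp only [hZ, stepTerm_sub_stepTerm]
    by_cases h1 : y j + ξ j ω ≤ a
    · simp [h1, h1.trans hab]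
    · by_cases h2 : y j + ξ j ω ≤ b <;> simp [h1, h2]
  have hZm : ∀ j, Measurable (Z j) := fun j => hZf j ▸
    (h.measurable_term b (y j) j).sub (h.measurable_term a (y j) j)
  have hZ1 : ∀ j ω, |Z j ω| ≤ 1 := fun j ω => by
    rcases hZ01 j ω with h0 | h0 <;> simp [h0]
  have hZabs : ∀ j ω, |Z j ω| = Z j ω := fun j ω => by
    rcases hZ01 j ω with h0 | h0 <;> simp [h0]
  have hZsq : ∀ j ω, Z j ω * Z j ω = Z j ω := fun j ω => by
    rcases hZ01 j ω with h0 | h0 <;> simp [h0]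
  have hZi : ∀ j, ∫ ω, Z j ω ∂P =
      ∫ ω, stepTerm b j (y j + ξ j ω) ∂P - ∫ ω, stepTerm a j (y j + ξ j ω) ∂P := fun j => by
    rw [hZf]
    exact integral_sub (h.integrable_term b (y j) j) (h.integrable_term a (y j) j)
  have hsum : HasSum (fun j => ∫ ω, Z j ω ∂P)
      (∫ ω, crossing y (b - ξ 0 ω) ∂P - ∫ ω, crossing y (a - ξ 0 ω) ∂P) := by
    simp only [hZi]
    exact (h.hasSum_stepTerm hy b).1.sub (h.hasSum_stepTerm hy a).1
  have hind : ∀ i j, i ≠ j → IndepFun (Z i) (Z j) P := fun i j hij => by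
    rw [hZf i, hZf j]
    exact (h.indep.indepFun hij).comp
      (φ := fun p : ℝ × ℝ => stepTerm b i (y i + p.1) - stepTerm a i (y i + p.1))
      (ψ := fun p : ℝ × ℝ => stepTerm b j (y j + p.1) - stepTerm a j (y j + p.1))
      ((measurable_stepTerm_comp measurable_const (measurable_fst.const_add _) i).sub
        (measurable_stepTerm_comp measurable_const (measurable_fst.const_add _) i))
      ((measurable_stepTerm_comp measurable_const (measurable_fst.const_add _) j).sub
        (measurable_stepTerm_comp measurable_const (measurable_fst.const_add _) j))
  have hs : Summable fun j => ∫ ω, |Z j ω| ∂P := by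
    simp only [hZabs]; exact hsum.summable
  have hS := hasSum_integral_mul_sub (P := P) hZm hZm hZ1 hZ1 hind hs hs
  have hiZ : ∀ j, Integrable (Z j) P := fun j =>
    integrable_of_abs_le_one (hZm j).aemeasurable (hZ1 j)
  have hmean : ∫ ω, ∑' j, Z j ω ∂P =
      ∫ ω, crossing y (b - ξ 0 ω) ∂P - ∫ ω, crossing y (a - ξ 0 ω) ∂P :=
    (hasSum_integral_of_summable_integral_norm hiZ hs).unique hsum
  have hle : ∫ ω, (∑' j, Z j ω) * (∑' j, Z j ω) ∂P -
      (∫ ω, ∑' j, Z j ω ∂P) * ∫ ω, ∑' j, Z j ω ∂P ≤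
      ∫ ω, crossing y (b - ξ 0 ω) ∂P - ∫ ω, crossing y (a - ξ 0 ω) ∂P := by
    refine hasSum_le (fun j => ?_) hS hsum
    simp only [hZsq]
    nlinarith [sq_nonneg (∫ ω, Z j ω ∂P)]
  have hae : ∀ᵐ ω ∂P, ∑' j, Z j ω =
      crossing (fun j => y j + ξ j ω) b - crossing (fun j => y j + ξ j ω) a := by
    filter_upwards [ae_summable_norm_of_summable_integral
      (fun j => h.integrable_term b (y j) j) (h.hasSum_stepTerm hy b).2.summable,
      ae_summable_norm_of_summable_integral
      (fun j => h.integrable_term a (y j) j) (h.hasSum_stepTerm hy a).2.summable] with ω h1 h2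
    simp only [hZ]
    exact h1.of_norm.tsum_sub h2.of_norm
  set m := ∫ ω, crossing y (b - ξ 0 ω) ∂P - ∫ ω, crossing y (a - ξ 0 ω) ∂P with hm
  rw [hmean] at hle
  have hL2 : MemLp (fun ω => ∑' j, Z j ω) 2 P :=
    ((h.memLp_crossing hy b).sub (h.memLp_crossing hy a)).ae_eq (by
      filter_upwards [hae] with ω hω using hω.symm)
  have hsq := hL2.integrable_sq
  have hi := hL2.integrable one_le_two
  calc _ = ∫ ω, ((∑' j, Z j ω) ^ 2 - (2 * m * ∑' j, Z j ω - m ^ 2)) ∂P := by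
        refine integral_congr_ae ?_
        filter_upwards [hae] with ω hω
        rw [hω]; ring
    _ = ∫ ω, (∑' j, Z j ω) * (∑' j, Z j ω) ∂P - m * m := by
        have e1 : Integrable (fun ω => 2 * m * ∑' j, Z j ω - m ^ 2) P :=
          (hi.const_mul _).sub (integrable_const _)
        rw [integral_sub hsq e1, integral_sub (hi.const_mul _) (integrable_const _),
          integral_const_mul, hmean]
        simp only [integral_const, probReal_univ, smul_eq_mul, one_mul, sq]
        ring
    _ ≤ m := hle

end Fixed

end SingleFile

namespace SingleFile

/-! ### Inversion of the counting function -/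

variable {Ω : Type*} [MeasurableSpace Ω] {P : Measure Ω}

/-- `Y` is the generalized inverse at level `1` of the counting functions `N`. -/
def IsCountInverse (Y : Ω → ℝ) (N : ℝ → Ω → ℝ) (P : Measure Ω) : Prop :=
  ∀ a, ∀ᵐ ω ∂P, (Y ω ≤ a → 1 ≤ N a ω) ∧ (a < Y ω → N a ω ≤ 0)

/-- Sixth moment bound for the fluctuations of the counting functions, and comparison of the
centering with the linear profile of slope `ρ`. -/
structure HasCountMoments (ρ K c R : ℝ) (N : ℝ → Ω → ℝ) (m : ℝ → ℝ) (P : Measure Ω) : Prop where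
  measurable : ∀ a, Measurable (N a)
  moment : ∀ a, ∫⁻ ω, ENNReal.ofReal ((N a ω - m a) ^ 6) ∂P ≤ ENNReal.ofReal (K * (R + |a|) ^ 3)
  mean : ∀ a, |m a - ρ * a| ≤ ρ * |a| / 2 + c

lemma measure_le_of_lintegral_pow_six_le {Z : Ω → ℝ} (hZ : Measurable Z) {a B : ℝ} (ha : 0 < a)
    (h : ∫⁻ ω, ENNReal.ofReal (Z ω ^ 6) ∂P ≤ ENNReal.ofReal B) :
    P {ω | a ≤ |Z ω|} ≤ ENNReal.ofReal (B / a ^ 6) := by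
  have h3 : P {ω | a ≤ |Z ω|} ≤ P {ω | ENNReal.ofReal (a ^ 6) ≤ ENNReal.ofReal (Z ω ^ 6)} := by
    refine measure_mono fun ω (hω : a ≤ _) => ?_
    refine ENNReal.ofReal_le_ofReal ?_
    rw [← Even.pow_abs (by decide : Even 6) (Z ω)]
    gcongr
  refine h3.trans ((meas_ge_le_lintegral_div (hZ.pow_const 6).ennreal_ofReal.aemeasurable
    (ENNReal.ofReal_pos.2 (pow_pos ha 6)).ne' ENNReal.ofReal_ne_top).trans ?_)
  rw [ENNReal.ofReal_div_of_pos (by positivity)]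
  gcongr

/-- If Y > a then N a ≤ 0, although its centre is at least ρa/2 - c ≥ ρa/4; the case Y < -a is
symmetric. Markov's inequality with sixth moments at threshold ρa/4, used twice, gives 2 · 4^6 =
8192. -/
lemma IsCountInverse.measure_tail_le {ρ K c R : ℝ} (hρ : 0 < ρ) {Y : Ω → ℝ}
    {N : ℝ → Ω → ℝ} {m : ℝ → ℝ} (hY : IsCountInverse Y N P) (hN : HasCountMoments ρ K c R N m P)
    (hK : 0 ≤ K) (hR : 0 ≤ R) {a : ℝ} (ha : 0 < a) (hac : 4 * c ≤ ρ * a) :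
    P {ω | a < |Y ω|} ≤ ENNReal.ofReal (8192 * K / ρ ^ 6 * (R + a) ^ 3 / a ^ 6) := by
  have hpos : 0 < ρ * a / 4 := by positivity
  have h1 := measure_le_of_lintegral_pow_six_le ((hN.measurable a).sub_const (m a)) hpos
    (hN.moment a)
  have h2 := measure_le_of_lintegral_pow_six_le ((hN.measurable (-a)).sub_const (m (-a))) hpos
    (hN.moment (-a))
  rw [abs_neg] at h2
  rw [abs_of_pos ha] at h1 h2
  have hm1 := abs_le.1 (hN.mean a)
  have hm2 := abs_le.1 (hN.mean (-a))
  rw [abs_neg] at hm2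
  rw [abs_of_pos ha] at hm1 hm2
  have hsub : P {ω | a < |Y ω|} ≤
      P ({ω | ρ * a / 4 ≤ |N a ω - m a|} ∪ {ω | ρ * a / 4 ≤ |N (-a) ω - m (-a)|}) := by
    refine measure_mono_ae ?_
    filter_upwards [hY a, hY (-a)] with ω h3 h4 hω
    change a < |Y ω| at hω
    change ρ * a / 4 ≤ |N a ω - m a| ∨ ρ * a / 4 ≤ |N (-a) ω - m (-a)|
    rcases lt_abs.1 hω with h5 | h5
    · left
      have := h3.2 h5
      rw [abs_sub_comm]
      refine le_trans ?_ (le_abs_self _)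
      linarith [hm1.1]
    · right
      have := h4.1 (by linarith)
      refine le_trans ?_ (le_abs_self _)
      linarith [hm2.2]
  refine hsub.trans ((measure_union_le _ _).trans ((add_le_add h1 h2).trans ?_))
  rw [← ENNReal.ofReal_add (by positivity) (by positivity)]
  refine ENNReal.ofReal_le_ofReal (le_of_eq ?_)
  field_simp
  ring

/-- Sixth moments of the count give a tail of order a^{-3} for large a, which is summable against
the square of a over dyadic shells; fourth moments of the same scaling would only give a^{-2} and
leave a divergent sum. -/
lemma IsCountInverse.lintegral_tail_le {ρ K c R : ℝ} (hρ : 0 < ρ) {Y : Ω → ℝ}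
    (hYm : Measurable Y) {N : ℝ → Ω → ℝ} {m : ℝ → ℝ} (hY : IsCountInverse Y N P)
    (hN : HasCountMoments ρ K c R N m P) (hK : 0 ≤ K) (hR : 0 ≤ R) {b : ℝ} (hb : 0 < b)
    (hbc : 4 * c ≤ ρ * b) :
    ∫⁻ ω in {ω | 2 * b < |Y ω|}, ENNReal.ofReal (Y ω ^ 2) ∂P ≤
      ENNReal.ofReal (1048576 * K / ρ ^ 6 * (R ^ 3 / b ^ 4 + 1 / b)) := by
  have hset : ∀ a : ℝ, MeasurableSet {ω | a < |Y ω|} := fun a =>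
    measurableSet_lt measurable_const hYm.abs
  have hpt : ∀ ω ∈ {ω | 2 * b < |Y ω|}, ENNReal.ofReal (Y ω ^ 2) ≤
      ∑' k : ℕ, Set.indicator {ω | 2 ^ k * b < |Y ω|}
        (fun _ => ENNReal.ofReal (16 * 4 ^ k * b ^ 2)) ω := by
    intro ω (hω : 2 * b < |Y ω|)
    -- The dyadic shell of |Y|, between 2^k and 2^{k+1} times 2b.
    obtain ⟨k, hk1, hk2⟩ := exists_nat_pow_near (x := |Y ω| / (2 * b)) (y := 2)
      (by rw [one_le_div (by positivity)]; exact hω.le) one_lt_two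
    rw [le_div_iff₀ (by positivity)] at hk1
    rw [div_lt_iff₀ (by positivity)] at hk2
    have hpk : (0 : ℝ) < 2 ^ k := by positivity
    refine le_trans ?_ (ENNReal.le_tsum k)
    rw [Set.indicator_of_mem (show ω ∈ {ω | 2 ^ k * b < |Y ω|} from
      lt_of_lt_of_le (by nlinarith) hk1)]
    refine ENNReal.ofReal_le_ofReal ?_
    rw [← sq_abs]
    calc |Y ω| ^ 2 ≤ (2 ^ (k + 1) * (2 * b)) ^ 2 := by gcongr
      _ = _ := by
        rw [show (4 : ℝ) ^ k = (2 ^ k) ^ 2 by rw [← pow_mul, mul_comm, pow_mul]; norm_num]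
        ring
  have hterm : ∀ k : ℕ, ENNReal.ofReal (16 * 4 ^ k * b ^ 2) * P {ω | 2 ^ k * b < |Y ω|} ≤
      ENNReal.ofReal (524288 * K / ρ ^ 6 * (R ^ 3 / b ^ 4 + 1 / b) * (1 / 2) ^ k) := by
    intro k
    have hpk : (1 : ℝ) ≤ 2 ^ k := one_le_pow₀ one_le_two
    have h1 := hY.measure_tail_le hρ hN hK hR (a := 2 ^ k * b) (by positivity)
      (hbc.trans (by nlinarith [mul_pos hρ hb]))
    refine (mul_le_mul_right h1 _).trans ?_
    rw [← ENNReal.ofReal_mul (by positivity)]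
    refine ENNReal.ofReal_le_ofReal ?_
    have h2 : (R + 2 ^ k * b) ^ 3 ≤ 4 * (R ^ 3 + (2 ^ k * b) ^ 3) := by
      have : 0 ≤ 2 ^ k * b := by positivity
      nlinarith [mul_nonneg (add_nonneg hR this) (sq_nonneg (R - 2 ^ k * b))]
    have h4 : (4 : ℝ) ^ k = (2 ^ k) ^ 2 := by
      rw [← pow_mul, mul_comm, pow_mul]; norm_num
    have h5 : ((1 : ℝ) / 2) ^ k = 1 / 2 ^ k := by rw [div_pow, one_pow]
    rw [h4, h5]
    generalize (2 : ℝ) ^ k = x at hpk h2 ⊢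
    calc 16 * x ^ 2 * b ^ 2 * (8192 * K / ρ ^ 6 * (R + x * b) ^ 3 / (x * b) ^ 6)
        ≤ 16 * x ^ 2 * b ^ 2 * (8192 * K / ρ ^ 6 * (4 * (R ^ 3 + (x * b) ^ 3)) / (x * b) ^ 6) := by
          gcongr
      _ = 524288 * K / ρ ^ 6 * (R ^ 3 / b ^ 4 * (1 / x ^ 3) + 1 / b) * (1 / x) := by
          field_simp; ring
      _ ≤ 524288 * K / ρ ^ 6 * (R ^ 3 / b ^ 4 * 1 + 1 / b) * (1 / x) := by
          gcongr
          rw [div_le_one (by positivity)]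
          exact one_le_pow₀ hpk
      _ = _ := by ring
  calc _ ≤ ∫⁻ ω in {ω | 2 * b < |Y ω|}, ∑' k : ℕ, Set.indicator {ω | 2 ^ k * b < |Y ω|}
        (fun _ => ENNReal.ofReal (16 * 4 ^ k * b ^ 2)) ω ∂P := setLIntegral_mono' (hset _) hpt
    _ ≤ ∫⁻ ω, ∑' k : ℕ, Set.indicator {ω | 2 ^ k * b < |Y ω|}
        (fun _ => ENNReal.ofReal (16 * 4 ^ k * b ^ 2)) ω ∂P := setLIntegral_le_lintegral _ _
    _ = ∑' k : ℕ, ENNReal.ofReal (16 * 4 ^ k * b ^ 2) * P {ω | 2 ^ k * b < |Y ω|} := by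
        rw [lintegral_tsum fun k => (measurable_const.indicator (hset _)).aemeasurable]
        exact tsum_congr fun k => lintegral_indicator_const (hset _) _
    _ ≤ _ := ENNReal.tsum_le_tsum hterm
    _ = _ := by
        rw [← ENNReal.ofReal_tsum_of_nonneg (fun k => by positivity)
          ((summable_geometric_of_lt_one (by norm_num) (by norm_num)).mul_left _), tsum_mul_left,
          tsum_geometric_of_lt_one (by norm_num) (by norm_num)]
        congr 1
        ring

lemma IsCountInverse.memLp_two [IsFiniteMeasure P] {ρ K c R : ℝ} (hρ : 0 < ρ) {Y : Ω → ℝ}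
    (hYm : Measurable Y) {N : ℝ → Ω → ℝ} {m : ℝ → ℝ} (hY : IsCountInverse Y N P)
    (hN : HasCountMoments ρ K c R N m P) (hK : 0 ≤ K) (hR : 0 ≤ R) : MemLp Y 2 P := by
  obtain ⟨b, hb, hbc⟩ : ∃ b : ℝ, 0 < b ∧ 4 * c ≤ ρ * b :=
    ⟨4 * |c| / ρ + 1, by positivity, by
      rw [mul_add, mul_div_cancel₀ _ hρ.ne']; linarith [le_abs_self c]⟩
  have hset : MeasurableSet {ω | 2 * b < |Y ω|} := measurableSet_lt measurable_const hYm.abs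
  have h1 := hY.lintegral_tail_le hρ hYm hN hK hR hb hbc
  rw [memLp_two_iff_integrable_sq hYm.aestronglyMeasurable]
  refine ⟨(hYm.pow_const 2).aestronglyMeasurable, ?_⟩
  rw [hasFiniteIntegral_iff_ofReal (ae_of_all _ fun _ => sq_nonneg _),
    ← lintegral_add_compl _ hset]
  refine ENNReal.add_lt_top.2 ⟨lt_of_le_of_lt h1 ENNReal.ofReal_lt_top, ?_⟩
  refine lt_of_le_of_lt (setLIntegral_mono' (g := fun _ => ENNReal.ofReal ((2 * b) ^ 2))
    hset.compl fun ω hω => ENNReal.ofReal_le_ofReal ?_) ?_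
  · rw [← sq_abs]
    have : |Y ω| ≤ 2 * b := not_lt.1 hω
    gcongr
  · rw [setLIntegral_const]
    exact ENNReal.mul_lt_top ENNReal.ofReal_lt_top (measure_lt_top _ _)

/-- Y lies between consecutive grid points with counts N (k-1) ≤ 0 and N k ≥ 1. If the counts are
nearly N₀ plus ρ times the position, both inequalities squeeze Y to -N₀/ρ up to the mesh r/n and the
linearisation errors. The index range reaches n²+1 rather than n² because the lower neighbour k-1 is
needed too. -/
lemma sq_add_div_le_grid {ρ r Y : ℝ} (hρ : 0 < ρ) (hr : 0 < r) {n : ℕ} (hn : 0 < n) {N : ℤ → ℝ}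
    {N₀ : ℝ} (hN : ∀ k : ℤ, (Y ≤ k / n * r → 1 ≤ N k) ∧ (k / n * r < Y → N k ≤ 0))
    (hY : |Y| ≤ n * r) :
    (Y + N₀ / ρ) ^ 2 ≤ 2 * (r / n) ^ 2 + 2 / ρ ^ 2 *
      ∑ k ∈ Finset.Icc (-(n ^ 2 + 1) : ℤ) (n ^ 2 + 1), (N k - N₀ - ρ * (k / n * r)) ^ 2 := by
  have hn' : (0 : ℝ) < n := by exact_mod_cast hn
  set k : ℤ := ⌈Y * n / r⌉ with hk
  have h1 : Y ≤ k / n * r := by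
    have := Int.le_ceil (Y * n / r)
    rw [div_le_iff₀ hr] at this
    rw [div_mul_eq_mul_div, le_div_iff₀ hn']
    exact this
  have h2 : ((k - 1 : ℤ) : ℝ) / n * r < Y := by
    have := Int.ceil_lt_add_one (Y * n / r)
    rw [← hk, ← sub_lt_iff_lt_add, lt_div_iff₀ hr] at this
    rw [div_mul_eq_mul_div, div_lt_iff₀ hn']
    push_cast
    exact this
  have hN1 := (hN k).1 h1
  have hN2 := (hN (k - 1)).2 h2
  have hY' := abs_le.1 hY
  have hkmem : k ∈ Finset.Icc (-(n ^ 2 + 1) : ℤ) (n ^ 2 + 1) ∧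
      k - 1 ∈ Finset.Icc (-(n ^ 2 + 1) : ℤ) (n ^ 2 + 1) := by
    have hu : k ≤ n ^ 2 := by
      rw [hk, Int.ceil_le, div_le_iff₀ hr]
      push_cast
      nlinarith
    have hl : -(n ^ 2 : ℤ) ≤ k := by
      have h3 : (-(n ^ 2 : ℤ) : ℝ) ≤ Y * n / r := by
        rw [le_div_iff₀ hr]
        push_cast
        nlinarith
      have h4 := h3.trans (Int.le_ceil (Y * n / r))
      exact_mod_cast h4
    simp only [Finset.mem_Icc]
    omega
  set e : ℤ → ℝ := fun k => N k - N₀ - ρ * (k / n * r) with he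
  have hsum : ∀ i ∈ Finset.Icc (-(n ^ 2 + 1) : ℤ) (n ^ 2 + 1),
      e i ^ 2 ≤ ∑ k ∈ Finset.Icc (-(n ^ 2 + 1) : ℤ) (n ^ 2 + 1), e k ^ 2 := fun i hi =>
    Finset.single_le_sum (f := fun k => e k ^ 2) (fun _ _ => sq_nonneg _) hi
  set S := ∑ k ∈ Finset.Icc (-(n ^ 2 + 1) : ℤ) (n ^ 2 + 1), e k ^ 2 with hS
  have hs1 := hsum _ hkmem.1
  have hs2 := hsum _ hkmem.2
  have hlow : ((k - 1 : ℤ) : ℝ) / n * r = k / n * r - r / n := by push_cast; ring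
  have hupper : Y + N₀ / ρ ≤ r / n - e (k - 1) / ρ := by
    have : N₀ / ρ ≤ (-e (k - 1) - ρ * (((k - 1 : ℤ) : ℝ) / n * r)) / ρ := by
      gcongr; simp only [he]; linarith
    rw [sub_div, mul_div_cancel_left₀ _ hρ.ne', neg_div] at this
    linarith
  have hlower : -(r / n) - e k / ρ ≤ Y + N₀ / ρ := by
    have : (-e k - ρ * ((k : ℝ) / n * r)) / ρ ≤ N₀ / ρ := by
      gcongr; simp only [he]; linarith
    rw [sub_div, mul_div_cancel_left₀ _ hρ.ne', neg_div] at this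
    linarith
  have hsq : ∀ x : ℝ, x ^ 2 ≤ S → (|r / n| + |x / ρ|) ^ 2 ≤ 2 * (r / n) ^ 2 + 2 / ρ ^ 2 * S := by
    intro x hx
    have h3 : (|r / n| + |x / ρ|) ^ 2 ≤ 2 * (r / n) ^ 2 + 2 * (x / ρ) ^ 2 := by
      rw [← sq_abs (r / n), ← sq_abs (x / ρ)]
      nlinarith [sq_nonneg (|r / n| - |x / ρ|)]
    have h4 : 2 * (x / ρ) ^ 2 = 2 / ρ ^ 2 * x ^ 2 := by ring
    have h5 : 2 / ρ ^ 2 * x ^ 2 ≤ 2 / ρ ^ 2 * S := by gcongr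
    linarith
  rcases le_total 0 (Y + N₀ / ρ) with h0 | h0
  · refine le_trans ?_ (hsq _ hs2)
    exact pow_le_pow_left₀ h0 (by linarith [le_abs_self (r / n), neg_abs_le (e (k - 1) / ρ)]) 2
  · refine le_trans ?_ (hsq _ hs1)
    rw [← neg_sq]
    exact pow_le_pow_left₀ (by linarith)
      (by linarith [le_abs_self (r / n), le_abs_self (e k / ρ)]) 2

/-- To leading order, the generalized inverse is the value at `0` of the counting function,
divided by minus the density. -/
theorem eventually_lintegral_inverse_add_le [IsProbabilityMeasure P] {ι : Type*} {l : Filter ι}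
    {ρ K c : ℝ} (hρ : 0 < ρ) (hK : 0 ≤ K) (hc : 0 ≤ c) {r : ι → ℝ} (hr : Tendsto r l atTop)
    {Y : ι → Ω → ℝ} (hYm : ∀ i, Measurable (Y i)) {N : ι → ℝ → Ω → ℝ} {m : ι → ℝ → ℝ}
    (hY : ∀ᶠ i in l, IsCountInverse (Y i) (N i) P)
    (hN : ∀ᶠ i in l, HasCountMoments ρ K c (r i ^ 2) (N i) (m i) P)
    (hinc : ∀ b ε : ℝ, 0 < ε → ∀ᶠ i in l,
      ∫⁻ ω, ENNReal.ofReal ((N i (b * r i) ω - N i 0 ω - ρ * (b * r i)) ^ 2) ∂P ≤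
        ENNReal.ofReal (ε * r i ^ 2)) {ε : ℝ} (hε : 0 < ε) :
    ∀ᶠ i in l, ∫⁻ ω, ENNReal.ofReal ((Y i ω + N i 0 ω / ρ) ^ 2) ∂P ≤
      ENNReal.ofReal (ε * r i ^ 2) := by
  set C₁ : ℝ := 1048576 * K / ρ ^ 6 * 18 with hC₁
  set C₂ : ℝ := 2 / ρ ^ 2 * (32 * (K + c ^ 6)) with hC₂
  set C : ℝ := 2 + 1 + ((2 + 2 / ρ ^ 2) * C₁ + C₂) with hC
  have hC₁0 : 0 ≤ C₁ := by positivity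
  have hC₂0 : 0 ≤ C₂ := by positivity
  have hC0 : 0 < C := by positivity
  -- The integer n is both the fineness of the grid, with mesh r/n, and the truncation level n r.
  -- Both errors are at most a constant times r²/n, so n is fixed before the limit; only finitely
  -- many grid points then remain.
  obtain ⟨n, hn⟩ := exists_nat_gt (max (C / ε) 1)
  have hn1 : (1 : ℝ) < n := (le_max_right _ _).trans_lt hn
  have hnC : C / n ≤ ε := by
    rw [div_le_iff₀ (by linarith), mul_comm, ← div_le_iff₀ hε]
    exact ((le_max_left _ _).trans_lt hn).le
  have hn0 : 0 < n := by exact_mod_cast (by linarith : (0 : ℝ) < n)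
  set I : Finset ℤ := Finset.Icc (-(n ^ 2 + 1) : ℤ) (n ^ 2 + 1) with hI
  have hIcard : (0 : ℝ) < I.card := by
    have : I.Nonempty := ⟨0, by rw [hI, Finset.mem_Icc]; constructor <;> nlinarith⟩
    exact_mod_cast Finset.card_pos.2 this
  -- The tolerance makes the sum over the grid, multiplied by 2/ρ², equal to r²/n.
  have hinc' : ∀ᶠ i in l, ∀ k ∈ I,
      ∫⁻ ω, ENNReal.ofReal ((N i (k / n * r i) ω - N i 0 ω - ρ * (k / n * r i)) ^ 2) ∂P ≤
        ENNReal.ofReal (ρ ^ 2 / (2 * n * I.card) * r i ^ 2) :=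
    (Finset.eventually_all I).2 fun k _ => hinc (k / n) _ (by positivity)
  filter_upwards [hY, hN, hinc', hr.eventually_ge_atTop 1, hr.eventually_ge_atTop (8 * c / ρ)]
    with i hYi hNi hi hr1 hrc
  have hr0 : 0 < r i := by linarith
  set A : Set Ω := {ω | n * r i < |Y i ω|} with hA
  have hAm : MeasurableSet A := measurableSet_lt measurable_const (hYm i).abs
  have htail : ∫⁻ ω in A, ENNReal.ofReal (Y i ω ^ 2) ∂P ≤ ENNReal.ofReal (C₁ / n * r i ^ 2) := by
    have hb : 4 * c ≤ ρ * (n * r i / 2) := by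
      rw [div_le_iff₀ hρ] at hrc
      nlinarith [mul_pos hr0 hρ]
    have h1 := hYi.lintegral_tail_le hρ (hYm i) hNi hK (sq_nonneg _) (b := n * r i / 2)
      (by positivity) hb
    rw [mul_div_cancel₀ _ (two_ne_zero' ℝ)] at h1
    refine h1.trans (ENNReal.ofReal_le_ofReal ?_)
    have h2 : (r i ^ 2) ^ 3 / (n * r i / 2) ^ 4 ≤ 16 * (r i ^ 2 / n) := by
      have : (r i ^ 2) ^ 3 / (n * r i / 2) ^ 4 = 16 * (r i ^ 2 / n) * (1 / n ^ 3) := by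
        field_simp; ring
      rw [this]
      refine mul_le_of_le_one_right (by positivity) ?_
      rw [div_le_one (by positivity)]
      exact one_le_pow₀ hn1.le
    have h3 : 1 / (n * r i / 2) ≤ 2 * (r i ^ 2 / n) := by
      rw [div_le_iff₀ (by positivity)]
      have : 2 * (r i ^ 2 / n) * (n * r i / 2) = r i ^ 3 := by field_simp
      rw [this]
      exact one_le_pow₀ hr1
    calc 1048576 * K / ρ ^ 6 * ((r i ^ 2) ^ 3 / (n * r i / 2) ^ 4 + 1 / (n * r i / 2))
        ≤ 1048576 * K / ρ ^ 6 * (16 * (r i ^ 2 / n) + 2 * (r i ^ 2 / n)) := by gcongr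
      _ = _ := by rw [hC₁]; ring
  have hN6 : ∫⁻ ω, ENNReal.ofReal (N i 0 ω ^ 6) ∂P ≤
      ENNReal.ofReal (32 * (K + c ^ 6) * r i ^ 6) := by
    have hm0 : |m i 0| ≤ c := by simpa using hNi.mean 0
    have hmom := hNi.moment 0
    rw [abs_zero, add_zero, ← pow_mul] at hmom
    calc ∫⁻ ω, ENNReal.ofReal (N i 0 ω ^ 6) ∂P
        ≤ ∫⁻ ω, (ENNReal.ofReal 32 * ENNReal.ofReal ((N i 0 ω - m i 0) ^ 6) +
            ENNReal.ofReal (32 * c ^ 6)) ∂P := by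
          refine lintegral_mono fun ω => ?_
          rw [← ENNReal.ofReal_mul (by norm_num),
            ← ENNReal.ofReal_add (by positivity) (by positivity)]
          refine ENNReal.ofReal_le_ofReal ?_
          have h1 := add_pow_le (abs_nonneg (N i 0 ω - m i 0)) (abs_nonneg (m i 0)) 6
          have h2 : N i 0 ω ^ 6 ≤ (|N i 0 ω - m i 0| + |m i 0|) ^ 6 := by
            rw [← Even.pow_abs (by decide : Even 6)]
            gcongr
            have := abs_add_le (N i 0 ω - m i 0) (m i 0)
            rwa [sub_add_cancel] at this
          have h3 : |m i 0| ^ 6 ≤ c ^ 6 := by gcongr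
          rw [Even.pow_abs (by decide : Even 6) (N i 0 ω - m i 0)] at h1
          norm_num at h1
          nlinarith
      _ ≤ ENNReal.ofReal 32 * ENNReal.ofReal (K * r i ^ 6) + ENNReal.ofReal (32 * c ^ 6) := by
          rw [lintegral_add_right _ measurable_const, lintegral_const_mul _
            (((hNi.measurable 0).sub_const _).pow_const 6).ennreal_ofReal, lintegral_const,
            measure_univ, mul_one]
          gcongr
      _ ≤ _ := by
          rw [← ENNReal.ofReal_mul (by norm_num),
            ← ENNReal.ofReal_add (by positivity) (by positivity)]
          refine ENNReal.ofReal_le_ofReal ?_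
          have : c ^ 6 * 1 ≤ c ^ 6 * r i ^ 6 := by gcongr; exact one_le_pow₀ hr1
          linarith
  have hinside : ∫⁻ ω in Aᶜ, ENNReal.ofReal ((Y i ω + N i 0 ω / ρ) ^ 2) ∂P ≤
      ENNReal.ofReal (2 / n * r i ^ 2) + ENNReal.ofReal (1 / n * r i ^ 2) := by
    have hgrid : ∀ᵐ ω ∂P, ∀ k : ℤ, (Y i ω ≤ k / n * r i → 1 ≤ N i (k / n * r i) ω) ∧
        (k / n * r i < Y i ω → N i (k / n * r i) ω ≤ 0) := ae_all_iff.2 fun k => hYi _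
    have hmeas : ∀ k : ℤ, Measurable fun ω => ENNReal.ofReal
        ((N i (k / n * r i) ω - N i 0 ω - ρ * (k / n * r i)) ^ 2) := fun k =>
      ((((hNi.measurable _).sub (hNi.measurable 0)).sub_const _).pow_const 2).ennreal_ofReal
    calc _ ≤ ∫⁻ ω in Aᶜ, (ENNReal.ofReal (2 * (r i / n) ^ 2) + ENNReal.ofReal (2 / ρ ^ 2) *
          ∑ k ∈ I, ENNReal.ofReal
            ((N i (k / n * r i) ω - N i 0 ω - ρ * (k / n * r i)) ^ 2)) ∂P := by
          refine setLIntegral_mono_ae' hAm.compl ?_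
          filter_upwards [hgrid] with ω hω hωA
          rw [← ENNReal.ofReal_sum_of_nonneg fun _ _ => sq_nonneg _,
            ← ENNReal.ofReal_mul (by positivity),
            ← ENNReal.ofReal_add (by positivity)
              (mul_nonneg (by positivity) (Finset.sum_nonneg fun _ _ => sq_nonneg _))]
          exact ENNReal.ofReal_le_ofReal (sq_add_div_le_grid hρ hr0 hn0 hω (not_lt.1 hωA))
      _ ≤ ∫⁻ ω, (ENNReal.ofReal (2 * (r i / n) ^ 2) + ENNReal.ofReal (2 / ρ ^ 2) *
          ∑ k ∈ I, ENNReal.ofReal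
            ((N i (k / n * r i) ω - N i 0 ω - ρ * (k / n * r i)) ^ 2)) ∂P :=
          setLIntegral_le_lintegral _ _
      _ = ENNReal.ofReal (2 * (r i / n) ^ 2) + ENNReal.ofReal (2 / ρ ^ 2) *
          ∑ k ∈ I, ∫⁻ ω, ENNReal.ofReal
            ((N i (k / n * r i) ω - N i 0 ω - ρ * (k / n * r i)) ^ 2) ∂P := by
          rw [lintegral_add_left measurable_const, lintegral_const, measure_univ, mul_one,
            lintegral_const_mul _ (Finset.measurable_sum _ fun k _ => hmeas k),
            lintegral_finsetSum _ fun k _ => hmeas k]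
      _ ≤ ENNReal.ofReal (2 * (r i / n) ^ 2) + ENNReal.ofReal (2 / ρ ^ 2) *
          ∑ k ∈ I, ENNReal.ofReal (ρ ^ 2 / (2 * n * I.card) * r i ^ 2) := by
          gcongr with k hk
          exact hi k hk
      _ ≤ _ := by
          rw [Finset.sum_const, nsmul_eq_mul, ← ENNReal.ofReal_natCast,
            ← ENNReal.ofReal_mul (by positivity), ← ENNReal.ofReal_mul (by positivity)]
          refine add_le_add (ENNReal.ofReal_le_ofReal ?_) (ENNReal.ofReal_le_ofReal (le_of_eq ?_))
          · have h1 : 2 * (r i / n) ^ 2 = 2 / n * r i ^ 2 * (1 / n) := by field_simp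
            rw [h1]
            refine mul_le_of_le_one_right (by positivity) ?_
            rw [div_le_one (by linarith)]
            exact hn1.le
          · field_simp
  have houtside : ∫⁻ ω in A, ENNReal.ofReal ((Y i ω + N i 0 ω / ρ) ^ 2) ∂P ≤
      ENNReal.ofReal (((2 + 2 / ρ ^ 2) * C₁ + C₂) / n * r i ^ 2) := by
    calc _ ≤ ∫⁻ ω in A, (ENNReal.ofReal (2 + 2 / ρ ^ 2) * ENNReal.ofReal (Y i ω ^ 2) +
          ENNReal.ofReal (2 / ρ ^ 2 / (n * r i) ^ 4) * ENNReal.ofReal (N i 0 ω ^ 6)) ∂P := by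
          refine setLIntegral_mono' hAm fun ω (hω : n * r i < |Y i ω|) => ?_
          rw [← ENNReal.ofReal_mul (by positivity), ← ENNReal.ofReal_mul (by positivity),
            ← ENNReal.ofReal_add (by positivity) (by positivity)]
          refine ENNReal.ofReal_le_ofReal ?_
          have hL : 0 < n * r i := by positivity
          set L := n * r i with hLdef
          have h1 : (Y i ω + N i 0 ω / ρ) ^ 2 ≤ 2 * Y i ω ^ 2 + 2 / ρ ^ 2 * N i 0 ω ^ 2 := by
            have : 2 / ρ ^ 2 * N i 0 ω ^ 2 = 2 * (N i 0 ω / ρ) ^ 2 := by ring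
            rw [this]
            nlinarith [sq_nonneg (Y i ω - N i 0 ω / ρ)]
          -- Outside the truncation either |N| ≤ L < |Y|, or |N| ≥ L and the sixth power dominates.
          -- No joint moment of Y and N is needed.
          have h2 : N i 0 ω ^ 2 ≤ Y i ω ^ 2 + N i 0 ω ^ 6 / L ^ 4 := by
            have hLY : L ^ 2 ≤ Y i ω ^ 2 := by rw [← sq_abs (Y i ω)]; gcongr
            rcases le_total (N i 0 ω ^ 2) (L ^ 2) with h3 | h3
            · have : 0 ≤ N i 0 ω ^ 6 / L ^ 4 := by positivity
              linarith
            · have h4 : N i 0 ω ^ 2 ≤ N i 0 ω ^ 6 / L ^ 4 := by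
                rw [le_div_iff₀ (by positivity)]
                calc N i 0 ω ^ 2 * L ^ 4 = N i 0 ω ^ 2 * (L ^ 2) ^ 2 := by ring
                  _ ≤ N i 0 ω ^ 2 * (N i 0 ω ^ 2) ^ 2 := by gcongr
                  _ = _ := by ring
              linarith [sq_nonneg (Y i ω)]
          have h3 : 2 / ρ ^ 2 * N i 0 ω ^ 2 ≤
              2 / ρ ^ 2 * (Y i ω ^ 2 + N i 0 ω ^ 6 / L ^ 4) := by gcongr
          calc _ ≤ _ := h1
            _ ≤ 2 * Y i ω ^ 2 + 2 / ρ ^ 2 * (Y i ω ^ 2 + N i 0 ω ^ 6 / L ^ 4) := by linarith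
            _ = _ := by ring
      _ = ENNReal.ofReal (2 + 2 / ρ ^ 2) * ∫⁻ ω in A, ENNReal.ofReal (Y i ω ^ 2) ∂P +
          ENNReal.ofReal (2 / ρ ^ 2 / (n * r i) ^ 4) *
            ∫⁻ ω in A, ENNReal.ofReal (N i 0 ω ^ 6) ∂P := by
          rw [lintegral_add_left (((hYm i).pow_const 2).ennreal_ofReal.const_mul _),
            lintegral_const_mul _ ((hYm i).pow_const 2).ennreal_ofReal,
            lintegral_const_mul _ ((hNi.measurable 0).pow_const 6).ennreal_ofReal]
      _ ≤ ENNReal.ofReal (2 + 2 / ρ ^ 2) * ENNReal.ofReal (C₁ / n * r i ^ 2) +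
          ENNReal.ofReal (2 / ρ ^ 2 / (n * r i) ^ 4) *
            ENNReal.ofReal (32 * (K + c ^ 6) * r i ^ 6) := by
          gcongr
          exact (setLIntegral_le_lintegral _ _).trans hN6
      _ ≤ _ := by
          rw [← ENNReal.ofReal_mul (by positivity), ← ENNReal.ofReal_mul (by positivity),
            ← ENNReal.ofReal_add (by positivity) (by positivity)]
          refine ENNReal.ofReal_le_ofReal ?_
          have h1 : 2 / ρ ^ 2 / (n * r i) ^ 4 * (32 * (K + c ^ 6) * r i ^ 6) =
              C₂ / n * r i ^ 2 * (1 / n ^ 3) := by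
            rw [hC₂]; field_simp
          have h2 : C₂ / n * r i ^ 2 * (1 / n ^ 3) ≤ C₂ / n * r i ^ 2 := by
            refine mul_le_of_le_one_right (by positivity) ?_
            rw [div_le_one (by positivity)]
            exact one_le_pow₀ hn1.le
          rw [h1]
          calc _ ≤ (2 + 2 / ρ ^ 2) * (C₁ / n * r i ^ 2) + C₂ / n * r i ^ 2 := by linarith
            _ = _ := by ring
  rw [← lintegral_add_compl _ hAm]
  calc _ ≤ _ := add_le_add houtside hinside
    _ = ENNReal.ofReal (C / n * r i ^ 2) := by
        rw [← ENNReal.ofReal_add (by positivity) (by positivity),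
          ← ENNReal.ofReal_add (by positivity) (by positivity), hC]
        congr 1; ring
    _ ≤ _ := by gcongr

end SingleFile

namespace SingleFile

/-! ### Gaussian averages of a linearly growing function -/

lemma sq_integral_mul_le {α : Type*} [MeasurableSpace α] {μ : Measure α} {f g : α → ℝ}
    (hf : MemLp f 2 μ) (hg : MemLp g 2 μ) :
    (∫ x, f x * g x ∂μ) ^ 2 ≤ (∫ x, f x ^ 2 ∂μ) * ∫ x, g x ^ 2 ∂μ := by
  have hfg : Integrable (fun x => f x * g x) μ := hf.integrable_mul hg
  have hf2 := hf.integrable_sq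
  have hg2 := hg.integrable_sq
  have key : ∀ t : ℝ, 0 ≤ (∫ x, f x ^ 2 ∂μ) * (t * t) + (2 * ∫ x, f x * g x ∂μ) * t +
      ∫ x, g x ^ 2 ∂μ := by
    intro t
    have h1 : 0 ≤ ∫ x, (t * f x + g x) ^ 2 ∂μ := integral_nonneg fun _ => sq_nonneg _
    have h2 : ∀ x, (t * f x + g x) ^ 2 = t * t * f x ^ 2 + (2 * t) * (f x * g x) + g x ^ 2 :=
      fun x => by ring
    simp only [h2] at h1
    have i1 : Integrable (fun x => t * t * f x ^ 2 + (2 * t) * (f x * g x)) μ :=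
      (hf2.const_mul _).add (hfg.const_mul _)
    rw [integral_add i1 hg2, integral_add (hf2.const_mul _) (hfg.const_mul _),
      integral_const_mul, integral_const_mul] at h1
    linarith
  have := discrim_le_zero key
  rw [discrim] at this
  linarith

lemma integral_abs_gaussianReal (v : ℝ≥0) :
    ∫ x, |x| ∂(gaussianReal 0 v) = √(2 * v / Real.pi) := by
  have hstd : ∫ x, |x| ∂(gaussianReal 0 1) = √(2 / Real.pi) := by
    rw [integral_gaussianReal_eq_integral_smul one_ne_zero]
    have h1 : ∀ x : ℝ, gaussianPDFReal 0 1 x • |x| =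
        (fun x => (√(2 * Real.pi))⁻¹ * (x ^ (1 : ℝ) * Real.exp (-(1 / 2) * x ^ (2 : ℝ)))) |x| := by
      intro x
      simp only [gaussianPDFReal, smul_eq_mul, NNReal.coe_one, mul_one, sub_zero, Real.rpow_one,
        Real.rpow_two, sq_abs]
      rw [show -x ^ 2 / 2 = -(1 / 2) * x ^ 2 by ring]
      ring
    simp only [h1]
    rw [integral_comp_abs (f := fun x : ℝ =>
        (√(2 * Real.pi))⁻¹ * (x ^ (1 : ℝ) * Real.exp (-(1 / 2) * x ^ (2 : ℝ)))),
      integral_const_mul,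
      integral_rpow_mul_exp_neg_mul_rpow two_pos (by norm_num) (by norm_num)]
    norm_num
    have h2 : √(2 : ℝ) * √2 = 2 := Real.mul_self_sqrt (by norm_num)
    have h3 : 0 < √Real.pi := Real.sqrt_pos.2 Real.pi_pos
    field_simp
    linarith
  have h := gaussianReal_map_const_mul (μ := 0) (v := 1) (√(v : ℝ))
  have hv : NNReal.mk (√(v : ℝ) ^ 2) (sq_nonneg _) * 1 = v := by
    ext; simp
  rw [mul_zero, hv] at h
  rw [← h, integral_map (by fun_prop) (by fun_prop)]
  simp only [abs_mul, abs_of_nonneg (Real.sqrt_nonneg _)]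
  rw [integral_const_mul, hstd, ← Real.sqrt_mul v.coe_nonneg]
  congr 1; ring

/-- Change of measure for a shift of a Gaussian variable. -/
lemma abs_integral_gaussianReal_shift_le {v : ℝ≥0} (hv : v ≠ 0) (h : ℝ) {F : ℝ → ℝ}
    (hF : MemLp F 2 (gaussianReal 0 v)) :
    |∫ x, F x ∂(gaussianReal h v) - ∫ x, F x ∂(gaussianReal 0 v)| ≤
      √((∫ x, F x ^ 2 ∂(gaussianReal 0 v)) * (Real.exp (h ^ 2 / v) - 1)) := by
  have hv0 : (0 : ℝ) < v := by exact_mod_cast pos_iff_ne_zero.2 hv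
  -- The density of the shifted Gaussian with respect to the centred one. Cauchy–Schwarz against L -
  -- 1, whose squared norm is exp(h²/v) - 1, gives the bound.
  set L : ℝ → ℝ := fun x => Real.exp (h / v * x) * Real.exp (-(h ^ 2 / (2 * v))) with hL
  have hpdf : ∀ x, gaussianPDFReal h v x = gaussianPDFReal 0 v x * L x := by
    intro x
    simp only [gaussianPDFReal, hL]
    rw [← Real.exp_add, mul_assoc _ (Real.exp _), ← Real.exp_add]
    congr 2
    field_simp
    ring
  have hmgf : ∀ c : ℝ, ∫ x, Real.exp (c * x) ∂(gaussianReal 0 v) = Real.exp (v * c ^ 2 / 2) := by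
    intro c
    have := congrFun (mgf_id_gaussianReal (μ := 0) (v := v)) c
    simpa [mgf] using this
  have hL2pt : ∀ x, L x ^ 2 = Real.exp (2 * (h / v) * x) * Real.exp (-(h ^ 2 / v)) := by
    intro x
    simp only [hL]
    rw [mul_pow, ← Real.exp_nat_mul, ← Real.exp_nat_mul]
    congr 2 <;> · push_cast; field_simp
  have hLm : Measurable L := by fun_prop
  have hL2i : Integrable (fun x => L x ^ 2) (gaussianReal 0 v) := by
    simp only [hL2pt]
    exact (integrable_exp_mul_gaussianReal _).mul_const _
  have hLL : MemLp L 2 (gaussianReal 0 v) :=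
    (memLp_two_iff_integrable_sq hLm.aestronglyMeasurable).2 hL2i
  have hLi : Integrable L (gaussianReal 0 v) := (integrable_exp_mul_gaussianReal _).mul_const _
  have e1 : ∫ x, L x ∂(gaussianReal 0 v) = 1 := by
    simp only [hL]
    rw [integral_mul_const, hmgf, ← Real.exp_add, Real.exp_eq_one_iff]
    field_simp
    ring
  have e2 : ∫ x, L x ^ 2 ∂(gaussianReal 0 v) = Real.exp (h ^ 2 / v) := by
    simp only [hL2pt]
    rw [integral_mul_const, hmgf, ← Real.exp_add]
    congr 1
    field_simp
    ring
  have hG : MemLp (fun x => L x - 1) 2 (gaussianReal 0 v) := hLL.sub (memLp_const 1)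
  have e3 : ∫ x, (L x - 1) ^ 2 ∂(gaussianReal 0 v) = Real.exp (h ^ 2 / v) - 1 := by
    have : ∀ x, (L x - 1) ^ 2 = L x ^ 2 - (2 * L x - 1) := fun x => by ring
    simp only [this]
    have i1 : Integrable (fun x => 2 * L x - 1) (gaussianReal 0 v) :=
      (hLi.const_mul 2).sub (integrable_const _)
    rw [integral_sub hL2i i1, integral_sub (hLi.const_mul 2) (integrable_const _),
      integral_const_mul, e1, e2]
    simp
    ring
  have e4 : ∫ x, F x ∂(gaussianReal h v) = ∫ x, F x * L x ∂(gaussianReal 0 v) := by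
    rw [integral_gaussianReal_eq_integral_smul hv, integral_gaussianReal_eq_integral_smul hv]
    refine integral_congr_ae (ae_of_all _ fun x => ?_)
    simp only [hpdf, smul_eq_mul]
    ring
  have e5 : ∫ x, F x ∂(gaussianReal h v) - ∫ x, F x ∂(gaussianReal 0 v) =
      ∫ x, F x * (L x - 1) ∂(gaussianReal 0 v) := by
    have hFL : Integrable (fun x => F x * L x) (gaussianReal 0 v) := hF.integrable_mul hLL
    rw [e4, ← integral_sub hFL (hF.integrable one_le_two)]
    exact integral_congr_ae (ae_of_all _ fun x => by ring)
  rw [e5, ← e3]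
  exact Real.abs_le_sqrt (sq_integral_mul_le hF hG)

/-- A measurable function asymptotic to `ρ v` up to a sublinear error. -/
structure IsSublinearlyClose (ρ : ℝ) (n : ℝ → ℝ) : Prop where
  measurable : Measurable n
  close : ∀ ε : ℝ, 0 < ε → ∃ C : ℝ, 0 ≤ C ∧ ∀ v, |n v - ρ * v| ≤ ε * |v| + C

/-- The Gaussian average of `n`, with variance `v`, around `u`. -/
noncomputable def gaussMean (n : ℝ → ℝ) (v : ℝ≥0) (u : ℝ) : ℝ :=
  ∫ x, n (u + x) ∂(gaussianReal 0 v)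

lemma memLp_id_gaussian (v : ℝ≥0) : MemLp (fun x : ℝ => x) 2 (gaussianReal 0 v) := by
  exact memLp_id_gaussianReal (μ := 0) (v := v) 2

lemma integrable_id_gaussian (v : ℝ≥0) : Integrable (fun x : ℝ => x) (gaussianReal 0 v) :=
  (memLp_id_gaussian v).integrable one_le_two

lemma integral_sq_gaussian (v : ℝ≥0) : ∫ x, x ^ 2 ∂(gaussianReal 0 v) = v := by
  have h := variance_fun_id_gaussianReal (μ := 0) (v := v)
  rw [variance_eq_sub (memLp_id_gaussian v)] at h
  simpa using h

lemma integral_abs_gaussian_le (v : ℝ≥0) : ∫ x, |x| ∂(gaussianReal 0 v) ≤ √v := by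
  rw [integral_abs_gaussianReal]
  refine Real.sqrt_le_sqrt ?_
  rw [div_le_iff₀ Real.pi_pos]
  nlinarith [Real.pi_gt_three, v.coe_nonneg]

namespace IsSublinearlyClose

variable {ρ : ℝ} {n : ℝ → ℝ}

lemma measurable_shift (h : IsSublinearlyClose ρ n) (u : ℝ) : Measurable fun x => n (u + x) :=
  h.measurable.comp (measurable_const_add u)

lemma memLp_error (h : IsSublinearlyClose ρ n) (v : ℝ≥0) (u : ℝ) :
    MemLp (fun x => n (u + x) - ρ * (u + x)) 2 (gaussianReal 0 v) := by
  obtain ⟨C, hC, hn⟩ := h.close 1 one_pos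
  have hb : MemLp (fun x : ℝ => (|u| + C) + |x|) 2 (gaussianReal 0 v) :=
    (memLp_const (|u| + C)).add (memLp_id_gaussian v).abs
  refine hb.mono ((h.measurable_shift u).sub
    (measurable_const.mul (measurable_const_add u))).aestronglyMeasurable (ae_of_all _ fun x => ?_)
  rw [Real.norm_eq_abs, Real.norm_eq_abs]
  refine (hn (u + x)).trans (le_trans ?_ (le_abs_self _))
  linarith [abs_add_le u x]

lemma integrable_error (h : IsSublinearlyClose ρ n) (v : ℝ≥0) (u : ℝ) :
    Integrable (fun x => n (u + x) - ρ * (u + x)) (gaussianReal 0 v) :=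
  (h.memLp_error v u).integrable one_le_two

lemma gaussMean_sub (h : IsSublinearlyClose ρ n) (v : ℝ≥0) (u : ℝ) :
    gaussMean n v u - ρ * u = ∫ x, (n (u + x) - ρ * (u + x)) ∂(gaussianReal 0 v) := by
  have h1 : Integrable (fun x => ρ * (u + x)) (gaussianReal 0 v) :=
    ((integrable_const u).add (integrable_id_gaussian v)).const_mul ρ
  have h2 : ∫ x, ρ * (u + x) ∂(gaussianReal 0 v) = ρ * u := by
    rw [integral_const_mul, integral_add (integrable_const u) (integrable_id_gaussian v),
      integral_id_gaussianReal]
    simp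
  have h3 := integral_add (h.integrable_error v u) h1
  rw [h2] at h3
  have h4 : gaussMean n v u = ∫ x, (n (u + x) - ρ * (u + x) + ρ * (u + x)) ∂(gaussianReal 0 v) := by
    simp [gaussMean]
  rw [h4, h3]
  ring

lemma abs_gaussMean_sub_le_integral (h : IsSublinearlyClose ρ n) {ε C : ℝ} (hε : 0 ≤ ε)
    (hn : ∀ v, |n v - ρ * v| ≤ ε * |v| + C) (v : ℝ≥0) (u : ℝ) :
    |gaussMean n v u - ρ * u| ≤ ε * (|u| + √v) + C := by
  rw [h.gaussMean_sub]
  have i0 : Integrable (fun x : ℝ => |u| + |x|) (gaussianReal 0 v) :=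
    (integrable_const |u|).add (integrable_id_gaussian v).abs
  have i1 : Integrable (fun x : ℝ => ε * (|u| + |x|)) (gaussianReal 0 v) := i0.const_mul ε
  have hi : Integrable (fun x : ℝ => ε * (|u| + |x|) + C) (gaussianReal 0 v) :=
    i1.add (integrable_const C)
  calc _ ≤ ∫ x, |n (u + x) - ρ * (u + x)| ∂(gaussianReal 0 v) := abs_integral_le_integral_abs
    _ ≤ ∫ x, (ε * (|u| + |x|) + C) ∂(gaussianReal 0 v) := by
        refine integral_mono (h.integrable_error v u).abs hi fun x => (hn (u + x)).trans ?_
        gcongr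
        exact abs_add_le _ _
    _ = ε * (|u| + ∫ x, |x| ∂(gaussianReal 0 v)) + C := by
        rw [integral_add i1 (integrable_const C), integral_const_mul,
          integral_add (integrable_const |u|) (integrable_id_gaussian v).abs]
        simp
    _ ≤ _ := by gcongr; exact integral_abs_gaussian_le v

/-- Gaussian averaging reproduces linear functions exactly, so only the error n - ρ· is shifted, and
the shift can be put on the measure. -/
lemma abs_gaussMean_sub_sub_le_sqrt (h : IsSublinearlyClose ρ n) {v : ℝ≥0} (hv : v ≠ 0)
    (u a : ℝ) : |gaussMean n v (u + a) - gaussMean n v u - ρ * a| ≤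
      √((∫ x, (n (u + x) - ρ * (u + x)) ^ 2 ∂(gaussianReal 0 v)) *
        (Real.exp (a ^ 2 / v) - 1)) := by
  have h1 : ∫ x, (n (u + a + x) - ρ * (u + a + x)) ∂(gaussianReal 0 v) =
      ∫ x, (n (u + x) - ρ * (u + x)) ∂(gaussianReal a v) := by
    have hmap := gaussianReal_map_const_add (μ := 0) (v := v) a
    rw [zero_add] at hmap
    have hm : AEStronglyMeasurable (fun x => n (u + x) - ρ * (u + x))
        ((gaussianReal 0 v).map fun x => a + x) := ((h.measurable_shift u).sub
      (measurable_const.mul (measurable_const_add u))).aestronglyMeasurable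
    rw [← hmap, integral_map (measurable_const_add a).aemeasurable hm]
    simp only [add_assoc]
  have h2 := h.gaussMean_sub v (u + a)
  have h3 := h.gaussMean_sub v u
  rw [h1] at h2
  have h4 : gaussMean n v (u + a) - gaussMean n v u - ρ * a =
      ∫ x, (n (u + x) - ρ * (u + x)) ∂(gaussianReal a v) -
        ∫ x, (n (u + x) - ρ * (u + x)) ∂(gaussianReal 0 v) := by
    rw [← h2, ← h3]; ring
  rw [h4]
  exact abs_integral_gaussianReal_shift_le hv a (h.memLp_error v u)

/-- On scales below the standard deviation the averages are nearly affine with slope `ρ`. -/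
lemma eventually_abs_increment_le (h : IsSublinearlyClose ρ n) {ε : ℝ} (hε : 0 < ε) :
    ∀ᶠ v : ℝ≥0 in atTop, ∀ u a : ℝ, |u| ≤ √v → |a| ≤ √v →
      |gaussMean n v (u + a) - gaussMean n v u - ρ * a| ≤ ε * |a| := by
  -- For large v the mean squared error is at most 9(ε/5)²v and exp(a²/v) - 1 ≤ 2a²/v; their product
  -- is (18/25)ε²a².
  obtain ⟨C, hC, hn⟩ := h.close (ε / 5) (by positivity)
  filter_upwards [eventually_gt_atTop (0 : ℝ≥0),
    eventually_ge_atTop (Real.toNNReal (25 * C ^ 2 / ε ^ 2))] with v hv0 hvC u a hu ha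
  have hv : (0 : ℝ) < v := hv0
  have hvC' : 25 * C ^ 2 / ε ^ 2 ≤ v := Real.toNNReal_le_iff_le_coe.1 hvC
  have hs : 0 < √(v : ℝ) := Real.sqrt_pos.2 hv
  have hsv : √(v : ℝ) ^ 2 = v := Real.sq_sqrt hv.le
  have hCv : C ^ 2 ≤ (ε / 5) ^ 2 * v := by
    rw [div_le_iff₀ (by positivity)] at hvC'
    nlinarith
  have hu2 : u ^ 2 ≤ v := by rw [← sq_abs, ← hsv]; gcongr
  have ha2 : a ^ 2 ≤ v := by rw [← sq_abs, ← hsv]; gcongr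
  have hF : ∫ x, (n (u + x) - ρ * (u + x)) ^ 2 ∂(gaussianReal 0 v) ≤ 9 * (ε / 5) ^ 2 * v := by
    have hi : Integrable (fun x : ℝ => 3 * (ε / 5) ^ 2 * x ^ 2 + (3 * (ε / 5) ^ 2 * u ^ 2 + 3 * C ^ 2))
        (gaussianReal 0 v) :=
      ((memLp_id_gaussian v).integrable_sq.const_mul _).add (integrable_const _)
    calc _ ≤ ∫ x, (3 * (ε / 5) ^ 2 * x ^ 2 + (3 * (ε / 5) ^ 2 * u ^ 2 + 3 * C ^ 2))
          ∂(gaussianReal 0 v) := by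
          refine integral_mono (h.memLp_error v u).integrable_sq hi fun x => ?_
          simp only
          have h1 : |n (u + x) - ρ * (u + x)| ≤ ε / 5 * |u| + ε / 5 * |x| + C := by
            refine (hn (u + x)).trans ?_
            have := mul_le_mul_of_nonneg_left (abs_add_le u x) (by positivity : 0 ≤ ε / 5)
            linarith
          rw [← sq_abs]
          calc _ ≤ (ε / 5 * |u| + ε / 5 * |x| + C) ^ 2 := by gcongr
            _ ≤ 3 * ((ε / 5 * |u|) ^ 2 + (ε / 5 * |x|) ^ 2 + C ^ 2) := by
                nlinarith [sq_nonneg (ε / 5 * |u| - ε / 5 * |x|), sq_nonneg (ε / 5 * |u| - C),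
                  sq_nonneg (ε / 5 * |x| - C)]
            _ = _ := by rw [mul_pow, mul_pow, sq_abs, sq_abs]; ring
      _ = 3 * (ε / 5) ^ 2 * v + (3 * (ε / 5) ^ 2 * u ^ 2 + 3 * C ^ 2) := by
          rw [integral_add ((memLp_id_gaussian v).integrable_sq.const_mul _) (integrable_const _),
            integral_const_mul, integral_sq_gaussian]
          simp
      _ ≤ _ := by nlinarith [mul_le_mul_of_nonneg_left hu2 (sq_nonneg (ε / 5))]
  have hexp : Real.exp (a ^ 2 / v) - 1 ≤ 2 * (a ^ 2 / v) := by
    have h0 : 0 ≤ a ^ 2 / v := by positivity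
    have h1 : a ^ 2 / v ≤ 1 := by rw [div_le_one hv]; exact ha2
    have := (abs_le.1 (Real.abs_exp_sub_one_sub_id_le (abs_le.2 ⟨by linarith, h1⟩))).2
    nlinarith
  have hexp0 : 0 ≤ Real.exp (a ^ 2 / v) - 1 := by
    have := Real.add_one_le_exp (a ^ 2 / v)
    have h0 : 0 ≤ a ^ 2 / v := by positivity
    linarith
  refine (h.abs_gaussMean_sub_sub_le_sqrt hv0.ne' u a).trans ?_
  rw [Real.sqrt_le_left (by positivity), mul_pow, sq_abs]
  calc _ ≤ 9 * (ε / 5) ^ 2 * v * (2 * (a ^ 2 / v)) := by gcongr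
    _ = 18 / 25 * (ε ^ 2 * a ^ 2) := by field_simp; ring
    _ ≤ _ := by nlinarith [mul_nonneg (sq_nonneg ε) (sq_nonneg a)]

lemma eventually_abs_gaussMean_le (h : IsSublinearlyClose ρ n) {ε : ℝ} (hε : 0 < ε) :
    ∀ᶠ v : ℝ≥0 in atTop, ∀ u : ℝ, |gaussMean n v u - ρ * u| ≤ ε * (|u| + √v) := by
  obtain ⟨C, hC, hn⟩ := h.close (ε / 2) (by positivity)
  filter_upwards [eventually_ge_atTop (Real.toNNReal ((2 * C / ε) ^ 2))] with v hv u
  have hv' : (2 * C / ε) ^ 2 ≤ v := Real.toNNReal_le_iff_le_coe.1 hv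
  have h1 : 2 * C / ε ≤ √v := Real.le_sqrt_of_sq_le hv'
  rw [div_le_iff₀ hε] at h1
  refine (h.abs_gaussMean_sub_le_integral (by positivity) hn v u).trans ?_
  nlinarith [abs_nonneg u]

/-- The level at which the averaged function vanishes. -/
lemma exists_root (h : IsSublinearlyClose ρ n) (hρ : 0 < ρ) :
    ∃ q : ℝ≥0 → ℝ, (∀ᶠ v in atTop, gaussMean n v (q v) = 0) ∧
      ∀ δ : ℝ, 0 < δ → ∀ᶠ v : ℝ≥0 in atTop, |q v| ≤ δ * √v := by
  -- Intermediate value theorem on [-√v/2, √v/2]: the nearly affine increments give continuity, and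
  -- the endpoint values differ from ±ρ√v/2 by at most 3ρ√v/8.
  have hex : ∀ᶠ v : ℝ≥0 in atTop, ∃ q : ℝ, |q| ≤ √v ∧ gaussMean n v q = 0 := by
    filter_upwards [h.eventually_abs_gaussMean_le (ε := ρ / 4) (by positivity),
      h.eventually_abs_increment_le hρ, eventually_gt_atTop 0] with v h1 h2 hv0
    have hs : 0 < √(v : ℝ) := Real.sqrt_pos.2 hv0
    have hcont : ContinuousOn (gaussMean n v) (Set.Icc (-(√v / 2)) (√v / 2)) := by
      refine Metric.continuousOn_iff.2 fun u hu ε hε => ?_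
      refine ⟨ε / (2 * ρ), by positivity, fun w hw hdist => ?_⟩
      rw [Real.dist_eq] at hdist ⊢
      have h3 := h2 u (w - u) (abs_le.2 ⟨by linarith [hu.1], by linarith [hu.2]⟩)
        (abs_le.2 ⟨by linarith [hu.2, hw.1], by linarith [hu.1, hw.2]⟩)
      rw [add_sub_cancel] at h3
      have h4 : |ρ * (w - u)| = ρ * |w - u| := by rw [abs_mul, abs_of_pos hρ]
      have h5 := abs_add_le (gaussMean n v w - gaussMean n v u - ρ * (w - u)) (ρ * (w - u))
      rw [sub_add_cancel] at h5
      rw [lt_div_iff₀ (by positivity)] at hdist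
      linarith
    have hlo := (abs_le.1 (h1 (-(√v / 2)))).2
    have hhi := (abs_le.1 (h1 (√v / 2))).1
    rw [abs_neg, abs_of_pos (by positivity)] at hlo
    rw [abs_of_pos (by positivity)] at hhi
    have h0 : (0 : ℝ) ∈ Set.Icc (gaussMean n v (-(√v / 2))) (gaussMean n v (√v / 2)) := by
      constructor <;> nlinarith [mul_pos hρ hs]
    obtain ⟨q, hq, hq0⟩ := intermediate_value_Icc (by linarith) hcont h0
    exact ⟨q, abs_le.2 ⟨by linarith [hq.1], by linarith [hq.2]⟩, hq0⟩
  classical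
  refine ⟨fun v => if hq : ∃ q : ℝ, |q| ≤ √v ∧ gaussMean n v q = 0 then hq.choose else 0,
    ?_, fun δ hδ => ?_⟩
  · filter_upwards [hex] with v hv
    rw [dif_pos hv]
    exact hv.choose_spec.2
  · filter_upwards [hex, h.eventually_abs_gaussMean_le (ε := ρ * δ / 2) (by positivity)] with v hv h1
    rw [dif_pos hv]
    obtain ⟨h2, h3⟩ := hv.choose_spec
    have h4 := h1 hv.choose
    rw [h3, zero_sub, abs_neg, abs_mul, abs_of_pos hρ] at h4
    have h5 : ρ * |hv.choose| ≤ ρ * (δ * √v) := by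
      refine h4.trans ?_
      have : ρ * δ / 2 * (|hv.choose| + √v) ≤ ρ * δ / 2 * (√v + √v) := by gcongr
      linarith
    exact le_of_mul_le_mul_left h5 hρ

end IsSublinearlyClose

end SingleFile

namespace SingleFile

/-! ### Free displacements -/

variable {Ω : Type*} [MeasurableSpace Ω] {P : Measure Ω}

/-- The free displacement of particle `j` at time `t`. -/
noncomputable def displacement (σ : ℝ) (W : ℤ → ℝ≥0 → Ω → ℝ) (t : ℝ≥0) (j : ℤ) (ω : Ω) : ℝ :=
  σ / √2 * W j t ω

/-- The variance of the free displacement at time `t`. -/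
noncomputable def displacementVar (σ : ℝ) (t : ℝ≥0) : ℝ≥0 := Real.toNNReal (σ ^ 2 / 2) * t

lemma coe_displacementVar (σ : ℝ) (t : ℝ≥0) : (displacementVar σ t : ℝ) = σ ^ 2 / 2 * t := by
  rw [displacementVar, NNReal.coe_mul, Real.coe_toNNReal _ (by positivity)]

lemma tendsto_displacementVar {σ : ℝ} (hσ : 0 < σ) :
    Tendsto (displacementVar σ) atTop atTop := by
  refine Tendsto.const_mul_atTop ?_ tendsto_id
  exact Real.toNNReal_pos.2 (by positivity)

lemma sqrt_displacementVar {σ : ℝ} (hσ : 0 < σ) (t : ℝ≥0) :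
    √(displacementVar σ t : ℝ) = σ / √2 * √t := by
  rw [coe_displacementVar, Real.sqrt_mul (by positivity), Real.sqrt_div (by positivity),
    Real.sqrt_sq hσ.le]

/-- The left side is the mean absolute value of a free displacement at time t; `kappa` is normalised
so that this equals 2ρκ√t. -/
lemma sqrt_two_mul_displacementVar_div {σ ρ : ℝ} (hσ : 0 < σ) (hρ : 0 < ρ) (t : ℝ≥0) :
    √(2 * displacementVar σ t / Real.pi) = 2 * ρ * kappa σ ρ * √t := by
  rw [coe_displacementVar, kappa,
    show 2 * (σ ^ 2 / 2 * (t : ℝ)) / Real.pi = (σ ^ 2 / Real.pi) * t by ring,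
    Real.sqrt_mul (by positivity), Real.sqrt_div (by positivity), Real.sqrt_sq hσ.le]
  have : 0 < √Real.pi := Real.sqrt_pos.2 Real.pi_pos
  field_simp

lemma gaussianReal_const_mul_displacement {σ : ℝ} {Z : Ω → ℝ} {t : ℝ≥0}
    (h : HasLaw Z (gaussianReal 0 t) P) :
    HasLaw (fun ω => σ / √2 * Z ω) (gaussianReal 0 (displacementVar σ t)) P := by
  have h1 := gaussianReal_const_mul h (σ / √2)
  rw [mul_zero] at h1
  convert h1 using 2
  ext
  rw [coe_displacementVar]
  simp [div_pow]

namespace IsBrownianFamily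

variable {W : ℤ → ℝ≥0 → Ω → ℝ} {σ : ℝ}

lemma measurable_displacement (hW : IsBrownianFamily W P) (t : ℝ≥0) (j : ℤ) :
    Measurable (displacement σ W t j) := (hW.measurable j t).const_mul _

lemma hasLaw_displacement (hW : IsBrownianFamily W P) (t : ℝ≥0) (j : ℤ) :
    HasLaw (displacement σ W t j) (gaussianReal 0 (displacementVar σ t)) P :=
  gaussianReal_const_mul_displacement ((hW.brownian j).toIsPreBrownianReal.hasLaw_eval t)

lemma hasLaw_displacement_sub_self (hW : IsBrownianFamily W P) (s t : ℝ≥0) (j : ℤ) :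
    HasLaw (fun ω => displacement σ W s j ω - displacement σ W t j ω)
      (gaussianReal 0 (displacementVar σ (nndist (s : ℝ) t))) P := by
  have h := gaussianReal_const_mul_displacement (σ := σ)
    ((hW.brownian j).toIsPreBrownianReal.hasLaw_sub s t)
  refine h.congr (ae_of_all _ fun ω => ?_)
  simp only [displacement, Pi.sub_apply]
  ring

lemma integral_abs_displacement (hW : IsBrownianFamily W P) (hσ : 0 < σ) {ρ : ℝ} (hρ : 0 < ρ)
    (t : ℝ≥0) (j : ℤ) :
    ∫ ω, |displacement σ W t j ω| ∂P = 2 * ρ * kappa σ ρ * √t := by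
  have h := (hW.hasLaw_displacement (σ := σ) t j).integral_comp (f := fun x => |x|)
    (by fun_prop)
  rw [integral_abs_gaussianReal, sqrt_two_mul_displacementVar_div hσ hρ] at h
  exact h

lemma integral_abs_displacement_sub_self (hW : IsBrownianFamily W P) (hσ : 0 < σ) {ρ : ℝ}
    (hρ : 0 < ρ) (s t : ℝ≥0) (j : ℤ) :
    ∫ ω, |displacement σ W s j ω - displacement σ W t j ω| ∂P =
      2 * ρ * kappa σ ρ * √|(t : ℝ) - s| := by
  have h := (hW.hasLaw_displacement_sub_self (σ := σ) s t j).integral_comp (f := fun x => |x|)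
    (by fun_prop)
  rw [integral_abs_gaussianReal, sqrt_two_mul_displacementVar_div hσ hρ] at h
  rw [abs_sub_comm, ← Real.dist_eq, ← coe_nndist]
  exact h

/-- Averaging over the displacement of a particle is a Gaussian average. -/
lemma integral_sub_displacement (hW : IsBrownianFamily W P) {n : ℝ → ℝ} (hn : Measurable n)
    (t : ℝ≥0) (u : ℝ) :
    ∫ ω, n (u - displacement σ W t 0 ω) ∂P = gaussMean n (displacementVar σ t) u := by
  have h1 := gaussianReal_neg (hW.hasLaw_displacement (σ := σ) t 0)
  rw [neg_zero] at h1
  have h := h1.integral_comp (f := fun x => n (u + x))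
    (hn.comp (measurable_const_add u)).aestronglyMeasurable
  simpa only [gaussMean, Function.comp_def, Pi.neg_apply, ← sub_eq_add_neg] using h

/-- For different particles the variances add, whereas for one particle only the elapsed time
counts. This contrast is the source of √(s+t) and √|t-s|. -/
lemma hasLaw_displacement_sub_of_ne (hW : IsBrownianFamily W P) (s t : ℝ≥0) {i j : ℤ}
    (hij : i ≠ j) :
    HasLaw (fun ω => displacement σ W s i ω - displacement σ W t j ω)
      (gaussianReal 0 (displacementVar σ (s + t))) P := by
  have hind : IndepFun (W i s) (-W j t) P :=
    (hW.indep.indepFun hij).comp (φ := fun w : ℝ≥0 → ℝ => w s) (ψ := fun w : ℝ≥0 → ℝ => -w t)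
      (by fun_prop) (by fun_prop)
  have h1 := gaussianReal_add_gaussianReal_of_indepFun hind
    ((hW.brownian i).toIsPreBrownianReal.hasLaw_eval s).map_eq
    (gaussianReal_neg ((hW.brownian j).toIsPreBrownianReal.hasLaw_eval t)).map_eq
  have h2 : HasLaw (W i s + -W j t) (gaussianReal 0 (s + t)) P :=
    ⟨((hW.measurable i s).add (hW.measurable j t).neg).aemeasurable, by rw [h1]; simp⟩
  refine (gaussianReal_const_mul_displacement (σ := σ) h2).congr (ae_of_all _ fun ω => ?_)
  simp only [displacement, Pi.add_apply, Pi.neg_apply]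
  ring

lemma isNoisePair (hW : IsBrownianFamily W P) (s t : ℝ≥0) :
    IsNoisePair (displacement σ W s) (displacement σ W t) P where
  measurable_left := hW.measurable_displacement s
  measurable_right := hW.measurable_displacement t
  indep := hW.indep.comp (fun _ (w : ℝ≥0 → ℝ) => (σ / √2 * w s, σ / √2 * w t)) fun _ => by
    fun_prop
  ident j := by
    have h : ∀ i, HasLaw (fun ω => ({s, t} : Finset ℝ≥0).restrict fun r => W i r ω) _ P :=
      fun i => (hW.brownian i).toIsPreBrownianReal.hasLaw {s, t}
    have h1 : IdentDistrib (fun ω => ({s, t} : Finset ℝ≥0).restrict fun r => W j r ω)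
        (fun ω => ({s, t} : Finset ℝ≥0).restrict fun r => W 0 r ω) P P :=
      ⟨(h j).aemeasurable, (h 0).aemeasurable, (h j).map_eq.trans (h 0).map_eq.symm⟩
    exact h1.comp (u := fun x : ({s, t} : Finset ℝ≥0) → ℝ =>
      (σ / √2 * x ⟨s, by simp⟩, σ / √2 * x ⟨t, by simp⟩)) (by fun_prop)
  integrable_left := ((hW.brownian 0).toIsPreBrownianReal.integrable_eval s).const_mul _
  integrable_right := ((hW.brownian 0).toIsPreBrownianReal.integrable_eval t).const_mul _

lemma integral_abs_displacement_sub_of_ne (hW : IsBrownianFamily W P) (hσ : 0 < σ) {ρ : ℝ}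
    (hρ : 0 < ρ) (s t : ℝ≥0) {i j : ℤ} (hij : i ≠ j) :
    ∫ ω, |displacement σ W s i ω - displacement σ W t j ω| ∂P =
      2 * ρ * kappa σ ρ * √((s : ℝ) + t) := by
  have h := (hW.hasLaw_displacement_sub_of_ne (σ := σ) s t hij).integral_comp (f := fun x => |x|)
    (by fun_prop)
  rw [integral_abs_gaussianReal, sqrt_two_mul_displacementVar_div hσ hρ] at h
  exact_mod_cast h

end IsBrownianFamily

/-- The number of particles that have crossed the level `u` at time `t`. -/
noncomputable def freeCrossing (σ : ℝ) (y : ℤ → ℝ) (W : ℤ → ℝ≥0 → Ω → ℝ) (t : ℝ≥0) (u : ℝ)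
    (ω : Ω) : ℝ :=
  crossing (fun j => y j + displacement σ W t j ω) u

end SingleFile

namespace SingleFile

/-! ### The tracer as inverse of the counting function -/

variable {Ω : Type*} [MeasurableSpace Ω] {P : Measure Ω}

lemma IsSingleFileSystem.ae_tracer_le_iff {σ : ℝ} {y : Ω → ℤ → ℝ} {W X : ℤ → ℝ≥0 → Ω → ℝ}
    (h : IsSingleFileSystem σ y W X P) (hW : IsBrownianFamily W P)
    (hy : ∀ᵐ ω ∂P, IsNice (y ω)) (t : ℝ≥0) :
    ∀ᵐ ω ∂P, ∀ u, (X 0 t ω ≤ u → 1 ≤ freeCrossing σ (y ω) W t u ω) ∧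
      (u < X 0 t ω → freeCrossing σ (y ω) W t u ω ≤ 0) := by
  have hc : ∀ᵐ ω ∂P, ∀ j, Continuous fun t => W j t ω :=
    ae_all_iff.2 fun j => (hW.brownian j).cont
  filter_upwards [h.history, hW.ae_sublinear, hc, hy] with ω h1 h2 h3 h4 u
  exact h1.tracer_le_iff (isLocallyDivergent_freePaths h4 h2)
    (fun j => continuous_const.add (continuous_const.mul (h3 j))) t u

lemma IsSingleFileSystem.isCountInverse {σ : ℝ} {y : Ω → ℤ → ℝ} {W X : ℤ → ℝ≥0 → Ω → ℝ}
    (h : IsSingleFileSystem σ y W X P) (hW : IsBrownianFamily W P)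
    (hy : ∀ᵐ ω ∂P, IsNice (y ω)) (t : ℝ≥0) (q : ℝ) :
    IsCountInverse (fun ω => X 0 t ω - q) (fun a ω => freeCrossing σ (y ω) W t (q + a) ω) P := by
  intro a
  filter_upwards [h.ae_tracer_le_iff hW hy t] with ω hω
  exact ⟨fun h1 => (hω _).1 (by linarith), fun h1 => (hω _).2 (by linarith)⟩

/-- The positions `X` are, up to errors of smaller order than `t ^ (1 / 4)`, an affine function of
the counts `N`. -/
structure IsTracerExpansion (ρ : ℝ) (X N : ℝ≥0 → Ω → ℝ) (q : ℝ≥0 → ℝ) (P : Measure Ω) : Prop where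
  memLp_position : ∀ t, MemLp (X t) 2 P
  memLp_count : ∀ t, MemLp (N t) 2 P
  error : ∀ ε : ℝ, 0 < ε → ∀ᶠ t in atTop,
    ∫⁻ ω, ENNReal.ofReal ((X t ω - q t + N t ω / ρ) ^ 2) ∂P ≤ ENNReal.ofReal (ε * √(t : ℝ))

lemma tendsto_sqrt_sqrt_atTop : Tendsto (fun t : ℝ≥0 => √(√(t : ℝ))) atTop atTop :=
  Real.tendsto_sqrt_atTop.comp (Real.tendsto_sqrt_atTop.comp
    (NNReal.tendsto_coe_atTop.2 tendsto_id))

/-! ### Quenched initial state -/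

section Quenched

variable {σ ρ : ℝ} {y : ℤ → ℝ} {W : ℤ → ℝ≥0 → Ω → ℝ}

lemma IsQuenchedInitial.isSublinearlyClose (hρ : 0 < ρ) (hy : IsQuenchedInitial ρ y) :
    IsSublinearlyClose ρ (crossing y) where
  measurable := (hy.isNice hρ).monotone_crossing.measurable
  close _ hε := hy.abs_crossing_sub_le hρ hε

lemma IsBrownianFamily.measurable_freeCrossing (hW : IsBrownianFamily W P) (t : ℝ≥0) (u : ℝ) :
    Measurable (freeCrossing σ y W t u) :=
  (hW.isNoisePair (σ := σ) t t).measurable_crossing u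

lemma IsNice.integral_abs_crossing_le (hy : IsNice y) (hW : IsBrownianFamily W P) :
    ∃ C : ℝ, 0 < C ∧ ∀ t u, ∫ ω, |crossing y (u - displacement σ W t 0 ω)| ∂P ≤
      C * (1 + |u| + √(displacementVar σ t)) := by
  obtain ⟨C, hC, h⟩ := hy.abs_crossing_le
  refine ⟨C, hC, fun t u => ?_⟩
  have hm := hy.monotone_crossing.measurable
  have h0 := hW.integral_sub_displacement (σ := σ) (n := fun x => |crossing y x|) hm.abs t u
  rw [h0, gaussMean]
  set v := displacementVar σ t
  have i0 : Integrable (fun x : ℝ => 1 + |u| + |x|) (gaussianReal 0 v) :=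
    (integrable_const (1 + |u|)).add (integrable_id_gaussian v).abs
  calc _ ≤ ∫ x, C * (1 + |u| + |x|) ∂(gaussianReal 0 v) := by
        refine integral_mono_of_nonneg (ae_of_all _ fun _ => abs_nonneg _) (i0.const_mul C)
          (ae_of_all _ fun x => (h (u + x)).trans ?_)
        exact mul_le_mul_of_nonneg_left (by linarith [abs_add_le u x]) hC.le
    _ = C * (1 + |u| + ∫ x, |x| ∂(gaussianReal 0 v)) := by
        rw [integral_const_mul, integral_add (integrable_const (1 + |u|))
          (integrable_id_gaussian v).abs]
        simp
    _ ≤ _ := by gcongr; exact integral_abs_gaussian_le v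

variable [IsProbabilityMeasure P]

lemma IsNice.lintegral_freeCrossing_pow_six_le (hy : IsNice y) (hW : IsBrownianFamily W P) :
    ∃ C : ℝ, 0 < C ∧ ∀ t u, ∫⁻ ω, ENNReal.ofReal ((freeCrossing σ y W t u ω -
      gaussMean (crossing y) (displacementVar σ t) u) ^ 6) ∂P ≤
        ENNReal.ofReal (4320 * (1 + C * (1 + |u| + √(displacementVar σ t))) ^ 3) := by
  obtain ⟨C, hC, h⟩ := hy.integral_abs_crossing_le (σ := σ) hW
  refine ⟨C, hC, fun t u => ?_⟩
  have h1 := (hW.isNoisePair (σ := σ) t t).lintegral_pow_six_le hy u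
  rw [hW.integral_sub_displacement hy.monotone_crossing.measurable] at h1
  refine h1.trans (ENNReal.ofReal_le_ofReal ?_)
  have : 0 ≤ ∫ ω, |crossing y (u - displacement σ W t 0 ω)| ∂P :=
    integral_nonneg fun _ => abs_nonneg _
  gcongr
  exact h t u

/-- Decomposition into fluctuation and bias: the variance of the increment is at most its mean, and
the bias is the deviation of the mean from the linear profile. -/
lemma IsNice.lintegral_increment_sq_le (hy : IsNice y) (hW : IsBrownianFamily W P) (t : ℝ≥0)
    (a b : ℝ) :
    ∫⁻ ω, ENNReal.ofReal ((freeCrossing σ y W t b ω - freeCrossing σ y W t a ω -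
      ρ * (b - a)) ^ 2) ∂P ≤
      ENNReal.ofReal (2 * |gaussMean (crossing y) (displacementVar σ t) b -
        gaussMean (crossing y) (displacementVar σ t) a| +
        2 * (gaussMean (crossing y) (displacementVar σ t) b -
        gaussMean (crossing y) (displacementVar σ t) a - ρ * (b - a)) ^ 2) := by
  wlog hab : a ≤ b generalizing a b
  · have h := this b a (not_le.1 hab).le
    rw [abs_sub_comm] at h
    convert h using 3
    · ring_nf
    · ring_nf
  have hnp := hW.isNoisePair (σ := σ) t t
  have hm := hy.monotone_crossing.measurable
  have h1 := hnp.variance_increment_le hy hab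
  rw [hW.integral_sub_displacement hm, hW.integral_sub_displacement hm] at h1
  set ma := gaussMean (crossing y) (displacementVar σ t) a
  set mb := gaussMean (crossing y) (displacementVar σ t) b
  have hL : MemLp (fun ω => freeCrossing σ y W t b ω - freeCrossing σ y W t a ω - (mb - ma)) 2 P :=
    ((hnp.memLp_crossing hy b).sub (hnp.memLp_crossing hy a)).sub (memLp_const _)
  have hL2 := hL.integrable_sq
  have i1 : Integrable (fun ω => 2 * (freeCrossing σ y W t b ω - freeCrossing σ y W t a ω -
      (mb - ma)) ^ 2 + 2 * (mb - ma - ρ * (b - a)) ^ 2) P :=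
    (hL2.const_mul 2).add (integrable_const _)
  calc _ ≤ ∫⁻ ω, ENNReal.ofReal (2 * (freeCrossing σ y W t b ω - freeCrossing σ y W t a ω -
      (mb - ma)) ^ 2 + 2 * (mb - ma - ρ * (b - a)) ^ 2) ∂P := by
        refine lintegral_mono fun ω => ENNReal.ofReal_le_ofReal ?_
        nlinarith [sq_nonneg ((freeCrossing σ y W t b ω - freeCrossing σ y W t a ω -
          (mb - ma)) - (mb - ma - ρ * (b - a)))]
    _ = ENNReal.ofReal (∫ ω, (2 * (freeCrossing σ y W t b ω - freeCrossing σ y W t a ω -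
      (mb - ma)) ^ 2 + 2 * (mb - ma - ρ * (b - a)) ^ 2) ∂P) :=
        (ofReal_integral_eq_lintegral_ofReal i1 (ae_of_all _ fun _ => by positivity)).symm
    _ ≤ _ := by
        refine ENNReal.ofReal_le_ofReal ?_
        rw [integral_add (hL2.const_mul 2) (integrable_const _), integral_const_mul]
        have : mb - ma ≤ |mb - ma| := le_abs_self _
        simp only [integral_const, probReal_univ, one_smul]
        have h2 : ∫ ω, (freeCrossing σ y W t b ω - freeCrossing σ y W t a ω - (mb - ma)) ^ 2 ∂P ≤
            mb - ma := h1
        linarith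

lemma IsQuenchedInitial.memLp_tracer {X : ℤ → ℝ≥0 → Ω → ℝ} (hρ : 0 < ρ)
    (hy : IsQuenchedInitial ρ y) (hW : IsBrownianFamily W P)
    (hX : IsSingleFileSystem σ (fun _ => y) W X P) (t : ℝ≥0) : MemLp (X 0 t) 2 P := by
  have hn := hy.isNice hρ
  have hcl := hy.isSublinearlyClose hρ
  obtain ⟨C, hC, h6⟩ := hn.lintegral_freeCrossing_pow_six_le (σ := σ) hW
  obtain ⟨C', hC', hmean⟩ := hcl.close (ρ / 2) (by positivity)
  set s := √(displacementVar σ t : ℝ) with hs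
  have hs0 : 0 ≤ s := Real.sqrt_nonneg _
  have hinv := hX.isCountInverse hW (ae_of_all _ fun _ => hn) t 0
  simp only [sub_zero, zero_add] at hinv
  refine hinv.memLp_two hρ (hX.measurable 0 t) (K := 4320 * (1 + C * (1 + s)) ^ 3) (R := 1)
    (c := ρ / 2 * s + C') (m := gaussMean (crossing y) (displacementVar σ t))
    ⟨hW.measurable_freeCrossing t, fun a => ?_, fun a => ?_⟩ (by positivity) zero_le_one
  · refine (h6 t a).trans (ENNReal.ofReal_le_ofReal ?_)
    rw [mul_assoc, ← mul_pow]
    gcongr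
    nlinarith [mul_nonneg hC.le (abs_nonneg a), abs_nonneg a,
      mul_nonneg (mul_nonneg hC.le hs0) (abs_nonneg a)]
  · have := hcl.abs_gaussMean_sub_le_integral (by positivity) hmean (displacementVar σ t) a
    linarith

/-- The tracer expansion around the level at which the mean count at time `t` vanishes. -/
theorem IsQuenchedInitial.exists_isTracerExpansion {X : ℤ → ℝ≥0 → Ω → ℝ} (hσ : 0 < σ)
    (hρ : 0 < ρ) (hy : IsQuenchedInitial ρ y) (hW : IsBrownianFamily W P)
    (hX : IsSingleFileSystem σ (fun _ => y) W X P) :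
    ∃ q : ℝ≥0 → ℝ,
      (∀ᶠ t in atTop, gaussMean (crossing y) (displacementVar σ t) (q t) = 0) ∧
      (∀ δ : ℝ, 0 < δ → ∀ᶠ t : ℝ≥0 in atTop, |q t| ≤ δ * √(t : ℝ)) ∧
      IsTracerExpansion ρ (X 0) (fun t => freeCrossing σ y W t (q t)) q P := by
  have hn := hy.isNice hρ
  have hcl := hy.isSublinearlyClose hρ
  obtain ⟨C, hC, h6⟩ := hn.lintegral_freeCrossing_pow_six_le (σ := σ) hW
  obtain ⟨q, hq0, hqδ⟩ := hcl.exists_root hρ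
  have hv := tendsto_displacementVar hσ
  set s : ℝ := σ / √2 with hs
  have hs0 : 0 < s := by positivity
  set m : ℝ≥0 → ℝ → ℝ := fun t => gaussMean (crossing y) (displacementVar σ t) with hm
  have hsv : ∀ t : ℝ≥0, √(displacementVar σ t : ℝ) = s * √t := sqrt_displacementVar hσ
  have hroot : ∀ᶠ t in atTop, m t (q (displacementVar σ t)) = 0 := hv.eventually hq0
  have hsmall : ∀ δ : ℝ, 0 < δ → ∀ᶠ t : ℝ≥0 in atTop, |q (displacementVar σ t)| ≤ δ * √(t : ℝ) := by
    intro δ hδ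
    filter_upwards [hv.eventually (hqδ (δ / s) (by positivity))] with t ht
    rw [hsv] at ht
    refine ht.trans (le_of_eq ?_)
    field_simp
  refine ⟨fun t => q (displacementVar σ t), hroot, hsmall, hy.memLp_tracer hρ hW hX, fun t =>
    (hW.isNoisePair t t).memLp_crossing hn _, fun ε hε => ?_⟩
  have hr2 : ∀ t : ℝ≥0, √√(t : ℝ) ^ 2 = √t := fun t => Real.sq_sqrt (Real.sqrt_nonneg _)
  have hinc : ∀ ε : ℝ, 0 < ε → ∀ᶠ t : ℝ≥0 in atTop, ∀ a, |a| ≤ √(displacementVar σ t) →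
      |m t (q (displacementVar σ t) + a) - m t (q (displacementVar σ t)) - ρ * a| ≤ ε * |a| := by
    intro ε hε
    filter_upwards [hv.eventually (hcl.eventually_abs_increment_le hε),
      hv.eventually (hqδ 1 one_pos)] with t h1 h2 a ha
    exact h1 _ a (by simpa using h2) ha
  -- The length scale is r = t^{1/4}, so r² = √t is the order of the variance of the count. The
  -- coordinate is centred at the root, where the mean count is 0 for large t.
  have main := eventually_lintegral_inverse_add_le (P := P) (l := atTop) (ρ := ρ)
    (K := 4320 * (1 + C + 2 * C * s) ^ 3) (c := 0) hρ (by positivity) le_rfl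
    (r := fun t : ℝ≥0 => √(√(t : ℝ))) tendsto_sqrt_sqrt_atTop
    (Y := fun t ω => X 0 t ω - q (displacementVar σ t)) (fun t => (hX.measurable 0 t).sub_const _)
    (N := fun t a => freeCrossing σ y W t (q (displacementVar σ t) + a))
    (m := fun t a => m t (q (displacementVar σ t) + a))
    (Eventually.of_forall fun t => hX.isCountInverse hW (ae_of_all _ fun _ => hn) t _) ?_ ?_ hε
  · filter_upwards [main] with t ht
    simpa only [add_zero, hr2] using ht
  · filter_upwards [hroot, hv.eventually (hqδ (1 / 4) (by positivity)), hinc (ρ / 2) (by positivity),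
      hv.eventually (hcl.eventually_abs_gaussMean_le (ε := ρ / 12) (by positivity)),
      eventually_ge_atTop 1] with t h1 h2 h3 h4 h5
    have ht1 : 1 ≤ √(t : ℝ) := Real.one_le_sqrt.2 (by exact_mod_cast h5)
    refine ⟨fun a => hW.measurable_freeCrossing t _, fun a => ?_, fun a => ?_⟩
    · refine (h6 t _).trans (ENNReal.ofReal_le_ofReal ?_)
      rw [mul_assoc, ← mul_pow, hr2]
      gcongr
      rw [hsv] at h2 ⊢
      have h7 := abs_add_le (q (displacementVar σ t)) a
      have h8 : |q (displacementVar σ t) + a| ≤ s * √t + |a| := by nlinarith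
      have h9 := mul_le_mul_of_nonneg_left h8 hC.le
      have h10 := mul_le_mul_of_nonneg_left ht1 hC.le
      nlinarith [abs_nonneg a, mul_nonneg (mul_nonneg hC.le hs0.le) (abs_nonneg a),
        mul_nonneg hC.le (abs_nonneg a)]
    -- Within one standard deviation the increment estimate applies, since the mean vanishes at the
    -- root. Farther out the global bound on the mean is enough, because the root is at most |a|/4.
    · rcases le_total |a| √(displacementVar σ t) with ha | ha
      · have := h3 a ha
        rw [h1, sub_zero] at this
        linarith
      · have h7 : |m t (q (displacementVar σ t) + a) - ρ * (q (displacementVar σ t) + a)| ≤ _ :=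
          h4 (q (displacementVar σ t) + a)
        have h8 : m t (q (displacementVar σ t) + a) - ρ * a =
          (m t (q (displacementVar σ t) + a) - ρ * (q (displacementVar σ t) + a)) +
            ρ * q (displacementVar σ t) := by ring
        have h9 := abs_add_le (q (displacementVar σ t)) a
        rw [h8]
        refine (abs_add_le _ _).trans ?_
        rw [abs_mul, abs_of_pos hρ]
        have h10 : |q (displacementVar σ t)| ≤ 1 / 4 * |a| := h2.trans (by gcongr)
        have h11 := mul_le_mul_of_nonneg_left h9 hρ.le
        have h12 := mul_le_mul_of_nonneg_left h10 hρ.le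
        have h13 := mul_le_mul_of_nonneg_left ha hρ.le
        have h14 := mul_nonneg hρ.le (abs_nonneg a)
        refine (add_le_add_left h7 _).trans ?_
        linarith
  · intro b ε hε
    -- The squared bias is at most η²b²r², and η makes twice that at most half of ε r². The variance
    -- is only of order r, hence negligible against r².
    obtain ⟨η, hη0, hη1, hη⟩ : ∃ η : ℝ, 0 < η ∧ η ≤ 1 ∧ 2 * η ^ 2 * b ^ 2 ≤ ε / 2 := by
      refine ⟨min 1 (ε / (4 * (b ^ 2 + 1))), by positivity, min_le_left _ _, ?_⟩
      have h1 : min 1 (ε / (4 * (b ^ 2 + 1))) ≤ 1 := min_le_left _ _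
      have h2 : min 1 (ε / (4 * (b ^ 2 + 1))) * (4 * (b ^ 2 + 1)) ≤ ε :=
        (le_div_iff₀ (by positivity)).1 (min_le_right _ _)
      have h0 : 0 < min 1 (ε / (4 * (b ^ 2 + 1))) := by positivity
      have h3 : min 1 (ε / (4 * (b ^ 2 + 1))) ^ 2 ≤ min 1 (ε / (4 * (b ^ 2 + 1))) := by nlinarith
      nlinarith [sq_nonneg b]
    have hlarge : ∀ᶠ t : ℝ≥0 in atTop, |b| / s ≤ √√(t : ℝ) :=
      tendsto_sqrt_sqrt_atTop.eventually_ge_atTop _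
    have hlarge2 : ∀ᶠ t : ℝ≥0 in atTop, 4 * ((ρ + 1) * |b|) / ε ≤ √√(t : ℝ) :=
      tendsto_sqrt_sqrt_atTop.eventually_ge_atTop _
    filter_upwards [hinc η hη0, hlarge, hlarge2] with t h1 h2 h3
    set r := √√(t : ℝ) with hr
    have hr0 : 0 ≤ r := Real.sqrt_nonneg _
    have habs : |b * r| = |b| * r := by rw [abs_mul, abs_of_nonneg hr0]
    have h4 := h1 (b * r) (by
      rw [hsv, ← hr2, ← hr, habs]
      rw [div_le_iff₀ hs0] at h2
      nlinarith)
    refine (le_of_eq ?_).trans ((hn.lintegral_increment_sq_le (σ := σ) (ρ := ρ) hW t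
      (q (displacementVar σ t)) (q (displacementVar σ t) + b * r)).trans
      (ENNReal.ofReal_le_ofReal ?_))
    · simp only [add_zero, add_sub_cancel_left]
    · rw [add_sub_cancel_left]
      have h5 : |m t (q (displacementVar σ t) + b * r) - m t (q (displacementVar σ t))| ≤
          (ρ + 1) * |b| * r := by
        have := abs_add_le (m t (q (displacementVar σ t) + b * r) -
          m t (q (displacementVar σ t)) - ρ * (b * r)) (ρ * (b * r))
        rw [sub_add_cancel, abs_mul ρ, abs_of_pos hρ, habs] at this
        rw [habs] at h4
        have h6 : η * (|b| * r) ≤ 1 * (|b| * r) := by gcongr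
        linarith
      have h6 : (m t (q (displacementVar σ t) + b * r) -
          m t (q (displacementVar σ t)) - ρ * (b * r)) ^ 2 ≤ η ^ 2 * b ^ 2 * r ^ 2 := by
        rw [← sq_abs, ← sq_abs b, ← mul_pow, ← mul_pow, mul_assoc, ← habs]
        gcongr
      rw [div_le_iff₀ hε] at h3
      have h7 : 2 * ((ρ + 1) * |b| * r) ≤ ε / 2 * r ^ 2 := by nlinarith
      have h8 : 2 * η ^ 2 * b ^ 2 * r ^ 2 ≤ ε / 2 * r ^ 2 := by gcongr
      simp only [hm] at h5 h6
      linarith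

end Quenched

end SingleFile

namespace SingleFile

/-! ### Quenched covariance of the counts -/

variable {Ω : Type*} [MeasurableSpace Ω] {P : Measure Ω}

lemma tendsto_div_sqrt_of_eventually_le {f : ℝ≥0 → ℝ} {c : ℝ}
    (h : ∀ δ : ℝ, 0 < δ → ∀ᶠ t : ℝ≥0 in atTop, |f t - c * √(t : ℝ)| ≤ δ * √(t : ℝ)) :
    Tendsto (fun t => f t / √(t : ℝ)) atTop (𝓝 c) := by
  rw [Metric.tendsto_nhds]
  intro ε hε
  filter_upwards [h (ε / 2) (by positivity), eventually_gt_atTop 0] with t ht ht0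
  have hs : 0 < √(t : ℝ) := Real.sqrt_pos.2 ht0
  rw [Real.dist_eq, show f t / √(t : ℝ) - c = (f t - c * √(t : ℝ)) / √(t : ℝ) by field_simp,
    abs_div, abs_of_pos hs, div_lt_iff₀ hs]
  nlinarith

lemma tendsto_const_mul_atTop_nnreal {τ : ℝ≥0} (hτ : 0 < τ) :
    Tendsto (fun t : ℝ≥0 => τ * t) atTop atTop := Tendsto.const_mul_atTop hτ tendsto_id

lemma eventually_const_le_mul_sqrt (C : ℝ) {δ : ℝ} (hδ : 0 < δ) :
    ∀ᶠ t : ℝ≥0 in atTop, C ≤ δ * √(t : ℝ) :=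
  (Tendsto.const_mul_atTop hδ (Real.tendsto_sqrt_atTop.comp
    (NNReal.tendsto_coe_atTop.2 tendsto_id))).eventually_ge_atTop C

lemma min_eq_half_add_sub_abs (a b : ℝ) : min a b = (a + b - |a - b|) / 2 := by
  rcases le_total a b with h | h
  · rw [min_eq_left h, abs_of_nonpos (by linarith)]; ring
  · rw [min_eq_right h, abs_of_nonneg (by linarith)]; ring

variable {σ ρ : ℝ} {y : ℤ → ℝ} {W : ℤ → ℝ≥0 → Ω → ℝ}

lemma IsBrownianFamily.integrable_displacement (hW : IsBrownianFamily W P) (t : ℝ≥0) (j : ℤ) :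
    Integrable (displacement σ W t j) P :=
  ((hW.brownian j).toIsPreBrownianReal.integrable_eval t).const_mul _

lemma IsBrownianFamily.integral_displacement (hW : IsBrownianFamily W P) (t : ℝ≥0) (j : ℤ) :
    ∫ ω, displacement σ W t j ω ∂P = 0 := by
  have h := (hW.brownian j).toIsPreBrownianReal.integral_eval t
  simp only [displacement]
  rw [integral_const_mul, h, mul_zero]

variable [IsProbabilityMeasure P]

/-- The crossing function is replaced by ρ times its argument, the minimum by half of sum minus
absolute difference, and centering removes the sum. The levels p and q shift the result by at most a
multiple of |p|+|q|. -/
lemma IsNice.abs_integral_crossing_min_sub_le (hy : IsNice y) (hW : IsBrownianFamily W P)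
    (hσ : 0 < σ) (hρ : 0 < ρ) {ε C : ℝ} (hε : 0 ≤ ε)
    (hn : ∀ v, |crossing y v - ρ * v| ≤ ε * |v| + C) (s t : ℝ≥0) (j : ℤ) (p q : ℝ) :
    |∫ ω, crossing y (min (p - displacement σ W s 0 ω) (q - displacement σ W t j ω)) ∂P +
        ρ / 2 * ∫ ω, |displacement σ W s 0 ω - displacement σ W t j ω| ∂P| ≤
      ε * (|p| + |q| + 2 * ρ * kappa σ ρ * (√(s : ℝ) + √(t : ℝ))) + C + ρ * (|p| + |q|) := by
  set ξ := displacement σ W s 0 with hξ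
  set η := displacement σ W t j with hη
  have iξ : Integrable ξ P := hW.integrable_displacement s 0
  have iη : Integrable η P := hW.integrable_displacement t j
  have mξ : Measurable ξ := hW.measurable_displacement s 0
  have mη : Measurable η := hW.measurable_displacement t j
  have eξ : ∫ ω, ξ ω ∂P = 0 := hW.integral_displacement s 0
  have eη : ∫ ω, η ω ∂P = 0 := hW.integral_displacement t j
  have i1 : Integrable (fun ω => p - ξ ω) P := (integrable_const p).sub iξ
  have i2 : Integrable (fun ω => q - η ω) P := (integrable_const q).sub iη
  set V : Ω → ℝ := fun ω => min (p - ξ ω) (q - η ω) with hV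
  have iV : Integrable V P := i1.inf i2
  have mV : Measurable V := (mξ.const_sub p).min (mη.const_sub q)
  have inV : Integrable (fun ω => crossing y (V ω)) P := hy.integrable_crossing mV iV
  have iρV : Integrable (fun ω => ρ * V ω) P := iV.const_mul ρ
  have idiff : Integrable (fun ω => ξ ω - η ω) P := iξ.sub iη
  have iabs : Integrable (fun ω => |ξ ω - η ω|) P := idiff.abs
  have i3 : Integrable (fun ω => |p| + |ξ ω|) P := (integrable_const _).add iξ.abs
  have i4 : Integrable (fun ω => |q| + |η ω|) P := (integrable_const _).add iη.abs
  have i5 : Integrable (fun ω => |p| + |ξ ω| + (|q| + |η ω|)) P := i3.add i4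
  have i6 : Integrable (fun ω => ε * (|p| + |ξ ω| + (|q| + |η ω|))) P := i5.const_mul ε
  have hVabs : ∀ ω, |V ω| ≤ |p| + |ξ ω| + (|q| + |η ω|) := by
    intro ω
    have h1 := abs_sub p (ξ ω)
    have h2 := abs_sub q (η ω)
    have h3 := abs_min_le_max_abs_abs (a := p - ξ ω) (b := q - η ω)
    refine h3.trans (max_le ?_ ?_)
    · linarith [abs_nonneg q, abs_nonneg (η ω)]
    · linarith [abs_nonneg p, abs_nonneg (ξ ω)]
  have e1 : |∫ ω, crossing y (V ω) ∂P - ∫ ω, ρ * V ω ∂P| ≤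
      ε * (|p| + |q| + 2 * ρ * kappa σ ρ * (√(s : ℝ) + √(t : ℝ))) + C := by
    rw [← integral_sub inV iρV]
    calc _ ≤ ∫ ω, |crossing y (V ω) - ρ * V ω| ∂P := abs_integral_le_integral_abs
      _ ≤ ∫ ω, (ε * (|p| + |ξ ω| + (|q| + |η ω|)) + C) ∂P := by
          refine integral_mono (inV.sub iρV).abs (i6.add (integrable_const C)) fun ω => ?_
          refine (hn _).trans ?_
          have := mul_le_mul_of_nonneg_left (hVabs ω) hε
          linarith
      _ = _ := by
          rw [integral_add i6 (integrable_const C), integral_const_mul, integral_add i3 i4,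
            integral_add (integrable_const _) iξ.abs, integral_add (integrable_const _) iη.abs,
            hW.integral_abs_displacement hσ hρ, hW.integral_abs_displacement hσ hρ]
          simp only [integral_const, probReal_univ, one_smul]
          ring
  have e2 : |∫ ω, ρ * V ω ∂P + ρ / 2 * ∫ ω, |ξ ω - η ω| ∂P| ≤ ρ * (|p| + |q|) := by
    rw [← integral_const_mul, ← integral_add iρV (iabs.const_mul _)]
    have i7 : Integrable (fun ω => ρ / 2 * (ξ ω + η ω)) P := (iξ.add iη).const_mul _
    -- The added term has mean zero, and with it the integrand is bounded pointwise by ρ(|p|+|q|).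
    have e3 : ∫ ω, (ρ * V ω + ρ / 2 * |ξ ω - η ω|) ∂P =
        ∫ ω, (ρ * V ω + ρ / 2 * |ξ ω - η ω| + ρ / 2 * (ξ ω + η ω)) ∂P := by
      have i8 : Integrable (fun ω => ρ * V ω + ρ / 2 * |ξ ω - η ω|) P :=
        iρV.add (iabs.const_mul _)
      rw [integral_add i8 i7, integral_const_mul (ρ / 2) (fun ω => ξ ω + η ω),
        integral_add iξ iη, eξ, eη]
      simp
    rw [e3]
    have e4 : ∀ ω, ‖ρ * V ω + ρ / 2 * |ξ ω - η ω| + ρ / 2 * (ξ ω + η ω)‖ ≤ ρ * (|p| + |q|) := by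
      intro ω
      have h1 : V ω = (p - ξ ω + (q - η ω) - |p - ξ ω - (q - η ω)|) / 2 :=
        min_eq_half_add_sub_abs _ _
      rw [Real.norm_eq_abs, h1, show ρ * ((p - ξ ω + (q - η ω) - |p - ξ ω - (q - η ω)|) / 2) +
        ρ / 2 * |ξ ω - η ω| + ρ / 2 * (ξ ω + η ω) =
        ρ / 2 * (p + q + (|ξ ω - η ω| - |p - ξ ω - (q - η ω)|)) by ring, abs_mul,
        abs_of_pos (by positivity : 0 < ρ / 2)]
      have h2 := abs_abs_sub_abs_le_abs_sub (η ω - ξ ω) (p - ξ ω - (q - η ω))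
      rw [abs_sub_comm (η ω), show η ω - ξ ω - (p - ξ ω - (q - η ω)) = q - p by ring] at h2
      have h3 := abs_sub q p
      have h4 := abs_add_le (p + q) (|ξ ω - η ω| - |p - ξ ω - (q - η ω)|)
      have h5 := abs_add_le p q
      have h6 : |p + q + (|ξ ω - η ω| - |p - ξ ω - (q - η ω)|)| ≤ 2 * (|p| + |q|) := by linarith
      calc _ ≤ ρ / 2 * (2 * (|p| + |q|)) := by gcongr
        _ = _ := by ring
    have := norm_integral_le_of_norm_le_const (μ := P) (ae_of_all P e4)
    simpa using this
  have := abs_add_le (∫ ω, crossing y (V ω) ∂P - ∫ ω, ρ * V ω ∂P)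
    (∫ ω, ρ * V ω ∂P + ρ / 2 * ∫ ω, |ξ ω - η ω| ∂P)
  rw [show ∫ ω, crossing y (V ω) ∂P - ∫ ω, ρ * V ω ∂P +
    (∫ ω, ρ * V ω ∂P + ρ / 2 * ∫ ω, |ξ ω - η ω| ∂P) =
      ∫ ω, crossing y (V ω) ∂P + ρ / 2 * ∫ ω, |ξ ω - η ω| ∂P by ring] at this
  linarith

/-- In the exact covariance formula the two expected minima differ, to leading order, by
(ρ/2)(E|ξ_0-η_1| - E|ξ_0-η_0|), which equals ρ² times `quenchedCorr`. Errors are o(√t) since the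
initial profile is sublinearly close to linear and q is o(√t). -/
theorem IsQuenchedInitial.tendsto_covariance_count (hσ : 0 < σ) (hρ : 0 < ρ)
    (hy : IsQuenchedInitial ρ y) (hW : IsBrownianFamily W P) {q : ℝ≥0 → ℝ}
    (hq : ∀ δ : ℝ, 0 < δ → ∀ᶠ t : ℝ≥0 in atTop, |q t| ≤ δ * √(t : ℝ)) {τ₁ τ₂ : ℝ≥0}
    (h1 : 0 < τ₁) (h2 : 0 < τ₂) :
    Tendsto (fun t : ℝ≥0 => cov[freeCrossing σ y W (τ₁ * t) (q (τ₁ * t)),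
      freeCrossing σ y W (τ₂ * t) (q (τ₂ * t)); P] / √(t : ℝ)) atTop
      (𝓝 (ρ ^ 2 * quenchedCorr σ ρ τ₁ τ₂)) := by
  have hn := hy.isNice hρ
  refine tendsto_div_sqrt_of_eventually_le fun δ hδ => ?_
  have hκ : 0 < kappa σ ρ := by unfold kappa; positivity
  -- Half of A, times √t, dominates the bracket multiplied by ε in the error bound, because θ ≤ 1
  -- bounds each level by √t.
  set A : ℝ := 2 * (2 * ρ * kappa σ ρ * (√(τ₁ : ℝ) + √(τ₂ : ℝ)) + 2) with hA
  have hA0 : 0 < A := by positivity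
  obtain ⟨C, hC, hcl⟩ := hy.abs_crossing_sub_le hρ (ε := δ / (4 * A)) (by positivity)
  obtain ⟨θ, hθ0, hθ1, hθ⟩ : ∃ θ : ℝ, 0 < θ ∧ θ ≤ 1 ∧ 4 * ρ * θ ≤ δ / 4 := by
    refine ⟨min 1 (δ / (16 * ρ)), by positivity, min_le_left _ _, ?_⟩
    have := (le_div_iff₀ (by positivity)).1 (min_le_right 1 (δ / (16 * ρ)))
    linarith
  have hqτ : ∀ τ : ℝ≥0, 0 < τ → ∀ᶠ t : ℝ≥0 in atTop, |q (τ * t)| ≤ θ * √(t : ℝ) := by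
    intro τ hτ
    have hτ' : 0 < √(τ : ℝ) := Real.sqrt_pos.2 hτ
    filter_upwards [(tendsto_const_mul_atTop_nnreal hτ).eventually
      (hq (θ / √(τ : ℝ)) (by positivity))] with t ht
    refine ht.trans (le_of_eq ?_)
    rw [NNReal.coe_mul, Real.sqrt_mul τ.coe_nonneg]
    field_simp
  filter_upwards [hqτ τ₁ h1, hqτ τ₂ h2, eventually_const_le_mul_sqrt (2 * C)
    (δ := δ / 4) (by positivity)] with t hq1 hq2 ht
  set s := √(t : ℝ) with hs
  have hs0 : 0 ≤ s := Real.sqrt_nonneg _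
  have hnp := hW.isNoisePair (σ := σ) (τ₁ * t) (τ₂ * t)
  have hcov := hnp.covariance_crossing hn (q (τ₁ * t)) (q (τ₂ * t))
  have hcov' : cov[freeCrossing σ y W (τ₁ * t) (q (τ₁ * t)),
      freeCrossing σ y W (τ₂ * t) (q (τ₂ * t)); P] = _ :=
    (covariance_eq_sub (hnp.memLp_crossing hn _) (hnp.swap.memLp_crossing hn _)).trans hcov
  have hb := fun j => hn.abs_integral_crossing_min_sub_le hW hσ hρ (by positivity) hcl (τ₁ * t)
    (τ₂ * t) j (q (τ₁ * t)) (q (τ₂ * t))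
  have hb0 := hb 0
  have hb1 := hb 1
  rw [hW.integral_abs_displacement_sub_self hσ hρ] at hb0
  rw [hW.integral_abs_displacement_sub_of_ne hσ hρ _ _ (by norm_num : (0 : ℤ) ≠ 1)] at hb1
  have r1 : ∀ τ : ℝ≥0, √((τ * t : ℝ≥0) : ℝ) = √(τ : ℝ) * s := fun τ => by
    rw [NNReal.coe_mul, Real.sqrt_mul τ.coe_nonneg]
  have r2 : √|((τ₂ * t : ℝ≥0) : ℝ) - (τ₁ * t : ℝ≥0)| = √|(τ₂ : ℝ) - τ₁| * s := by
    rw [NNReal.coe_mul, NNReal.coe_mul, ← sub_mul, abs_mul, Real.sqrt_mul (abs_nonneg _),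
      abs_of_nonneg t.coe_nonneg]
  have r3 : √(((τ₁ * t : ℝ≥0) : ℝ) + (τ₂ * t : ℝ≥0)) = √((τ₁ : ℝ) + τ₂) * s := by
    rw [NNReal.coe_mul, NNReal.coe_mul, ← add_mul, Real.sqrt_mul (by positivity)]
  rw [r1, r1, r2] at hb0
  rw [r1, r1, r3] at hb1
  set B := δ / (4 * A) * (|q (τ₁ * t)| + |q (τ₂ * t)| + 2 * ρ * kappa σ ρ *
    (√(τ₁ : ℝ) * s + √(τ₂ : ℝ) * s)) + C + ρ * (|q (τ₁ * t)| + |q (τ₂ * t)|) with hB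
  have hB1 : 2 * B ≤ δ * s := by
    have hq3 : |q (τ₁ * t)| + |q (τ₂ * t)| ≤ 2 * θ * s := by linarith
    have hq4 : 2 * θ * s ≤ 2 * s := by nlinarith
    have e1 : δ / (4 * A) * (|q (τ₁ * t)| + |q (τ₂ * t)| + 2 * ρ * kappa σ ρ *
        (√(τ₁ : ℝ) * s + √(τ₂ : ℝ) * s)) ≤ δ / (4 * A) * (A / 2 * s) := by
      gcongr
      rw [hA]
      linarith
    have e2 : δ / (4 * A) * (A / 2 * s) = δ / 8 * s := by field_simp; ring
    have e3 : ρ * (|q (τ₁ * t)| + |q (τ₂ * t)|) ≤ ρ * (2 * θ * s) := by gcongr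
    have e4 : 4 * ρ * θ * s ≤ δ / 4 * s := by gcongr
    rw [hB]
    nlinarith [mul_nonneg hδ.le hs0]
  rw [hcov', quenchedCorr]
  have := abs_sub _ _ |>.trans (add_le_add hb0 hb1)
  refine le_trans (le_of_eq ?_) (this.trans (by linarith))
  congr 1
  ring

/-! ### From counts to positions -/

/-- Cauchy–Schwarz in an asymmetric form: the first factor keeps the raw second moment because this
is what is known about the expansion error. -/
lemma sq_covariance_le {f g : Ω → ℝ} (hf : MemLp f 2 P) (hg : MemLp g 2 P) :
    cov[f, g; P] ^ 2 ≤ (∫ ω, f ω ^ 2 ∂P) * cov[g, g; P] := by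
  have h1 := sq_integral_mul_le (hf.sub (memLp_const (∫ ω, f ω ∂P)))
    (hg.sub (memLp_const (∫ ω, g ω ∂P)))
  have h2 : Var[f; P] ≤ ∫ ω, f ω ^ 2 ∂P := variance_le_expectation_sq hf.aestronglyMeasurable
  rw [variance_eq_integral hf.aemeasurable] at h2
  have h3 : cov[g, g; P] = ∫ ω, (g ω - ∫ ω, g ω ∂P) ^ 2 ∂P := by
    rw [covariance_self hg.aemeasurable, variance_eq_integral hg.aemeasurable]
  rw [h3]
  have h4 : 0 ≤ ∫ ω, (g ω - ∫ ω, g ω ∂P) ^ 2 ∂P := integral_nonneg fun _ => sq_nonneg _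
  exact h1.trans (mul_le_mul_of_nonneg_right h2 h4)

namespace IsTracerExpansion

variable {X N : ℝ≥0 → Ω → ℝ} {q : ℝ≥0 → ℝ}

lemma memLp_error (h : IsTracerExpansion ρ X N q P) (t : ℝ≥0) :
    MemLp (fun ω => X t ω - q t + N t ω / ρ) 2 P :=
  ((h.memLp_position t).sub (memLp_const _)).add ((h.memLp_count t).mul_const ρ⁻¹)

lemma tendsto_integral_error_sq (h : IsTracerExpansion ρ X N q P) {τ : ℝ≥0} (hτ : 0 < τ) :
    Tendsto (fun t : ℝ≥0 => (∫ ω, (X (τ * t) ω - q (τ * t) + N (τ * t) ω / ρ) ^ 2 ∂P) /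
      √(t : ℝ)) atTop (𝓝 0) := by
  refine tendsto_div_sqrt_of_eventually_le fun δ hδ => ?_
  have hτ' : 0 < √(τ : ℝ) := Real.sqrt_pos.2 hτ
  filter_upwards [(tendsto_const_mul_atTop_nnreal hτ).eventually
    (h.error (δ / √(τ : ℝ)) (by positivity))] with t ht
  rw [← ofReal_integral_eq_lintegral_ofReal (h.memLp_error _).integrable_sq
    (ae_of_all _ fun _ => sq_nonneg _), ENNReal.ofReal_le_ofReal_iff (by positivity)] at ht
  rw [zero_mul, sub_zero, abs_of_nonneg (integral_nonneg fun _ => sq_nonneg _)]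
  refine ht.trans (le_of_eq ?_)
  rw [NNReal.coe_mul, Real.sqrt_mul τ.coe_nonneg]
  field_simp

lemma tendsto_zero_of_sq_le {f a b : ℝ≥0 → ℝ} {c : ℝ} (h : ∀ t, f t ^ 2 ≤ a t * b t)
    (ha : Tendsto (fun t : ℝ≥0 => a t / √(t : ℝ)) atTop (𝓝 0))
    (hb : Tendsto (fun t : ℝ≥0 => b t / √(t : ℝ)) atTop (𝓝 c)) :
    Tendsto (fun t : ℝ≥0 => f t / √(t : ℝ)) atTop (𝓝 0) := by
  have h1 : Tendsto (fun t : ℝ≥0 => (f t / √(t : ℝ)) ^ 2) atTop (𝓝 0) := by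
    have h2 := ha.mul hb
    rw [zero_mul] at h2
    refine squeeze_zero (fun _ => sq_nonneg _) (fun t => ?_) h2
    rw [div_pow, div_mul_div_comm, ← sq]
    exact div_le_div_of_nonneg_right (h t) (sq_nonneg _)
  have h3 := h1.sqrt
  simp only [Real.sqrt_sq_eq_abs, Real.sqrt_zero] at h3
  exact (tendsto_zero_iff_abs_tendsto_zero _).2 h3

/-- Write X = q + E - N/ρ, with deterministic q and E of second moment o(√t). By Cauchy–Schwarz
every covariance involving E is o(√t), the diagonal limits c₁ and c₂ serving to bound the variances
of N. What remains is the covariance of the counts divided by ρ². -/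
theorem tendsto_covariance (h : IsTracerExpansion ρ X N q P) (hρ : 0 < ρ) {τ₁ τ₂ : ℝ≥0}
    (h1 : 0 < τ₁) (h2 : 0 < τ₂) {c₁ c₂ c : ℝ}
    (hc₁ : Tendsto (fun t : ℝ≥0 => cov[N (τ₁ * t), N (τ₁ * t); P] / √(t : ℝ)) atTop (𝓝 c₁))
    (hc₂ : Tendsto (fun t : ℝ≥0 => cov[N (τ₂ * t), N (τ₂ * t); P] / √(t : ℝ)) atTop (𝓝 c₂))
    (hc : Tendsto (fun t : ℝ≥0 => cov[N (τ₁ * t), N (τ₂ * t); P] / √(t : ℝ)) atTop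
      (𝓝 (ρ ^ 2 * c))) :
    Tendsto (fun t : ℝ≥0 => cov[X (τ₁ * t), X (τ₂ * t); P] / √(t : ℝ)) atTop (𝓝 c) := by
  set E : ℝ≥0 → Ω → ℝ := fun t ω => X t ω - q t + N t ω / ρ with hE
  have mE : ∀ t, MemLp (E t) 2 P := h.memLp_error
  have mN := h.memLp_count
  have e1 := h.tendsto_integral_error_sq h1
  have e2 := h.tendsto_integral_error_sq h2
  have a1 : Tendsto (fun t : ℝ≥0 => cov[E (τ₁ * t), N (τ₂ * t); P] / √(t : ℝ)) atTop (𝓝 0) :=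
    tendsto_zero_of_sq_le (fun t => sq_covariance_le (mE _) (mN _)) e1 hc₂
  have a2 : Tendsto (fun t : ℝ≥0 => cov[E (τ₂ * t), N (τ₁ * t); P] / √(t : ℝ)) atTop (𝓝 0) :=
    tendsto_zero_of_sq_le (fun t => sq_covariance_le (mE _) (mN _)) e2 hc₁
  have a3 : Tendsto (fun t : ℝ≥0 => cov[E (τ₁ * t), E (τ₂ * t); P] / √(t : ℝ)) atTop (𝓝 0) := by
    refine tendsto_zero_of_sq_le (fun t => (sq_covariance_le (mE _) (mE _)).trans
      (mul_le_mul_of_nonneg_left ?_ (integral_nonneg fun _ => sq_nonneg _))) e1 e2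
    rw [covariance_self (mE _).aemeasurable]
    exact variance_le_expectation_sq (mE _).aestronglyMeasurable
  have hX : ∀ t, X t = fun ω => E t ω - N t ω / ρ + q t := fun t => funext fun ω => by
    simp only [hE]; ring
  have mD : ∀ t, MemLp (fun ω => N t ω / ρ) 2 P := fun t => (mN t).mul_const ρ⁻¹
  have key : ∀ t s, cov[X t, X s; P] = cov[E t, E s; P] - cov[E t, N s; P] / ρ -
      cov[E s, N t; P] / ρ + cov[N t, N s; P] / ρ ^ 2 := by
    intro t s
    have hI : ∀ t, Integrable (fun ω => E t ω - N t ω / ρ) P := fun t =>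
      ((mE t).sub (mD t)).integrable one_le_two
    rw [hX t, hX s, covariance_add_const_left (hI t), covariance_add_const_right (hI s),
      covariance_fun_sub_fun_sub (mE t) (mD t) (mE s) (mD s), covariance_fun_div_right,
      covariance_fun_div_left, covariance_fun_div_left, covariance_fun_div_right,
      covariance_comm (X := N t) (Y := E s)]
    field_simp
  have hlim := ((a3.sub (a1.div_const ρ)).sub (a2.div_const ρ)).add (hc.div_const (ρ ^ 2))
  rw [show 0 - 0 / ρ - 0 / ρ + ρ ^ 2 * c / ρ ^ 2 = c by field_simp; ring] at hlim
  refine hlim.congr fun t => ?_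
  rw [key]
  ring

/-- The mean of X is q - E N/ρ, which is bounded, plus the mean of the error, which is o(t^{1/4}).
The product of the two means is therefore o(√t), and covariance and raw moment have the same limit.
-/
lemma tendsto_integral_mul (h : IsTracerExpansion ρ X N q P) {τ₁ τ₂ : ℝ≥0}
    (h1 : 0 < τ₁) (h2 : 0 < τ₂) {B c : ℝ}
    (hB : ∀ᶠ t in atTop, |q t - (∫ ω, N t ω ∂P) / ρ| ≤ B)
    (hc : Tendsto (fun t : ℝ≥0 => cov[X (τ₁ * t), X (τ₂ * t); P] / √(t : ℝ)) atTop (𝓝 c)) :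
    Tendsto (fun t : ℝ≥0 => (∫ ω, X (τ₁ * t) ω * X (τ₂ * t) ω ∂P) / √(t : ℝ)) atTop (𝓝 c) := by
  have hmean : ∀ τ : ℝ≥0, 0 < τ →
      Tendsto (fun t : ℝ≥0 => (∫ ω, X (τ * t) ω ∂P) ^ 2 / √(t : ℝ)) atTop (𝓝 0) := by
    intro τ hτ
    have e1 := h.tendsto_integral_error_sq hτ
    have e2 : Tendsto (fun t : ℝ≥0 => B ^ 2 / √(t : ℝ)) atTop (𝓝 0) :=
      tendsto_const_nhds.div_atTop (Real.tendsto_sqrt_atTop.comp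
        (NNReal.tendsto_coe_atTop.2 tendsto_id))
    have e3 := (e1.add e2).const_mul 2
    rw [add_zero, mul_zero] at e3
    refine squeeze_zero' (Eventually.of_forall fun t => by positivity) ?_ e3
    filter_upwards [(tendsto_const_mul_atTop_nnreal hτ).eventually hB] with t ht
    have mE := h.memLp_error (τ * t)
    have iX := (h.memLp_position (τ * t)).integrable one_le_two
    have iN : Integrable (fun ω => N (τ * t) ω / ρ) P :=
      ((h.memLp_count (τ * t)).integrable one_le_two).div_const ρ
    have iXq : Integrable (fun ω => X (τ * t) ω - q (τ * t)) P := iX.sub (integrable_const _)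
    have hE : ∫ ω, (X (τ * t) ω - q (τ * t) + N (τ * t) ω / ρ) ∂P =
        ∫ ω, X (τ * t) ω ∂P - (q (τ * t) - (∫ ω, N (τ * t) ω ∂P) / ρ) := by
      rw [integral_add iXq iN, integral_sub iX (integrable_const _), integral_div]
      simp only [integral_const, probReal_univ, one_smul]
      ring
    have hJ := sq_integral_mul_le mE (memLp_const (1 : ℝ))
    simp only [mul_one, one_pow, integral_const, probReal_univ, one_smul] at hJ
    rw [hE] at hJ
    set D := q (τ * t) - (∫ ω, N (τ * t) ω ∂P) / ρ
    have hD : D ^ 2 ≤ B ^ 2 := by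
      rw [← sq_abs]
      gcongr
    rw [← add_div, ← mul_div_assoc]
    refine div_le_div_of_nonneg_right ?_ (Real.sqrt_nonneg _)
    nlinarith [sq_nonneg ((∫ ω, X (τ * t) ω ∂P) - D - D)]
  have hprod : Tendsto (fun t : ℝ≥0 => (∫ ω, X (τ₁ * t) ω ∂P) * (∫ ω, X (τ₂ * t) ω ∂P) /
      √(t : ℝ)) atTop (𝓝 0) :=
    tendsto_zero_of_sq_le (fun t => (mul_pow _ _ 2).le) (hmean τ₁ h1) (hmean τ₂ h2)
  have := hc.add hprod
  rw [add_zero] at this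
  refine this.congr fun t => ?_
  rw [covariance_eq_sub (h.memLp_position _) (h.memLp_position _), ← add_div]
  simp

end IsTracerExpansion

end SingleFile

namespace SingleFile

/-! ### The correlations -/

/-- Positivity of the limit matters: equivalence to the zero function would mean eventual vanishing.
-/
lemma isEquivalent_of_tendsto_div_sqrt {f : ℝ≥0 → ℝ} {c : ℝ} (hc : 0 < c)
    (h : Tendsto (fun t : ℝ≥0 => f t / √(t : ℝ)) atTop (𝓝 c)) :
    f ~[atTop] fun t : ℝ≥0 => c * √(t : ℝ) := by
  have hpos : ∀ᶠ t : ℝ≥0 in atTop, 0 < c * √(t : ℝ) := by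
    filter_upwards [eventually_gt_atTop 0] with t ht
    exact mul_pos hc (Real.sqrt_pos.2 ht)
  refine (isEquivalent_iff_tendsto_one (hpos.mono fun t ht => ht.ne')).2 ?_
  have h1 := h.div_const c
  rw [div_self hc.ne'] at h1
  refine h1.congr fun t => ?_
  rw [Pi.div_apply, div_div, mul_comm c]

lemma kappa_pos {σ ρ : ℝ} (hσ : 0 < σ) (hρ : 0 < ρ) : 0 < kappa σ ρ := by
  unfold kappa; positivity

lemma annealedCorr_pos {σ ρ : ℝ} (hσ : 0 < σ) (hρ : 0 < ρ) {τ₁ τ₂ : ℝ≥0} (h1 : 0 < τ₁)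
    (h2 : 0 < τ₂) : 0 < annealedCorr σ ρ τ₁ τ₂ := by
  have h1' : (0 : ℝ) < τ₁ := h1
  have h2' : (0 : ℝ) < τ₂ := h2
  refine mul_pos (kappa_pos hσ hρ) ?_
  have hs1 := Real.sqrt_pos.2 h1'
  have hs2 := Real.sqrt_pos.2 h2'
  have : √|(τ₂ : ℝ) - τ₁| < √(τ₁ : ℝ) + √(τ₂ : ℝ) := by
    rw [Real.sqrt_lt' (by positivity), add_sq, Real.sq_sqrt h1'.le, Real.sq_sqrt h2'.le, abs_lt]
    constructor <;> nlinarith [mul_pos hs1 hs2]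
  linarith

lemma quenchedCorr_pos {σ ρ : ℝ} (hσ : 0 < σ) (hρ : 0 < ρ) {τ₁ τ₂ : ℝ≥0} (h1 : 0 < τ₁)
    (h2 : 0 < τ₂) : 0 < quenchedCorr σ ρ τ₁ τ₂ := by
  have h1' : (0 : ℝ) < τ₁ := h1
  have h2' : (0 : ℝ) < τ₂ := h2
  refine mul_pos (kappa_pos hσ hρ) ?_
  have : √|(τ₂ : ℝ) - τ₁| < √((τ₁ : ℝ) + τ₂) := by
    refine Real.sqrt_lt_sqrt (abs_nonneg _) ?_
    rw [abs_lt]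
    constructor <;> linarith
  linarith

lemma annealedCorr_mul (σ ρ : ℝ) (τ₁ τ₂ t : ℝ≥0) :
    annealedCorr σ ρ (τ₁ * t) (τ₂ * t) = annealedCorr σ ρ τ₁ τ₂ * √(t : ℝ) := by
  unfold annealedCorr
  rw [← sub_mul, abs_mul, abs_of_nonneg t.coe_nonneg, Real.sqrt_mul τ₁.coe_nonneg,
    Real.sqrt_mul τ₂.coe_nonneg, Real.sqrt_mul (abs_nonneg _)]
  ring

lemma quenchedCorr_mul (σ ρ : ℝ) (τ₁ τ₂ t : ℝ≥0) :
    quenchedCorr σ ρ (τ₁ * t) (τ₂ * t) = quenchedCorr σ ρ τ₁ τ₂ * √(t : ℝ) := by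
  unfold quenchedCorr
  rw [← sub_mul, ← add_mul, abs_mul, abs_of_nonneg t.coe_nonneg, Real.sqrt_mul (by positivity),
    Real.sqrt_mul (abs_nonneg _)]
  ring

variable {Ω : Type*} [MeasurableSpace Ω] {P : Measure Ω} [IsProbabilityMeasure P]
  {σ ρ : ℝ} {W X : ℤ → ℝ≥0 → Ω → ℝ}

theorem IsQuenchedInitial.tracer_correlations {y : ℤ → ℝ} (hσ : 0 < σ) (hρ : 0 < ρ)
    (hy : IsQuenchedInitial ρ y) (hW : IsBrownianFamily W P)
    (hX : IsSingleFileSystem σ (fun _ => y) W X P) {τ₁ τ₂ : ℝ≥0} (h1 : 0 < τ₁) (h2 : 0 < τ₂) :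
    ((fun t : ℝ≥0 => cov[X 0 (τ₁ * t), X 0 (τ₂ * t); P]) ~[atTop]
      fun t : ℝ≥0 => quenchedCorr σ ρ (τ₁ * t) (τ₂ * t)) ∧
    ((∀ j : ℤ, y j = j / ρ) →
      (fun t : ℝ≥0 => ∫ ω, X 0 (τ₁ * t) ω * X 0 (τ₂ * t) ω ∂P) ~[atTop]
        fun t : ℝ≥0 => quenchedCorr σ ρ (τ₁ * t) (τ₂ * t)) := by
  obtain ⟨q, hroot, hq, hexp⟩ := hy.exists_isTracerExpansion hσ hρ hW hX
  have hcov := hexp.tendsto_covariance hρ h1 h2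
    (hy.tendsto_covariance_count hσ hρ hW hq h1 h1) (hy.tendsto_covariance_count hσ hρ hW hq h2 h2)
    (hy.tendsto_covariance_count hσ hρ hW hq h1 h2)
  have hpos := quenchedCorr_pos hσ hρ h1 h2
  simp only [quenchedCorr_mul]
  refine ⟨isEquivalent_of_tendsto_div_sqrt hpos hcov, fun hyj =>
    isEquivalent_of_tendsto_div_sqrt hpos (hexp.tendsto_integral_mul h1 h2 (B := 1 / ρ) ?_ hcov)⟩
  filter_upwards [hroot] with t ht
  have hN : ∫ ω, freeCrossing σ y W t (q t) ω ∂P = 0 := by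
    rw [← ht, ← hW.integral_sub_displacement (hy.isNice hρ).monotone_crossing.measurable]
    exact (hW.isNoisePair t t).integral_crossing (hy.isNice hρ) _
  -- For equal spacing the profile error is at most 1 with no linear part, so at the root of the
  -- mean ρ|q| ≤ 1, which is the required B = 1/ρ.
  have hb := (hy.isSublinearlyClose hρ).abs_gaussMean_sub_le_integral (ε := 0) (C := 1) le_rfl
    (fun v => by simpa using abs_crossing_equispaced_sub_le hρ hyj v) (displacementVar σ t) (q t)
  rw [ht, zero_sub, abs_neg, abs_mul, abs_of_pos hρ, zero_mul, zero_add] at hb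
  rw [hN, zero_div, sub_zero, le_div_iff₀ hρ, mul_comm]
  exact hb

end SingleFile

namespace SingleFile

/-! ### Moments of the Poisson distribution -/

lemma hasSum_exp_poisson (r : ℝ≥0) (l : ℝ) :
    HasSum (fun n : ℕ => Real.exp (-r) * (r : ℝ) ^ n / n.factorial * Real.exp (l * n))
      (Real.exp (r * (Real.exp l - 1))) := by
  have h := (NormedSpace.expSeries_div_hasSum_exp ((r : ℝ) * Real.exp l)).mul_left
    (Real.exp (-r))
  rw [← Real.exp_eq_exp_ℝ, ← Real.exp_add,
    show -(r : ℝ) + r * Real.exp l = r * (Real.exp l - 1) by ring] at h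
  refine h.congr_fun fun n => ?_
  rw [mul_pow, ← Real.exp_nat_mul, mul_comm l]
  ring

lemma integrable_exp_poisson (r : ℝ≥0) (l : ℝ) :
    Integrable (fun n : ℕ => Real.exp (l * n)) (poissonMeasure r) := by
  rw [integrable_poissonMeasure_iff]
  simpa using (hasSum_exp_poisson r l).summable

lemma mgf_poisson (r : ℝ≥0) :
    mgf (fun n : ℕ => (n : ℝ)) (poissonMeasure r) =
      fun l => Real.exp (r * (Real.exp l - 1)) := by
  ext l
  rw [mgf, integral_poissonMeasure]
  exact (hasSum_exp_poisson r l).tsum_eq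

lemma zero_mem_interior_integrableExpSet_poisson (r : ℝ≥0) :
    (0 : ℝ) ∈ interior (integrableExpSet (fun n : ℕ => (n : ℝ)) (poissonMeasure r)) := by
  have : integrableExpSet (fun n : ℕ => (n : ℝ)) (poissonMeasure r) = Set.univ :=
    Set.eq_univ_of_forall fun l => integrable_exp_poisson r l
  simp [this]

lemma cgf_poisson (r : ℝ≥0) :
    cgf (fun n : ℕ => (n : ℝ)) (poissonMeasure r) = fun l => r * (Real.exp l - 1) := by
  ext l
  rw [cgf, mgf_poisson, Real.log_exp]

lemma deriv_cgf_poisson (r : ℝ≥0) :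
    deriv (cgf (fun n : ℕ => (n : ℝ)) (poissonMeasure r)) = fun l => r * Real.exp l := by
  ext l
  rw [cgf_poisson]
  exact (((Real.hasDerivAt_exp l).sub_const 1).const_mul (r : ℝ)).deriv

lemma integral_poisson (r : ℝ≥0) : ∫ n : ℕ, (n : ℝ) ∂(poissonMeasure r) = r := by
  have h := deriv_cgf_zero (zero_mem_interior_integrableExpSet_poisson r)
  rw [deriv_cgf_poisson] at h
  simpa using h.symm

lemma integral_sq_poisson_sub (r : ℝ≥0) :
    ∫ n : ℕ, ((n : ℝ) - r) ^ 2 ∂(poissonMeasure r) = r := by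
  have h := iteratedDeriv_two_cgf_eq_integral (zero_mem_interior_integrableExpSet_poisson r)
  rw [deriv_cgf_poisson, iteratedDeriv_succ, iteratedDeriv_one, deriv_cgf_poisson] at h
  have h1 : deriv (fun l : ℝ => (r : ℝ) * Real.exp l) 0 = r := by
    rw [((Real.hasDerivAt_exp 0).const_mul (r : ℝ)).deriv]; simp
  rw [h1, mgf_poisson] at h
  simpa using h.symm

/-- The centred logarithmic moment generating function r(exp l - 1 - l) is at most r l² for |l| ≤ 1,
which is the input of the sixth moment bound. -/
lemma lintegral_poisson_sub_pow_six_le (r : ℝ≥0) :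
    ∫⁻ n : ℕ, ENNReal.ofReal (((n : ℝ) - r) ^ 6) ∂(poissonMeasure r) ≤
      ENNReal.ofReal (4320 * (1 + r) ^ 3) := by
  refine lintegral_pow_six_le (by fun_prop) r.coe_nonneg fun l hl => ?_
  have h1 : ∀ n : ℕ, Real.exp (l * ((n : ℝ) - r)) = Real.exp (-(l * r)) * Real.exp (l * n) := by
    intro n
    rw [← Real.exp_add]
    ring_nf
  simp only [h1]
  rw [← ofReal_integral_eq_lintegral_ofReal ((integrable_exp_poisson r l).const_mul _)
    (ae_of_all _ fun _ => by positivity), integral_const_mul]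
  refine ENNReal.ofReal_le_ofReal ?_
  have h2 := congrFun (mgf_poisson r) l
  rw [mgf] at h2
  rw [h2, ← Real.exp_add, Real.exp_le_exp]
  have h3 := (abs_le.1 (Real.abs_exp_sub_one_sub_id_le hl)).2
  nlinarith [mul_le_mul_of_nonneg_left h3 r.coe_nonneg]

/-! ### Counts and the crossing function -/

/-- The correction is the tracer: `countIn` omits label 0, which sits at the origin and lies in (a,
b] exactly when the two indicators differ. -/
lemma IsNice.crossing_sub {y : ℤ → ℝ} (hy : IsNice y) {a b : ℝ} (hab : a ≤ b) :
    crossing y b - crossing y a = (countIn y (Set.Ioc a b)).toNat +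
      ((if 0 ≤ b then 1 else 0) - if 0 ≤ a then 1 else 0) := by
  obtain ⟨ka, hka⟩ := hy.exists_rank a
  obtain ⟨kb, hkb⟩ := hy.exists_rank b
  have h0a : 0 ≤ a ↔ 0 < ka := by rw [← hka, hy.zero]
  have h0b : 0 ≤ b ↔ 0 < kb := by rw [← hkb, hy.zero]
  have hle : ka ≤ kb := by
    by_contra! h
    have h1 := (hka kb).2 h
    exact lt_irrefl _ ((hkb kb).1 (h1.trans hab))
  have hset : {j : ℤ | j ≠ 0 ∧ y j ∈ Set.Ioc a b} = ((Finset.Ico ka kb).erase 0 : Finset ℤ) := by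
    ext j
    simp only [Set.mem_ofPred_eq, Set.mem_Ioc, Finset.coe_erase, Finset.coe_Ico, Set.mem_sdiff,
      Set.mem_Ico, Set.mem_singleton_iff, ← hkb, ← not_lt, ← hka]
    simp only [← not_le]
    tauto
  rw [crossing_eq_of_rank hka, crossing_eq_of_rank hkb, countIn, hset, Set.encard_coe_eq_coe_finsetCard,
    ENat.toNat_natCast]
  have hcard : ((Finset.Ico ka kb).card : ℤ) = kb - ka := by
    rw [Int.card_Ico, Int.toNat_of_nonneg (by omega)]
  have hcard' : ((Finset.Ico ka kb).card : ℝ) = kb - ka := by exact_mod_cast hcard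
  by_cases ha : 0 < ka
  · rw [if_pos (h0b.2 (ha.trans_le hle)), if_pos (h0a.2 ha), Finset.erase_eq_of_notMem
      (by simp [ha]), hcard']
    ring
  · by_cases hb : 0 < kb
    · rw [if_pos (h0b.2 hb), if_neg (fun h => ha (h0a.1 h))]
      have h1 := Finset.card_erase_add_one (s := Finset.Ico ka kb) (a := 0)
        (by simp; omega)
      have h2 : ((((Finset.Ico ka kb).erase 0).card : ℝ)) + 1 = kb - ka := by
        rw [← hcard']; exact_mod_cast h1
      linarith
    · rw [if_neg (fun h => hb (h0b.1 h)), if_neg (fun h => ha (h0a.1 h)),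
        Finset.erase_eq_of_notMem (by simp; omega), hcard']
      ring

lemma IsNice.crossing_zero {y : ℤ → ℝ} (hy : IsNice y) (h : countIn y {0} = 0) :
    crossing y 0 = 1 := by
  have h1 : ∀ j, y j ≤ 0 ↔ j < 1 := by
    intro j
    refine ⟨fun hj => ?_, fun hj => hy.nonpos (by omega)⟩
    by_contra! hj1
    have h2 : y j = 0 := le_antisymm hj (hy.nonneg (by omega))
    rw [countIn, Set.encard_eq_zero] at h
    have : j ∈ {j : ℤ | j ≠ 0 ∧ y j ∈ ({0} : Set ℝ)} := ⟨by omega, h2⟩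
    rw [h] at this
    exact this
  rw [crossing_eq_of_rank h1]
  simp

lemma card_le_toNat_countIn {y : ℤ → ℝ} {A : Set ℝ} (hA : countIn y A ≠ ⊤) (s : Finset ℤ)
    (hs : ∀ j ∈ s, j ≠ 0 ∧ y j ∈ A) : s.card ≤ (countIn y A).toNat := by
  have h1 : (s : Set ℤ).encard ≤ countIn y A := Set.encard_le_encard fun j hj => hs j hj
  rw [Set.encard_coe_eq_coe_finsetCard] at h1
  exact (ENat.toNat_le_toNat h1 hA)

/-- By monotonicity the particles with labels between 0 and j, the tracer aside, lie within distance
|y j| of the origin, so |j| is at most a count over a symmetric interval. -/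
lemma isNice_of_countIn_le {y : ℤ → ℝ} (hm : Monotone y) (h0 : y 0 = 0) {C : ℝ}
    (hfin : ∀ k : ℕ, countIn y (Set.Icc (-k) k) ≠ ⊤)
    (hC : ∀ k : ℕ, ((countIn y (Set.Icc (-k) k)).toNat : ℝ) ≤ C * (1 + k)) : IsNice y := by
  have hC0 : 0 ≤ C := by
    have := hC 0
    simp only [CharP.cast_eq_zero, add_zero, mul_one] at this
    exact (Nat.cast_nonneg _).trans this
  refine ⟨hm, h0, 2 * C + 1, by positivity, fun j => ?_⟩
  have key : ∀ s : Finset ℤ, (∀ i ∈ s, i ≠ 0 ∧ |y i| ≤ |y j|) → (s.card : ℝ) ≤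
      (2 * C + 1) * (1 + |y j|) := by
    intro s hs
    have h1 := card_le_toNat_countIn (hfin ⌈|y j|⌉₊) s fun i hi =>
      ⟨(hs i hi).1, Set.mem_Icc.2 (abs_le.1 ((hs i hi).2.trans (Nat.le_ceil _)))⟩
    have h2 := hC ⌈|y j|⌉₊
    have h3 := (Nat.ceil_lt_add_one (abs_nonneg (y j))).le
    have h4 : (s.card : ℝ) ≤ ((countIn y (Set.Icc (-(⌈|y j|⌉₊ : ℝ)) ⌈|y j|⌉₊)).toNat : ℝ) := by
      exact_mod_cast h1
    have h5 := mul_le_mul_of_nonneg_left h3 hC0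
    nlinarith [abs_nonneg (y j), mul_nonneg hC0 (abs_nonneg (y j))]
  rcases le_total 0 j with hj | hj
  · have h1 := key (Finset.Ioc 0 j) fun i hi => by
      rw [Finset.mem_Ioc] at hi
      have h2 : 0 ≤ y i := h0 ▸ hm hi.1.le
      have h3 : y i ≤ y j := hm hi.2
      exact ⟨hi.1.ne', by rwa [abs_of_nonneg h2, abs_of_nonneg (h2.trans h3)]⟩
    rw [Int.card_Ioc, sub_zero] at h1
    have h4 : ((j.toNat : ℕ) : ℝ) = j := by exact_mod_cast Int.toNat_of_nonneg hj
    rwa [h4, ← abs_of_nonneg (by exact_mod_cast hj : (0 : ℝ) ≤ j)] at h1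
  · have h1 := key (Finset.Ico j 0) fun i hi => by
      rw [Finset.mem_Ico] at hi
      have h2 : y i ≤ 0 := h0 ▸ hm hi.2.le
      have h3 : y j ≤ y i := hm hi.1
      exact ⟨hi.2.ne, by
        rw [abs_of_nonpos h2, abs_of_nonpos (h3.trans h2)]; linarith⟩
    rw [Int.card_Ico, zero_sub] at h1
    have h4 : (((-j).toNat : ℕ) : ℝ) = -j := by
      exact_mod_cast Int.toNat_of_nonneg (by omega : 0 ≤ -j)
    rwa [h4, ← abs_of_nonpos (by exact_mod_cast hj : (j : ℝ) ≤ 0)] at h1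

end SingleFile

namespace SingleFile

/-! ### The annealed initial state -/

/-- Deviation of the crossing function from its mean in the annealed initial state. -/
noncomputable def fluctuation (ρ : ℝ) (y : ℤ → ℝ) (v : ℝ) : ℝ :=
  crossing y v - ρ * v - if 0 ≤ v then 1 else 0

lemma measurable_fluctuation (ρ : ℝ) :
    Measurable fun p : (ℤ → ℝ) × ℝ => fluctuation ρ p.1 p.2 := by
  unfold fluctuation
  exact (measurable_crossing.sub (measurable_snd.const_mul ρ)).sub
    (Measurable.ite (measurableSet_le measurable_const measurable_snd) measurable_const
      measurable_const)

namespace IsAnnealedInitial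

variable {Ω : Type*} [MeasurableSpace Ω] {P : Measure Ω} {ρ : ℝ} {y : Ω → ℤ → ℝ}

lemma hasLaw_count (h : IsAnnealedInitial ρ y P) {A : Set ℝ} (hA : MeasurableSet A)
    (hvol : volume A ≠ ∞) :
    HasLaw (fun ω => (countIn (y ω) A).toNat)
      (poissonMeasure (ρ * volume.real A).toNNReal) P := by
  have h1 : HasLaw ENat.toNat (poissonMeasure (ρ * volume.real A).toNNReal)
      ((poissonMeasure (ρ * volume.real A).toNNReal).map (fun n : ℕ => (n : ℕ∞))) := by
    refine ⟨Measurable.of_discrete.aemeasurable, ?_⟩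
    rw [Measure.map_map .of_discrete .of_discrete]
    simp [Function.comp_def]
  exact h1.comp (h.poisson A hA hvol)

lemma ae_countIn_ne_top (h : IsAnnealedInitial ρ y P) {A : Set ℝ} (hA : MeasurableSet A)
    (hvol : volume A ≠ ∞) : ∀ᵐ ω ∂P, countIn (y ω) A ≠ ⊤ := by
  rw [(h.poisson A hA hvol).ae_iff (p := fun n => n ≠ ⊤) .of_discrete,
    ae_map_iff (by fun_prop) (by measurability)]
  simp

lemma ae_countIn_singleton (h : IsAnnealedInitial ρ y P) :
    ∀ᵐ ω ∂P, countIn (y ω) {0} = 0 := by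
  have h1 : ∀ᵐ n : ℕ ∂(poissonMeasure 0), n = 0 := by
    have h2 := integral_poisson 0
    rw [NNReal.coe_zero, integral_eq_zero_iff_of_nonneg (fun n => Nat.cast_nonneg n)
      (integrable_of_mem_interior_integrableExpSet
        (zero_mem_interior_integrableExpSet_poisson 0))] at h2
    filter_upwards [h2] with n hn
    have hn' : (n : ℝ) = 0 := hn
    exact_mod_cast hn'
  have h3 := h.hasLaw_count (A := {0}) (by simp) (by simp)
  have hr : (ρ * volume.real ({0} : Set ℝ)).toNNReal = 0 := by simp [Measure.real]
  rw [hr] at h3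
  filter_upwards [(h3.ae_iff (p := fun n => n = 0) .of_discrete).2 h1,
    h.ae_countIn_ne_top (A := {0}) (by simp) (by simp)] with ω h4 h5
  exact ((ENat.toNat_eq_zero).1 h4).resolve_right h5

/-- The normalised count deviations on [-k, k] have sixth moments of order k^{-3}. Their sum over k
is integrable, hence almost surely finite, which bounds all counts by a random multiple of 1+k. -/
lemma ae_isNice (h : IsAnnealedInitial ρ y P) (hρ : 0 < ρ) : ∀ᵐ ω ∂P, IsNice (y ω) := by
  have hvol : ∀ k : ℕ, volume (Set.Icc (-(k : ℝ)) k) ≠ ∞ := fun k => by simp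
  have hr : ∀ k : ℕ, (((ρ * volume.real (Set.Icc (-(k : ℝ)) k)).toNNReal : ℝ≥0) : ℝ) =
      2 * ρ * k := by
    intro k
    rw [Real.coe_toNNReal _ (mul_nonneg hρ.le measureReal_nonneg),
      Real.volume_real_Icc_of_le (by linarith [(Nat.cast_nonneg k : (0 : ℝ) ≤ k)])]
    ring
  set Z : ℕ → Ω → ℝ := fun k ω =>
    (((countIn (y ω) (Set.Icc (-(k : ℝ)) k)).toNat : ℝ) - 2 * ρ * k) / (1 + k) with hZ
  have hmeas : ∀ k, AEMeasurable (fun ω => ENNReal.ofReal (Z k ω ^ 6)) P := by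
    intro k
    have h1 := (h.hasLaw_count measurableSet_Icc (hvol k)).aemeasurable
    have h2 : AEMeasurable
        (fun ω => ((countIn (y ω) (Set.Icc (-(k : ℝ)) k)).toNat : ℝ)) P :=
      (Measurable.of_discrete (f := fun n : ℕ => (n : ℝ))).comp_aemeasurable h1
    exact (((h2.sub_const _).div_const _).pow_const 6).ennreal_ofReal
  have hbound : ∀ k, ∫⁻ ω, ENNReal.ofReal (Z k ω ^ 6) ∂P ≤
      ENNReal.ofReal (4320 * (1 + 2 * ρ) ^ 3 * (1 / ((k : ℝ) + 1) ^ 3)) := by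
    intro k
    have h1 := (h.hasLaw_count measurableSet_Icc (hvol k)).lintegral_comp
      (f := fun n : ℕ => ENNReal.ofReal ((((n : ℝ) - 2 * ρ * k) / (1 + k)) ^ 6)) (by fun_prop)
    have h2 := lintegral_poisson_sub_pow_six_le
      (ρ * volume.real (Set.Icc (-(k : ℝ)) k)).toNNReal
    rw [hr] at h2
    refine (le_of_eq h1).trans ?_
    have h3 : ∀ n : ℕ, ENNReal.ofReal ((((n : ℝ) - 2 * ρ * k) / (1 + k)) ^ 6) =
        ENNReal.ofReal (1 / (1 + k) ^ 6) * ENNReal.ofReal (((n : ℝ) - 2 * ρ * k) ^ 6) := by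
      intro n
      rw [← ENNReal.ofReal_mul (by positivity), div_pow]
      ring_nf
    simp only [h3]
    rw [lintegral_const_mul _ (by fun_prop)]
    refine (mul_le_mul_right h2 _).trans ?_
    rw [← ENNReal.ofReal_mul (by positivity)]
    refine ENNReal.ofReal_le_ofReal ?_
    have hk : (0 : ℝ) ≤ k := Nat.cast_nonneg k
    have h4 : (1 + 2 * ρ * k) ^ 3 ≤ ((1 + 2 * ρ) * (1 + k)) ^ 3 := by
      gcongr
      nlinarith
    calc 1 / (1 + (k : ℝ)) ^ 6 * (4320 * (1 + 2 * ρ * k) ^ 3)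
        ≤ 1 / (1 + (k : ℝ)) ^ 6 * (4320 * ((1 + 2 * ρ) * (1 + k)) ^ 3) := by gcongr
      _ = _ := by rw [add_comm (k : ℝ) 1]; field_simp
  have hsum : ∫⁻ ω, ∑' k, ENNReal.ofReal (Z k ω ^ 6) ∂P ≠ ∞ := by
    rw [lintegral_tsum hmeas]
    have hs : Summable fun k : ℕ => 4320 * (1 + 2 * ρ) ^ 3 * (1 / ((k : ℝ) + 1) ^ 3) := by
      refine Summable.mul_left _ ?_
      exact_mod_cast (summable_nat_add_iff (f := fun k : ℕ => 1 / (k : ℝ) ^ 3) 1).2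
        (Real.summable_one_div_nat_pow.2 (by norm_num))
    refine ne_top_of_le_ne_top ?_ (ENNReal.tsum_le_tsum hbound)
    rw [← ENNReal.ofReal_tsum_of_nonneg (fun k => by positivity) hs]
    exact ENNReal.ofReal_ne_top
  have hae := ae_lt_top' (AEMeasurable.tsum hmeas) hsum
  filter_upwards [hae, h.origin, h.ordered,
    ae_all_iff.2 fun k : ℕ => h.ae_countIn_ne_top measurableSet_Icc (hvol k)] with ω h1 h2 h3 h4
  set S := (∑' k, ENNReal.ofReal (Z k ω ^ 6)).toReal with hS
  refine isNice_of_countIn_le h3 h2 (C := 1 + S + 2 * ρ) h4 fun k => ?_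
  have h5 : Z k ω ^ 6 ≤ S := by
    rw [← ENNReal.ofReal_le_iff_le_toReal h1.ne]
    exact ENNReal.le_tsum k
  have hk : (0 : ℝ) ≤ k := Nat.cast_nonneg k
  have h6 : Z k ω ≤ 1 + S := by
    by_contra! hlt
    have hS0 : 0 ≤ S := ENNReal.toReal_nonneg
    have h7 : 1 ≤ Z k ω := by linarith
    have := le_self_pow₀ h7 (by norm_num : (6 : ℕ) ≠ 0)
    linarith
  simp only [hZ] at h6
  rw [div_le_iff₀ (by positivity)] at h6
  nlinarith

lemma ae_fluctuation_sub (h : IsAnnealedInitial ρ y P) (hρ : 0 < ρ) {a b : ℝ} (hab : a ≤ b) :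
    ∀ᵐ ω ∂P, fluctuation ρ (y ω) b - fluctuation ρ (y ω) a =
      (countIn (y ω) (Set.Ioc a b)).toNat - ρ * (b - a) := by
  filter_upwards [h.ae_isNice hρ] with ω hω
  have := hω.crossing_sub hab
  unfold fluctuation
  linarith

lemma ae_fluctuation_zero (h : IsAnnealedInitial ρ y P) (hρ : 0 < ρ) :
    ∀ᵐ ω ∂P, fluctuation ρ (y ω) 0 = 0 := by
  filter_upwards [h.ae_isNice hρ, h.ae_countIn_singleton] with ω h1 h2
  simp [fluctuation, h1.crossing_zero h2]

lemma hasLaw_fluctuation_sub (h : IsAnnealedInitial ρ y P) (hρ : 0 < ρ) {a b : ℝ} (hab : a ≤ b) :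
    HasLaw (fun ω => fluctuation ρ (y ω) b - fluctuation ρ (y ω) a)
      ((poissonMeasure (ρ * (b - a)).toNNReal).map fun n : ℕ => (n : ℝ) - ρ * (b - a)) P := by
  have h1 := h.hasLaw_count (A := Set.Ioc a b) measurableSet_Ioc (by simp)
  rw [Real.volume_real_Ioc_of_le hab] at h1
  have h2 : HasLaw (fun n : ℕ => (n : ℝ) - ρ * (b - a))
      ((poissonMeasure (ρ * (b - a)).toNNReal).map fun n : ℕ => (n : ℝ) - ρ * (b - a))
      (poissonMeasure (ρ * (b - a)).toNNReal) := ⟨Measurable.of_discrete.aemeasurable, rfl⟩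
  exact (h2.comp h1).congr (h.ae_fluctuation_sub hρ hab)

lemma integral_fluctuation_sub_comp (h : IsAnnealedInitial ρ y P) (hρ : 0 < ρ) {a b : ℝ}
    (hab : a ≤ b) {f : ℝ → ℝ} (hf : Measurable f) :
    ∫ ω, f (fluctuation ρ (y ω) b - fluctuation ρ (y ω) a) ∂P =
      ∫ n : ℕ, f ((n : ℝ) - (ρ * (b - a)).toNNReal) ∂(poissonMeasure (ρ * (b - a)).toNNReal) := by
  have h1 := (h.hasLaw_fluctuation_sub hρ hab).integral_comp hf.aestronglyMeasurable
  rw [integral_map Measurable.of_discrete.aemeasurable hf.aestronglyMeasurable] at h1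
  rw [Real.coe_toNNReal _ (mul_nonneg hρ.le (by linarith))]
  exact h1

lemma integral_fluctuation_sub (h : IsAnnealedInitial ρ y P) (hρ : 0 < ρ) {a b : ℝ}
    (hab : a ≤ b) : ∫ ω, (fluctuation ρ (y ω) b - fluctuation ρ (y ω) a) ∂P = 0 := by
  have h1 := h.integral_fluctuation_sub_comp hρ hab measurable_id
  simp only [id] at h1
  rw [h1]
  have hi : Integrable (fun n : ℕ => (n : ℝ)) (poissonMeasure (ρ * (b - a)).toNNReal) :=
    integrable_of_mem_interior_integrableExpSet
      (zero_mem_interior_integrableExpSet_poisson _)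
  rw [integral_sub hi (integrable_const _), integral_poisson]
  simp

lemma integral_fluctuation_sub_sq (h : IsAnnealedInitial ρ y P) (hρ : 0 < ρ) (a b : ℝ) :
    ∫ ω, (fluctuation ρ (y ω) b - fluctuation ρ (y ω) a) ^ 2 ∂P = ρ * |b - a| := by
  wlog hab : a ≤ b generalizing a b
  · rw [abs_sub_comm, ← this b a (not_le.1 hab).le]
    congr 1 with ω
    ring
  rw [h.integral_fluctuation_sub_comp hρ hab (f := fun x => x ^ 2) (by fun_prop),
    integral_sq_poisson_sub, Real.coe_toNNReal _ (mul_nonneg hρ.le (by linarith)),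
    abs_of_nonneg (by linarith)]

lemma lintegral_fluctuation_sub_pow_six_le (h : IsAnnealedInitial ρ y P) (hρ : 0 < ρ) (a b : ℝ) :
    ∫⁻ ω, ENNReal.ofReal ((fluctuation ρ (y ω) b - fluctuation ρ (y ω) a) ^ 6) ∂P ≤
      ENNReal.ofReal (4320 * (1 + ρ * |b - a|) ^ 3) := by
  wlog hab : a ≤ b generalizing a b
  · rw [abs_sub_comm]
    refine (le_of_eq ?_).trans (this b a (not_le.1 hab).le)
    congr 1 with ω
    ring_nf
  have h1 := (h.hasLaw_fluctuation_sub hρ hab).lintegral_comp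
    (f := fun x => ENNReal.ofReal (x ^ 6)) (by fun_prop)
  rw [lintegral_map (by fun_prop) .of_discrete] at h1
  have h2 := lintegral_poisson_sub_pow_six_le (ρ * (b - a)).toNNReal
  rw [Real.coe_toNNReal _ (mul_nonneg hρ.le (by linarith))] at h2
  rw [abs_of_nonneg (by linarith)]
  exact (le_of_eq h1).trans h2

lemma integral_fluctuation (h : IsAnnealedInitial ρ y P) (hρ : 0 < ρ) (a : ℝ) :
    ∫ ω, fluctuation ρ (y ω) a ∂P = 0 := by
  rcases le_total 0 a with ha | ha
  · rw [← h.integral_fluctuation_sub hρ ha]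
    refine integral_congr_ae ?_
    filter_upwards [h.ae_fluctuation_zero hρ] with ω hω
    rw [hω, sub_zero]
  · rw [← neg_zero, ← h.integral_fluctuation_sub hρ ha, ← integral_neg]
    refine integral_congr_ae ?_
    filter_upwards [h.ae_fluctuation_zero hρ] with ω hω
    rw [hω, zero_sub, neg_neg]

lemma lintegral_fluctuation_pow_six_le (h : IsAnnealedInitial ρ y P) (hρ : 0 < ρ) (a : ℝ) :
    ∫⁻ ω, ENNReal.ofReal (fluctuation ρ (y ω) a ^ 6) ∂P ≤
      ENNReal.ofReal (4320 * (1 + ρ * |a|) ^ 3) := by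
  have h1 := h.lintegral_fluctuation_sub_pow_six_le hρ 0 a
  rw [sub_zero] at h1
  refine (le_of_eq (lintegral_congr_ae ?_)).trans h1
  filter_upwards [h.ae_fluctuation_zero hρ] with ω hω
  rw [hω, sub_zero]

lemma integral_fluctuation_sq (h : IsAnnealedInitial ρ y P) (hρ : 0 < ρ) (a : ℝ) :
    ∫ ω, fluctuation ρ (y ω) a ^ 2 ∂P = ρ * |a| := by
  have h1 := h.integral_fluctuation_sub_sq hρ 0 a
  rw [sub_zero] at h1
  rw [← h1]
  refine integral_congr_ae ?_
  filter_upwards [h.ae_fluctuation_zero hρ] with ω hω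
  rw [hω, sub_zero]

variable [IsProbabilityMeasure P]

lemma memLp_fluctuation (h : IsAnnealedInitial ρ y P) (hρ : 0 < ρ) (a : ℝ) :
    MemLp (fun ω => fluctuation ρ (y ω) a) 2 P :=
  memLp_two_of_lintegral_pow_six
    ((measurable_fluctuation ρ).comp (h.measurable.prodMk measurable_const)).aemeasurable
    (ne_top_of_le_ne_top ENNReal.ofReal_ne_top (h.lintegral_fluctuation_pow_six_le hρ a))

/-- Polarisation of the variance formulas: a fluctuation at level a has variance ρ|a| and an
increment has variance ρ|a-b|. -/
lemma integral_fluctuation_mul (h : IsAnnealedInitial ρ y P) (hρ : 0 < ρ) (a b : ℝ) :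
    ∫ ω, fluctuation ρ (y ω) a * fluctuation ρ (y ω) b ∂P =
      ρ / 2 * (|a| + |b| - |a - b|) := by
  have ia := (h.memLp_fluctuation hρ a).integrable_sq
  have ib := (h.memLp_fluctuation hρ b).integrable_sq
  have iab : Integrable (fun ω => (fluctuation ρ (y ω) a - fluctuation ρ (y ω) b) ^ 2) P :=
    ((h.memLp_fluctuation hρ a).sub (h.memLp_fluctuation hρ b)).integrable_sq
  have isum : Integrable (fun ω => fluctuation ρ (y ω) a ^ 2 + fluctuation ρ (y ω) b ^ 2) P :=
    ia.add ib
  have h1 : ∀ ω, fluctuation ρ (y ω) a * fluctuation ρ (y ω) b =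
      1 / 2 * (fluctuation ρ (y ω) a ^ 2 + fluctuation ρ (y ω) b ^ 2 -
        (fluctuation ρ (y ω) a - fluctuation ρ (y ω) b) ^ 2) := fun ω => by ring
  simp only [h1]
  rw [integral_const_mul, integral_sub isum iab, integral_add ia ib, h.integral_fluctuation_sq hρ,
    h.integral_fluctuation_sq hρ, h.integral_fluctuation_sub_sq hρ]
  ring

end IsAnnealedInitial

end SingleFile

namespace SingleFile

/-! ### Conditioning on the initial state -/

lemma pow_integral_le {α : Type*} [MeasurableSpace α] {μ : Measure α} [IsProbabilityMeasure μ]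
    {f : α → ℝ} (n : ℕ) (h0 : ∀ x, 0 ≤ f x) (h1 : Integrable f μ)
    (hn : Integrable (fun x => f x ^ n) μ) : (∫ x, f x ∂μ) ^ n ≤ ∫ x, f x ^ n ∂μ :=
  (convexOn_pow n).map_integral_le (continuous_pow n).continuousOn isClosed_Ici
    (ae_of_all _ h0) h1 hn

lemma integral_abs_pow_three_gaussian (v : ℝ≥0) :
    ∫ x, |x| ^ 3 ∂(gaussianReal 0 v) = √(v : ℝ) ^ 3 * ∫ x, |x| ^ 3 ∂(gaussianReal 0 1) := by
  have h := gaussianReal_map_const_mul (μ := 0) (v := 1) (√(v : ℝ))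
  have hv : NNReal.mk (√(v : ℝ) ^ 2) (sq_nonneg _) * 1 = v := by
    ext; simp
  rw [mul_zero, hv] at h
  rw [← h, integral_map (by fun_prop) (by fun_prop), ← integral_const_mul]
  simp only [abs_mul, abs_of_nonneg (Real.sqrt_nonneg _), mul_pow]

lemma integrable_abs_pow_three_gaussian (v : ℝ≥0) :
    Integrable (fun x : ℝ => |x| ^ 3) (gaussianReal 0 v) := by
  have h : MemLp (id : ℝ → ℝ) 3 (gaussianReal 0 v) := memLp_id_gaussianReal 3
  exact h.integrable_norm_pow (by norm_num)

variable {Ω : Type*} [MeasurableSpace Ω] {P : Measure Ω} [IsProbabilityMeasure P]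
  {σ ρ : ℝ} {y : ℤ → ℝ} {W : ℤ → ℝ≥0 → Ω → ℝ}

lemma measurable_fluctuation_comp (ρ : ℝ) (y : ℤ → ℝ) {U : Ω → ℝ} (hU : Measurable U) :
    Measurable fun ω => fluctuation ρ y (U ω) :=
  (measurable_fluctuation ρ).comp (measurable_const.prodMk hU)

lemma abs_crossing_sub_fluctuation_sub_le (ρ : ℝ) (y : ℤ → ℝ) (v : ℝ) :
    |crossing y v - fluctuation ρ y v - ρ * v| ≤ 1 := by
  unfold fluctuation
  split_ifs <;> · ring_nf; norm_num

/-- The centre is the annealed profile ρa instead of the mean for the given configuration. Jensen's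
inequality moves the powers inside the average over the displacement, so the configuration enters
only through its fluctuation at one level, a form that can be averaged over the Poisson process. -/
lemma IsNice.lintegral_freeCrossing_sub_pow_six_le (hy : IsNice y) (hW : IsBrownianFamily W P)
    (hρ : 0 < ρ) (t : ℝ≥0) (a : ℝ) :
    ∫⁻ ω, ENNReal.ofReal ((freeCrossing σ y W t a ω - ρ * a) ^ 6) ∂P ≤
      ENNReal.ofReal 20000000 * ∫⁻ ω, ENNReal.ofReal
        (1 + fluctuation ρ y (a - displacement σ W t 0 ω) ^ 6 +
          (ρ * |a - displacement σ W t 0 ω|) ^ 3) ∂P := by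
  set U : Ω → ℝ := fun ω => a - displacement σ W t 0 ω with hU
  have mU : Measurable U := (hW.measurable_displacement t 0).const_sub a
  have iU : Integrable U P := (integrable_const a).sub (hW.integrable_displacement t 0)
  have eU : ∫ ω, U ω ∂P = a := by
    rw [hU, integral_sub (integrable_const a) (hW.integrable_displacement t 0),
      hW.integral_displacement]
    simp
  set F : Ω → ℝ := fun ω => |fluctuation ρ y (U ω)| with hF
  have mF : Measurable F := (measurable_fluctuation_comp ρ y mU).abs
  set G : Ω → ℝ := fun ω => 1 + fluctuation ρ y (U ω) ^ 6 + (ρ * |U ω|) ^ 3 with hG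
  have mG : Measurable G := by
    exact (((measurable_fluctuation_comp ρ y mU).pow_const 6).const_add 1).add
      ((mU.abs.const_mul ρ).pow_const 3)
  have hG0 : ∀ ω, 0 ≤ G ω := fun ω => by simp only [hG]; positivity
  have hF6 : ∀ ω, F ω ^ 6 = fluctuation ρ y (U ω) ^ 6 := fun ω =>
    Even.pow_abs (by decide : Even 6) _
  have hF0 : ∀ ω, 0 ≤ F ω := fun ω => abs_nonneg _
  have hF3 : ∀ x : ℝ, 0 ≤ x → x ^ 3 ≤ 1 + x ^ 6 := fun x hx => by nlinarith [sq_nonneg (x ^ 3 - 1)]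
  have hF1 : ∀ x : ℝ, 0 ≤ x → x ≤ 1 + x ^ 6 := fun x hx => by
    rcases le_total x 1 with h | h
    · linarith [pow_nonneg hx 6]
    · linarith [le_self_pow₀ h (by norm_num : (6 : ℕ) ≠ 0)]
  by_cases hfin : ∫⁻ ω, ENNReal.ofReal (G ω) ∂P = ∞
  -- If the right side is infinite nothing is to be proved; otherwise its finiteness supplies all
  -- integrability below.
  · simp only [hG] at hfin
    rw [hfin, ENNReal.mul_top (by simp)]
    exact le_top
  have iG : Integrable G P := by
    refine ⟨mG.aestronglyMeasurable, ?_⟩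
    rw [hasFiniteIntegral_iff_ofReal (ae_of_all _ hG0)]
    exact lt_top_iff_ne_top.2 hfin
  have hFG : ∀ ω, F ω ≤ G ω := fun ω => by
    have h1 := hF1 _ (hF0 ω)
    rw [hF6] at h1
    have : 0 ≤ (ρ * |U ω|) ^ 3 := by positivity
    simp only [hG]
    linarith
  have iF : Integrable F P := iG.mono' mF.aestronglyMeasurable (ae_of_all _ fun ω => by
    rw [Real.norm_eq_abs, abs_of_nonneg (hF0 ω)]; exact hFG ω)
  have iA : Integrable (fun ω => 2 + F ω + ρ * |U ω|) P :=
    ((integrable_const 2).add iF).add (iU.abs.const_mul ρ)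
  have hA3 : ∀ ω, (2 + F ω + ρ * |U ω|) ^ 3 ≤ 144 * G ω := fun ω => by
    have hz : 0 ≤ ρ * |U ω| := by positivity
    have hf := hF0 ω
    have h1 := hF3 _ hf
    rw [hF6] at h1
    have h2 := add_pow_le (by positivity : 0 ≤ 2 + F ω) hz 3
    have h3 := add_pow_le (zero_le_two (α := ℝ)) hf 3
    norm_num at h2 h3
    simp only [hG]
    have : 0 ≤ fluctuation ρ y (U ω) ^ 6 := by positivity
    have : 0 ≤ (ρ * |U ω|) ^ 3 := by positivity
    linarith
  have iA3 : Integrable (fun ω => (2 + F ω + ρ * |U ω|) ^ 3) P :=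
    (iG.const_mul 144).mono' (((mF.const_add 2).add (mU.abs.const_mul ρ)).pow_const
      3).aestronglyMeasurable (ae_of_all _ fun ω => by
        have hf := hF0 ω
        rw [Real.norm_eq_abs, abs_of_nonneg (by positivity)]
        exact hA3 ω)
  have iB : Integrable (fun ω => 1 + F ω) P := (integrable_const 1).add iF
  have hB6 : ∀ ω, (1 + F ω) ^ 6 ≤ 32 * G ω := fun ω => by
    have h1 := add_pow_le (zero_le_one (α := ℝ)) (hF0 ω) 6
    rw [hF6] at h1
    have : 0 ≤ (ρ * |U ω|) ^ 3 := by positivity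
    simp only [hG]
    norm_num at h1 ⊢
    linarith
  have iB6 : Integrable (fun ω => (1 + F ω) ^ 6) P :=
    (iG.const_mul 32).mono' ((mF.const_add 1).pow_const 6).aestronglyMeasurable
      (ae_of_all _ fun ω => by
        have hf := hF0 ω
        rw [Real.norm_eq_abs, abs_of_nonneg (by positivity)]
        exact hB6 ω)
  have iN : Integrable (fun ω => crossing y (U ω)) P := hy.integrable_crossing mU iU
  have hNle : ∀ ω, |crossing y (U ω) - ρ * U ω| ≤ 1 + F ω := fun ω => by
    have h1 := abs_crossing_sub_fluctuation_sub_le ρ y (U ω)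
    have h2 := abs_add_le (crossing y (U ω) - fluctuation ρ y (U ω) - ρ * U ω)
      (fluctuation ρ y (U ω))
    rw [show crossing y (U ω) - fluctuation ρ y (U ω) - ρ * U ω + fluctuation ρ y (U ω) =
      crossing y (U ω) - ρ * U ω by ring] at h2
    linarith
  set m := ∫ ω, crossing y (U ω) ∂P with hm
  set M := ∫ ω, |crossing y (U ω)| ∂P with hM
  have hM0 : 0 ≤ M := integral_nonneg fun _ => abs_nonneg _
  have hM3 : (1 + M) ^ 3 ≤ 144 * ∫ ω, G ω ∂P := by
    have h1 : 1 + M ≤ ∫ ω, (2 + F ω + ρ * |U ω|) ∂P := by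
      have i1 : Integrable (fun ω => 1 + |crossing y (U ω)|) P := (integrable_const 1).add iN.abs
      have h2 : 1 + M = ∫ ω, (1 + |crossing y (U ω)|) ∂P := by
        rw [integral_add (integrable_const 1) iN.abs]; simp [hM]
      rw [h2]
      refine integral_mono i1 iA fun ω => ?_
      have h3 := abs_add_le (crossing y (U ω) - ρ * U ω) (ρ * U ω)
      rw [sub_add_cancel, abs_mul, abs_of_pos hρ] at h3
      have h4 := hNle ω
      change 1 + |crossing y (U ω)| ≤ 2 + F ω + ρ * |U ω|
      linarith
    calc (1 + M) ^ 3 ≤ (∫ ω, (2 + F ω + ρ * |U ω|) ∂P) ^ 3 := by gcongr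
      _ ≤ ∫ ω, (2 + F ω + ρ * |U ω|) ^ 3 ∂P :=
          pow_integral_le 3 (fun ω => by have := hF0 ω; positivity) iA iA3
      _ ≤ ∫ ω, 144 * G ω ∂P := integral_mono iA3 (iG.const_mul 144) hA3
      _ = _ := integral_const_mul _ _
  have hm6 : (m - ρ * a) ^ 6 ≤ 32 * ∫ ω, G ω ∂P := by
    have h1 : |m - ρ * a| ≤ ∫ ω, (1 + F ω) ∂P := by
      have iρU : Integrable (fun ω => ρ * U ω) P := iU.const_mul ρ
      rw [← eU, ← integral_const_mul, hm, ← integral_sub iN iρU]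
      exact abs_integral_le_integral_abs.trans (integral_mono (iN.sub iρU).abs iB hNle)
    rw [← Even.pow_abs (by decide : Even 6)]
    calc |m - ρ * a| ^ 6 ≤ (∫ ω, (1 + F ω) ∂P) ^ 6 := by gcongr
      _ ≤ ∫ ω, (1 + F ω) ^ 6 ∂P :=
          pow_integral_le 6 (fun ω => by have := hF0 ω; positivity) iB iB6
      _ ≤ ∫ ω, 32 * G ω ∂P := integral_mono iB6 (iG.const_mul 32) hB6
      _ = _ := integral_const_mul _ _
  have hmain : ∫⁻ ω, ENNReal.ofReal ((freeCrossing σ y W t a ω - m) ^ 6) ∂P ≤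
      ENNReal.ofReal (4320 * (1 + M) ^ 3) :=
    (hW.isNoisePair (σ := σ) t t).lintegral_pow_six_le hy a
  have hpt : ∀ ω, ENNReal.ofReal ((freeCrossing σ y W t a ω - ρ * a) ^ 6) ≤
      ENNReal.ofReal 32 * ENNReal.ofReal ((freeCrossing σ y W t a ω - m) ^ 6) +
        ENNReal.ofReal (32 * (m - ρ * a) ^ 6) := by
    intro ω
    rw [← ENNReal.ofReal_mul (by norm_num), ← ENNReal.ofReal_add (by positivity) (by positivity)]
    refine ENNReal.ofReal_le_ofReal ?_
    have h1 := (Even.add_pow_le (a := freeCrossing σ y W t a ω - m) (b := m - ρ * a)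
      (by decide : Even 6))
    rw [sub_add_sub_cancel] at h1
    norm_num at h1
    linarith
  calc _ ≤ ∫⁻ ω, (ENNReal.ofReal 32 * ENNReal.ofReal ((freeCrossing σ y W t a ω - m) ^ 6) +
        ENNReal.ofReal (32 * (m - ρ * a) ^ 6)) ∂P := lintegral_mono hpt
    _ = ENNReal.ofReal 32 * ∫⁻ ω, ENNReal.ofReal ((freeCrossing σ y W t a ω - m) ^ 6) ∂P +
        ENNReal.ofReal (32 * (m - ρ * a) ^ 6) := by
        rw [lintegral_add_right _ measurable_const, lintegral_const_mul' _ _ ENNReal.ofReal_ne_top]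
        simp
    _ ≤ ENNReal.ofReal 32 * ENNReal.ofReal (4320 * (1 + M) ^ 3) +
        ENNReal.ofReal (32 * (m - ρ * a) ^ 6) := by gcongr
    -- The constant exceeds 32 · 4320 · 144 + 32 · 32.
    _ ≤ ENNReal.ofReal 20000000 * ENNReal.ofReal (∫ ω, G ω ∂P) := by
        rw [← ENNReal.ofReal_mul (by norm_num), ← ENNReal.ofReal_mul (by norm_num),
          ← ENNReal.ofReal_add (by positivity) (by positivity)]
        refine ENNReal.ofReal_le_ofReal ?_
        have : 0 ≤ ∫ ω, G ω ∂P := integral_nonneg hG0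
        linarith
    _ = _ := by rw [ofReal_integral_eq_lintegral_ofReal iG (ae_of_all _ hG0)]

lemma IsNice.lintegral_freeCrossing_increment_sq_le (hy : IsNice y) (hW : IsBrownianFamily W P)
    (hρ : 0 < ρ) (t : ℝ≥0) (a b : ℝ) :
    ∫⁻ ω, ENNReal.ofReal ((freeCrossing σ y W t b ω - freeCrossing σ y W t a ω -
      ρ * (b - a)) ^ 2) ∂P ≤ ∫⁻ ω, ENNReal.ofReal
        (5 * (fluctuation ρ y (b - displacement σ W t 0 ω) -
          fluctuation ρ y (a - displacement σ W t 0 ω)) ^ 2 + (7 + 2 * (ρ * |b - a|))) ∂P := by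
  have hξ := hW.measurable_displacement (σ := σ) t 0
  have iξ := hW.integrable_displacement (σ := σ) t 0
  have hmc := hy.monotone_crossing.measurable
  set Ua : Ω → ℝ := fun ω => a - displacement σ W t 0 ω with hUa
  set Ub : Ω → ℝ := fun ω => b - displacement σ W t 0 ω with hUb
  have mUa : Measurable Ua := hξ.const_sub a
  have mUb : Measurable Ub := hξ.const_sub b
  set D : Ω → ℝ := fun ω => fluctuation ρ y (Ub ω) - fluctuation ρ y (Ua ω) with hD
  have mD : Measurable D :=
    (measurable_fluctuation_comp ρ y mUb).sub (measurable_fluctuation_comp ρ y mUa)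
  have hG0 : ∀ ω, 0 ≤ 5 * D ω ^ 2 + (7 + 2 * (ρ * |b - a|)) := fun ω => by positivity
  by_cases hfin : ∫⁻ ω, ENNReal.ofReal (5 * D ω ^ 2 + (7 + 2 * (ρ * |b - a|))) ∂P = ∞
  · simp only [hD] at hfin
    rw [hfin]
    exact le_top
  have iG : Integrable (fun ω => 5 * D ω ^ 2 + (7 + 2 * (ρ * |b - a|))) P := by
    refine ⟨(((mD.pow_const 2).const_mul 5).add_const _).aestronglyMeasurable, ?_⟩
    rw [hasFiniteIntegral_iff_ofReal (ae_of_all _ hG0)]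
    exact lt_top_iff_ne_top.2 hfin
  have iD2 : Integrable (fun ω => D ω ^ 2) P := iG.mono' (mD.pow_const 2).aestronglyMeasurable
    (ae_of_all _ fun ω => by
      rw [Real.norm_eq_abs, abs_of_nonneg (sq_nonneg _)]
      have : 0 ≤ ρ * |b - a| := by positivity
      nlinarith [sq_nonneg (D ω)])
  have LD : MemLp D 2 P := (memLp_two_iff_integrable_sq mD.aestronglyMeasurable).2 iD2
  have iD : Integrable D P := LD.integrable one_le_two
  have h1 := hy.lintegral_increment_sq_le (σ := σ) (ρ := ρ) hW t a b
  rw [← hW.integral_sub_displacement hmc, ← hW.integral_sub_displacement hmc] at h1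
  have iA : Integrable (fun ω => crossing y (Ua ω)) P :=
    hy.integrable_crossing mUa ((integrable_const a).sub iξ)
  have iB : Integrable (fun ω => crossing y (Ub ω)) P :=
    hy.integrable_crossing mUb ((integrable_const b).sub iξ)
  set x := ∫ ω, |D ω| ∂P with hx
  have hx0 : 0 ≤ x := integral_nonneg fun _ => abs_nonneg _
  have hx2 : x ^ 2 ≤ ∫ ω, D ω ^ 2 ∂P := by
    have := pow_integral_le (μ := P) (f := fun ω => |D ω|) 2 (fun _ => abs_nonneg _) iD.abs
      (by simpa only [sq_abs] using iD2)
    simpa only [sq_abs] using this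
  set Δ := ∫ ω, crossing y (Ub ω) ∂P - ∫ ω, crossing y (Ua ω) ∂P with hΔ
  have hΔx : |Δ - ρ * (b - a)| ≤ 1 + x := by
    have e1 : Δ - ρ * (b - a) = ∫ ω, (crossing y (Ub ω) - crossing y (Ua ω) - ρ * (b - a)) ∂P := by
      have iBA : Integrable (fun ω => crossing y (Ub ω) - crossing y (Ua ω)) P := iB.sub iA
      rw [integral_sub iBA (integrable_const _), integral_sub iB iA]
      simp [hΔ]
    have i1 : Integrable (fun ω => 1 + |D ω|) P := (integrable_const 1).add iD.abs
    have e2 : 1 + x = ∫ ω, (1 + |D ω|) ∂P := by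
      rw [integral_add (integrable_const 1) iD.abs]; simp [hx]
    rw [e1, e2]
    refine abs_integral_le_integral_abs.trans
      (integral_mono ((iB.sub iA).sub (integrable_const _)).abs i1 fun ω => ?_)
    change |crossing y (Ub ω) - crossing y (Ua ω) - ρ * (b - a)| ≤ 1 + |D ω|
    have e3 : crossing y (Ub ω) - crossing y (Ua ω) - ρ * (b - a) =
        ((if 0 ≤ Ub ω then 1 else 0) - (if 0 ≤ Ua ω then 1 else 0)) + D ω := by
      simp only [hD, fluctuation, hUa, hUb]
      ring
    rw [e3]
    refine (abs_add_le _ _).trans ?_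
    gcongr
    split_ifs <;> norm_num
  refine h1.trans ?_
  rw [← ofReal_integral_eq_lintegral_ofReal iG (ae_of_all _ hG0)]
  refine ENNReal.ofReal_le_ofReal ?_
  rw [integral_add (iD2.const_mul 5) (integrable_const _), integral_const_mul]
  simp only [integral_const, probReal_univ, one_smul]
  have e4 : |Δ| ≤ 1 + x + ρ * |b - a| := by
    have := abs_add_le (Δ - ρ * (b - a)) (ρ * (b - a))
    rw [sub_add_cancel, abs_mul ρ, abs_of_pos hρ] at this
    linarith
  have e5 : (Δ - ρ * (b - a)) ^ 2 ≤ (1 + x) ^ 2 := by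
    rw [← sq_abs]
    gcongr
  -- With x = E|D| the bound is 2(1 + x + ρ|b-a|) + 2(1+x)², and 6x ≤ 3x² + 3 brings it to 7 + 5x² +
  -- 2ρ|b-a|.
  nlinarith [sq_nonneg (x - 1), sq_nonneg (x - 3)]

end SingleFile

namespace SingleFile

/-! ### Annealed averages -/

section Annealed

variable {Ω : Type*} [MeasurableSpace Ω] {P : Measure Ω}
  {σ ρ : ℝ} {y : Ω → ℤ → ℝ} {W : ℤ → ℝ≥0 → Ω → ℝ}

/-- The crossing numbers of the displaced configuration as a function of all the paths. -/
noncomputable def pathCrossing (σ : ℝ) (t : ℝ≥0) (a : ℝ) (z : (ℤ → ℝ) × (ℤ → ℝ≥0 → ℝ)) : ℝ :=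
  crossing (fun j => z.1 j + σ / √2 * z.2 j t) a

lemma measurable_pathCrossing (σ : ℝ) (t : ℝ≥0) (a : ℝ) : Measurable (pathCrossing σ t a) :=
  measurable_crossing.comp (Measurable.prodMk (by fun_prop) measurable_const)

lemma measurable_freeCrossing_uncurry (hym : Measurable y) (hW : IsBrownianFamily W P)
    (t : ℝ≥0) (a : ℝ) : Measurable fun p : Ω × Ω => freeCrossing σ (y p.1) W t a p.2 :=
  (measurable_pathCrossing σ t a).comp ((hym.comp measurable_fst).prodMk
    (measurable_pi_lambda _ fun j => measurable_pi_lambda _ fun t =>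
      (hW.measurable j t).comp measurable_snd))

lemma measurable_freeCrossing_random (hym : Measurable y) (hW : IsBrownianFamily W P)
    (t : ℝ≥0) (a : ℝ) : Measurable fun ω => freeCrossing σ (y ω) W t a ω :=
  (measurable_freeCrossing_uncurry hym hW t a).comp (measurable_id.prodMk measurable_id)

lemma measurable_fluctuation_uncurry (ρ : ℝ) (hym : Measurable y) {U : Ω → ℝ}
    (hU : Measurable U) : Measurable fun p : Ω × Ω => fluctuation ρ (y p.1) (U p.2) :=
  (measurable_fluctuation ρ).comp ((hym.comp measurable_fst).prodMk (hU.comp measurable_snd))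

variable [IsProbabilityMeasure P]

/-- Independence permits configuration and paths to be read from separate copies of the probability
space. Conditioning on the initial state then becomes Fubini's theorem. -/
lemma identDistrib_initial_paths (hym : Measurable y) (hW : IsBrownianFamily W P)
    (hind : IndepFun y (fun (ω : Ω) (j : ℤ) (t : ℝ≥0) => W j t ω) P) :
    IdentDistrib (fun ω => (y ω, fun (j : ℤ) (t : ℝ≥0) => W j t ω))
      (fun p : Ω × Ω => (y p.1, fun (j : ℤ) (t : ℝ≥0) => W j t p.2)) P (P.prod P) := by
  have hWm : Measurable fun (ω : Ω) (j : ℤ) (t : ℝ≥0) => W j t ω :=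
    measurable_pi_lambda _ fun j => measurable_pi_lambda _ fun t => hW.measurable j t
  refine ⟨(hym.prodMk hWm).aemeasurable,
    ((hym.comp measurable_fst).prodMk (hWm.comp measurable_snd)).aemeasurable, ?_⟩
  rw [(indepFun_iff_map_prod_eq_prod_map_map hym.aemeasurable hWm.aemeasurable).1 hind,
    Measure.map_prod_map _ _ hym hWm]
  rfl

lemma lintegral_freeCrossing_random (hym : Measurable y) (hW : IsBrownianFamily W P)
    (hind : IndepFun y (fun (ω : Ω) (j : ℤ) (t : ℝ≥0) => W j t ω) P) (t : ℝ≥0) (a b : ℝ)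
    {f : ℝ × ℝ → ℝ≥0∞} (hf : Measurable f) :
    ∫⁻ ω, f (freeCrossing σ (y ω) W t a ω, freeCrossing σ (y ω) W t b ω) ∂P =
      ∫⁻ ω', ∫⁻ ω, f (freeCrossing σ (y ω') W t a ω, freeCrossing σ (y ω') W t b ω) ∂P ∂P := by
  have h1 := ((identDistrib_initial_paths hym hW hind).comp
    (hf.comp ((measurable_pathCrossing σ t a).prodMk (measurable_pathCrossing σ t b)))).lintegral_eq
  have h2 : Measurable fun p : Ω × Ω =>
      f (freeCrossing σ (y p.1) W t a p.2, freeCrossing σ (y p.1) W t b p.2) :=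
    hf.comp ((measurable_freeCrossing_uncurry hym hW t a).prodMk
      (measurable_freeCrossing_uncurry hym hW t b))
  rw [← lintegral_prod _ h2.aemeasurable]
  exact h1

lemma IsAnnealedInitial.lintegral_moment_le (h : IsAnnealedInitial ρ y P) (hρ : 0 < ρ)
    {U : Ω → ℝ} (hU : Measurable U) :
    ∫⁻ ω', ∫⁻ ω, ENNReal.ofReal (1 + fluctuation ρ (y ω') (U ω) ^ 6 + (ρ * |U ω|) ^ 3) ∂P ∂P ≤
      ∫⁻ ω, ENNReal.ofReal (4322 * (1 + ρ * |U ω|) ^ 3) ∂P := by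
  have hm := measurable_fluctuation_uncurry ρ h.measurable hU
  have hmeas : Measurable fun p : Ω × Ω =>
      ENNReal.ofReal (1 + fluctuation ρ (y p.1) (U p.2) ^ 6 + (ρ * |U p.2|) ^ 3) :=
    (((hm.pow_const 6).const_add 1).add
      (((hU.comp measurable_snd).abs.const_mul ρ).pow_const 3)).ennreal_ofReal
  rw [lintegral_lintegral_swap hmeas.aemeasurable]
  refine lintegral_mono fun ω => ?_
  have hz : 0 ≤ ρ * |U ω| := by positivity
  have h1 : ∀ ω', ENNReal.ofReal (1 + fluctuation ρ (y ω') (U ω) ^ 6 + (ρ * |U ω|) ^ 3) =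
      ENNReal.ofReal (fluctuation ρ (y ω') (U ω) ^ 6) +
        ENNReal.ofReal (1 + (ρ * |U ω|) ^ 3) := fun ω' => by
    rw [← ENNReal.ofReal_add (by positivity) (by positivity)]
    congr 1
    ring
  simp only [h1]
  rw [lintegral_add_right _ measurable_const]
  refine (add_le_add_left (h.lintegral_fluctuation_pow_six_le hρ (U ω)) _).trans ?_
  simp only [lintegral_const, measure_univ, mul_one]
  rw [← ENNReal.ofReal_add (by positivity) (by positivity)]
  refine ENNReal.ofReal_le_ofReal ?_
  nlinarith [pow_nonneg hz 3, pow_nonneg hz 2]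

/-- The configuration is averaged first, at a fixed displacement, by the Poisson sixth moment; the
remaining cubic in the displacement is integrated by Gaussian scaling. -/
lemma IsAnnealedInitial.lintegral_freeCrossing_pow_six_le (h : IsAnnealedInitial ρ y P)
    (hρ : 0 < ρ) (hW : IsBrownianFamily W P)
    (hind : IndepFun y (fun (ω : Ω) (j : ℤ) (t : ℝ≥0) => W j t ω) P) :
    ∃ C : ℝ, 0 < C ∧ ∀ t a, ∫⁻ ω, ENNReal.ofReal ((freeCrossing σ (y ω) W t a ω - ρ * a) ^ 6) ∂P ≤
      ENNReal.ofReal (C * (1 + ρ * |a| + ρ * √(displacementVar σ t)) ^ 3) := by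
  set c₃ := ∫ x, |x| ^ 3 ∂(gaussianReal 0 1) with hc₃
  have hc0 : 0 ≤ c₃ := integral_nonneg fun _ => by positivity
  refine ⟨20000000 * (4322 * 4 * (1 + c₃)), by positivity, fun t a => ?_⟩
  have hU := (hW.measurable_displacement (σ := σ) t 0).const_sub a
  have h1 : ∫⁻ ω, ENNReal.ofReal (4322 * (1 + ρ * |a - displacement σ W t 0 ω|) ^ 3) ∂P ≤
      ENNReal.ofReal (4322 * 4 * (1 + c₃) * (1 + ρ * |a| + ρ * √(displacementVar σ t)) ^ 3) := by
    have hlaw := hW.hasLaw_displacement (σ := σ) t 0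
    set v := displacementVar σ t with hv
    have i1 : Integrable (fun x : ℝ => 4322 * 4 * ((1 + ρ * |a|) ^ 3 + ρ ^ 3 * |x| ^ 3))
        (gaussianReal 0 v) :=
      ((integrable_const _).add ((integrable_abs_pow_three_gaussian v).const_mul _)).const_mul _
    have h2 := hlaw.lintegral_comp
      (f := fun x => ENNReal.ofReal (4322 * (1 + ρ * |a - x|) ^ 3)) (by fun_prop)
    refine (le_of_eq h2).trans ?_
    calc _ ≤ ∫⁻ x, ENNReal.ofReal (4322 * 4 * ((1 + ρ * |a|) ^ 3 + ρ ^ 3 * |x| ^ 3))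
          ∂(gaussianReal 0 v) := by
          refine lintegral_mono fun x => ENNReal.ofReal_le_ofReal ?_
          have e1 : 1 + ρ * |a - x| ≤ (1 + ρ * |a|) + ρ * |x| := by
            have := mul_le_mul_of_nonneg_left (abs_sub a x) hρ.le
            linarith
          have e2 := add_pow_le (by positivity : 0 ≤ 1 + ρ * |a|)
            (by positivity : 0 ≤ ρ * |x|) 3
          have e3 : (1 + ρ * |a - x|) ^ 3 ≤ ((1 + ρ * |a|) + ρ * |x|) ^ 3 := by gcongr
          rw [mul_pow ρ |x|] at e2
          norm_num at e2
          linarith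
      _ = ENNReal.ofReal (4322 * 4 * ((1 + ρ * |a|) ^ 3 + ρ ^ 3 * (√(v : ℝ) ^ 3 * c₃))) := by
          rw [← ofReal_integral_eq_lintegral_ofReal i1 (ae_of_all _ fun x => by positivity),
            integral_const_mul, integral_add (integrable_const _)
              ((integrable_abs_pow_three_gaussian v).const_mul _), integral_const_mul,
            integral_abs_pow_three_gaussian]
          simp [hc₃]
      _ ≤ _ := by
          refine ENNReal.ofReal_le_ofReal ?_
          rw [mul_assoc (4322 * 4 : ℝ)]
          refine mul_le_mul_of_nonneg_left ?_ (by norm_num)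
          have e1 : (1 + ρ * |a|) ^ 3 ≤ (1 + ρ * |a| + ρ * √(v : ℝ)) ^ 3 :=
            pow_le_pow_left₀ (by positivity) (le_add_of_nonneg_right (by positivity)) 3
          have e2 : (ρ * √(v : ℝ)) ^ 3 ≤ (1 + ρ * |a| + ρ * √(v : ℝ)) ^ 3 :=
            pow_le_pow_left₀ (by positivity) (le_add_of_nonneg_left (by positivity)) 3
          have e3 := mul_le_mul_of_nonneg_right e2 hc0
          rw [mul_pow] at e3
          linarith
  have h3 := lintegral_freeCrossing_random (σ := σ) h.measurable hW hind t a a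
    (f := fun z => ENNReal.ofReal ((z.1 - ρ * a) ^ 6)) (by fun_prop)
  rw [h3]
  calc _ ≤ ∫⁻ ω', ENNReal.ofReal 20000000 * ∫⁻ ω, ENNReal.ofReal
        (1 + fluctuation ρ (y ω') (a - displacement σ W t 0 ω) ^ 6 +
          (ρ * |a - displacement σ W t 0 ω|) ^ 3) ∂P ∂P := by
        refine lintegral_mono_ae ?_
        filter_upwards [h.ae_isNice hρ] with ω' hω'
        exact hω'.lintegral_freeCrossing_sub_pow_six_le hW hρ t a
    _ ≤ ENNReal.ofReal 20000000 * ENNReal.ofReal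
        (4322 * 4 * (1 + c₃) * (1 + ρ * |a| + ρ * √(displacementVar σ t)) ^ 3) := by
        rw [lintegral_const_mul' _ _ ENNReal.ofReal_ne_top]
        gcongr
        exact (h.lintegral_moment_le hρ hU).trans h1
    _ = _ := by
        rw [← ENNReal.ofReal_mul (by norm_num)]
        congr 1
        ring

/-- At a fixed displacement the Poisson increment has variance ρ|b-a| whatever the level, so the
bound is uniform in time. -/
lemma IsAnnealedInitial.lintegral_increment_sq_le (h : IsAnnealedInitial ρ y P)
    (hρ : 0 < ρ) (hW : IsBrownianFamily W P)
    (hind : IndepFun y (fun (ω : Ω) (j : ℤ) (t : ℝ≥0) => W j t ω) P) (t : ℝ≥0) (a b : ℝ) :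
    ∫⁻ ω, ENNReal.ofReal ((freeCrossing σ (y ω) W t b ω - freeCrossing σ (y ω) W t a ω -
      ρ * (b - a)) ^ 2) ∂P ≤ ENNReal.ofReal (7 + 7 * (ρ * |b - a|)) := by
  have hξ := hW.measurable_displacement (σ := σ) t 0
  have h3 := lintegral_freeCrossing_random (σ := σ) h.measurable hW hind t a b
    (f := fun z => ENNReal.ofReal ((z.2 - z.1 - ρ * (b - a)) ^ 2)) (by fun_prop)
  rw [h3]
  have hz : 0 ≤ ρ * |b - a| := by positivity
  calc _ ≤ ∫⁻ ω', ∫⁻ ω, ENNReal.ofReal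
        (5 * (fluctuation ρ (y ω') (b - displacement σ W t 0 ω) -
          fluctuation ρ (y ω') (a - displacement σ W t 0 ω)) ^ 2 + (7 + 2 * (ρ * |b - a|)))
            ∂P ∂P := by
        refine lintegral_mono_ae ?_
        filter_upwards [h.ae_isNice hρ] with ω' hω'
        exact hω'.lintegral_freeCrossing_increment_sq_le hW hρ t a b
    _ = ∫⁻ ω, ∫⁻ ω', ENNReal.ofReal
        (5 * (fluctuation ρ (y ω') (b - displacement σ W t 0 ω) -
          fluctuation ρ (y ω') (a - displacement σ W t 0 ω)) ^ 2 + (7 + 2 * (ρ * |b - a|)))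
            ∂P ∂P := by
        refine lintegral_lintegral_swap (Measurable.aemeasurable ?_)
        exact (((((measurable_fluctuation_uncurry ρ h.measurable (hξ.const_sub b)).sub
          (measurable_fluctuation_uncurry ρ h.measurable (hξ.const_sub a))).pow_const 2).const_mul
            5).add_const _).ennreal_ofReal
    _ ≤ ∫⁻ _, ENNReal.ofReal (7 + 7 * (ρ * |b - a|)) ∂P := by
        refine lintegral_mono fun ω => ?_
        set u := a - displacement σ W t 0 ω
        set w := b - displacement σ W t 0 ω
        have i1 : Integrable (fun ω' => (fluctuation ρ (y ω') w - fluctuation ρ (y ω') u) ^ 2) P :=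
          ((h.memLp_fluctuation hρ w).sub (h.memLp_fluctuation hρ u)).integrable_sq
        have i2 : Integrable (fun ω' => 5 * (fluctuation ρ (y ω') w - fluctuation ρ (y ω') u) ^ 2 +
            (7 + 2 * (ρ * |b - a|))) P := (i1.const_mul 5).add (integrable_const _)
        rw [← ofReal_integral_eq_lintegral_ofReal i2 (ae_of_all _ fun x => by positivity),
          integral_add (i1.const_mul 5) (integrable_const _), integral_const_mul,
          h.integral_fluctuation_sub_sq hρ, show w - u = b - a by simp only [u, w]; ring]
        refine ENNReal.ofReal_le_ofReal (le_of_eq ?_)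
        simp only [integral_const, probReal_univ, one_smul]
        ring
    _ = _ := by simp

lemma IsAnnealedInitial.memLp_freeCrossing (h : IsAnnealedInitial ρ y P)
    (hρ : 0 < ρ) (hW : IsBrownianFamily W P)
    (hind : IndepFun y (fun (ω : Ω) (j : ℤ) (t : ℝ≥0) => W j t ω) P) (t : ℝ≥0) (a : ℝ) :
    MemLp (fun ω => freeCrossing σ (y ω) W t a ω) 2 P := by
  obtain ⟨C, hC, h6⟩ := h.lintegral_freeCrossing_pow_six_le (σ := σ) hρ hW hind
  have h1 := memLp_two_of_lintegral_pow_six (P := P)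
    (Z := fun ω => freeCrossing σ (y ω) W t a ω - ρ * a)
    ((measurable_freeCrossing_random h.measurable hW t a).sub_const _).aemeasurable
    (ne_top_of_le_ne_top ENNReal.ofReal_ne_top (h6 t a))
  refine (h1.add (memLp_const (ρ * a))).ae_eq (ae_of_all _ fun ω => ?_)
  simp

lemma IsAnnealedInitial.memLp_tracer {X : ℤ → ℝ≥0 → Ω → ℝ} (h : IsAnnealedInitial ρ y P)
    (hρ : 0 < ρ) (hW : IsBrownianFamily W P)
    (hind : IndepFun y (fun (ω : Ω) (j : ℤ) (t : ℝ≥0) => W j t ω) P)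
    (hX : IsSingleFileSystem σ y W X P) (t : ℝ≥0) : MemLp (X 0 t) 2 P := by
  obtain ⟨C, hC, h6⟩ := h.lintegral_freeCrossing_pow_six_le (σ := σ) hρ hW hind
  have hinv := hX.isCountInverse hW (h.ae_isNice hρ) t 0
  simp only [sub_zero, zero_add] at hinv
  have hs := Real.sqrt_nonneg (displacementVar σ t : ℝ)
  refine hinv.memLp_two hρ (hX.measurable 0 t) (K := C * (1 + ρ) ^ 3)
    (R := 1 + √(displacementVar σ t)) (c := 0) (m := fun a => ρ * a)
    ⟨measurable_freeCrossing_random h.measurable hW t, fun a => ?_, fun a => ?_⟩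
    (by positivity) (by positivity)
  · refine (h6 t a).trans (ENNReal.ofReal_le_ofReal ?_)
    rw [mul_assoc, ← mul_pow]
    gcongr
    nlinarith [abs_nonneg a]
  · rw [sub_self, abs_zero]
    positivity

/-- No moving centre is needed: the moment bounds hold around the exactly linear profile ρa, so the
expansion is taken at level 0. Increments over t^{1/4} have mean squared error of order t^{1/4},
which is o(√t). -/
theorem IsAnnealedInitial.isTracerExpansion {X : ℤ → ℝ≥0 → Ω → ℝ} (h : IsAnnealedInitial ρ y P)
    (hσ : 0 < σ) (hρ : 0 < ρ) (hW : IsBrownianFamily W P)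
    (hind : IndepFun y (fun (ω : Ω) (j : ℤ) (t : ℝ≥0) => W j t ω) P)
    (hX : IsSingleFileSystem σ y W X P) :
    IsTracerExpansion ρ (X 0) (fun t ω => freeCrossing σ (y ω) W t 0 ω) (fun _ => 0) P := by
  obtain ⟨C, hC, h6⟩ := h.lintegral_freeCrossing_pow_six_le (σ := σ) hρ hW hind
  refine ⟨h.memLp_tracer hρ hW hind hX, fun t => h.memLp_freeCrossing hρ hW hind t 0,
    fun ε hε => ?_⟩
  have hr2 : ∀ t : ℝ≥0, √√(t : ℝ) ^ 2 = √t := fun t => Real.sq_sqrt (Real.sqrt_nonneg _)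
  set s : ℝ := σ / √2 with hs
  have hs0 : 0 < s := by positivity
  have main := eventually_lintegral_inverse_add_le (P := P) (l := atTop) (ρ := ρ)
    (K := C * (1 + ρ + ρ * s) ^ 3) (c := 0) hρ (by positivity) le_rfl
    (r := fun t : ℝ≥0 => √(√(t : ℝ))) tendsto_sqrt_sqrt_atTop
    (Y := fun t ω => X 0 t ω - 0) (fun t => (hX.measurable 0 t).sub_const _)
    (N := fun t a ω => freeCrossing σ (y ω) W t (0 + a) ω) (m := fun t a => ρ * a)
    (Eventually.of_forall fun t => hX.isCountInverse hW (h.ae_isNice hρ) t 0) ?_ ?_ hε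
  · filter_upwards [main] with t ht
    simpa only [add_zero, hr2] using ht
  · filter_upwards [eventually_ge_atTop 1] with t ht
    have ht1 : 1 ≤ √(t : ℝ) := Real.one_le_sqrt.2 (by exact_mod_cast ht)
    refine ⟨fun a => measurable_freeCrossing_random h.measurable hW t _, fun a => ?_,
      fun a => ?_⟩
    · simp only [zero_add]
      refine (h6 t a).trans (ENNReal.ofReal_le_ofReal ?_)
      rw [mul_assoc, ← mul_pow, hr2, sqrt_displacementVar hσ]
      gcongr
      have e1 : 0 ≤ ρ * s * |a| := by positivity
      nlinarith [abs_nonneg a, mul_le_mul_of_nonneg_left ht1 hρ.le]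
    · rw [sub_self, abs_zero]
      positivity
  · intro b ε hε
    have hlarge : ∀ᶠ t : ℝ≥0 in atTop, 14 * (ρ * |b|) / ε + 14 / ε + 1 ≤ √√(t : ℝ) :=
      tendsto_sqrt_sqrt_atTop.eventually_ge_atTop _
    filter_upwards [hlarge] with t ht
    set r := √√(t : ℝ) with hr
    have hr0 : 0 ≤ r := Real.sqrt_nonneg _
    have h1 := h.lintegral_increment_sq_le (σ := σ) hρ hW hind t 0 (b * r)
    rw [sub_zero] at h1
    simp only [zero_add]
    refine h1.trans (ENNReal.ofReal_le_ofReal ?_)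
    rw [abs_mul, abs_of_nonneg hr0]
    have e1 : 0 ≤ 14 * (ρ * |b|) / ε := by positivity
    have e2 : 0 ≤ 14 / ε := by positivity
    have e3 : 14 * (ρ * |b|) ≤ ε * r := by
      rw [mul_comm ε, ← div_le_iff₀ hε]; linarith
    have e4 : 14 ≤ ε * r := by
      rw [mul_comm ε, ← div_le_iff₀ hε]; linarith
    have e5 : 1 ≤ r := by linarith
    nlinarith [mul_le_mul_of_nonneg_right e3 hr0, mul_le_mul_of_nonneg_right e4 hr0]

end Annealed

end SingleFile

namespace SingleFile

/-! ### Annealed covariance of the counts -/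

/-- Mean of the crossing function in the annealed initial state. -/
noncomputable def meanCrossing (ρ v : ℝ) : ℝ := ρ * v + if 0 ≤ v then 1 else 0

lemma crossing_eq_fluctuation_add (ρ : ℝ) (y : ℤ → ℝ) (v : ℝ) :
    crossing y v = fluctuation ρ y v + meanCrossing ρ v := by
  unfold fluctuation meanCrossing
  ring

lemma abs_meanCrossing_sub_le (ρ v : ℝ) : |meanCrossing ρ v - ρ * v| ≤ 1 := by
  unfold meanCrossing
  split_ifs <;> simp

lemma measurable_meanCrossing (ρ : ℝ) : Measurable (meanCrossing ρ) :=
  (measurable_id.const_mul ρ).add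
    (Measurable.ite measurableSet_Ici measurable_const measurable_const)

section Annealed

variable {Ω : Type*} [MeasurableSpace Ω] {P : Measure Ω}
  {σ ρ : ℝ} {y : Ω → ℤ → ℝ} {W : ℤ → ℝ≥0 → Ω → ℝ} {U V : Ω → ℝ}

lemma IsBrownianFamily.memLp_displacement (hW : IsBrownianFamily W P) (t : ℝ≥0) (j : ℤ) :
    MemLp (displacement σ W t j) 2 P := by
  have h := hW.hasLaw_displacement (σ := σ) t j
  have h2 : MemLp id 2 (P.map (displacement σ W t j)) := by
    rw [h.map_eq]
    exact memLp_id_gaussianReal' 2 (by norm_num)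
  exact h2.comp_of_map h.aemeasurable

lemma IsBrownianFamily.integral_comp_displacement (hW : IsBrownianFamily W P) {f : ℝ → ℝ}
    (hf : Measurable f) (t : ℝ≥0) (j : ℤ) :
    ∫ ω, f (displacement σ W t j ω) ∂P = ∫ ω, f (displacement σ W t 0 ω) ∂P :=
  ((hW.hasLaw_displacement t j).integral_comp hf.aestronglyMeasurable).trans
    ((hW.hasLaw_displacement t 0).integral_comp hf.aestronglyMeasurable).symm

variable [IsProbabilityMeasure P]

lemma memLp_meanCrossing (hU : Measurable U) {p : ℝ≥0∞} (hp : MemLp U p P) :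
    MemLp (fun ω => meanCrossing ρ (U ω)) p P := by
  have h1 : MemLp (fun ω => meanCrossing ρ (U ω) - ρ * U ω) p P :=
    (memLp_const (1 : ℝ)).mono
      (((measurable_meanCrossing ρ).comp hU).sub (hU.const_mul ρ)).aestronglyMeasurable
      (ae_of_all _ fun ω => by simpa using abs_meanCrossing_sub_le ρ (U ω))
  refine (h1.add (hp.const_mul ρ)).ae_eq (ae_of_all _ fun ω => ?_)
  simp

lemma abs_integral_meanCrossing_sub_le (hU : Measurable U) (hi : Integrable U P) :
    |∫ ω, meanCrossing ρ (U ω) ∂P - ρ * ∫ ω, U ω ∂P| ≤ 1 := by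
  have h1 : Integrable (fun ω => meanCrossing ρ (U ω)) P :=
    memLp_one_iff_integrable.1 (memLp_meanCrossing hU (memLp_one_iff_integrable.2 hi))
  rw [← integral_const_mul, ← integral_sub h1 (hi.const_mul ρ)]
  have := norm_integral_le_of_norm_le_const (μ := P)
    (f := fun ω => meanCrossing ρ (U ω) - ρ * U ω)
    (ae_of_all P fun ω => abs_meanCrossing_sub_le ρ (U ω))
  simpa using this

namespace IsAnnealedInitial

lemma integral_crossing (h : IsAnnealedInitial ρ y P) (hρ : 0 < ρ) (a : ℝ) :
    ∫ ω, crossing (y ω) a ∂P = meanCrossing ρ a := by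
  simp only [crossing_eq_fluctuation_add ρ]
  rw [integral_add ((h.memLp_fluctuation hρ a).integrable one_le_two) (integrable_const _),
    h.integral_fluctuation hρ]
  simp

lemma integral_crossing_mul (h : IsAnnealedInitial ρ y P) (hρ : 0 < ρ) (a b : ℝ) :
    ∫ ω, crossing (y ω) a * crossing (y ω) b ∂P =
      ρ / 2 * (|a| + |b| - |a - b|) + meanCrossing ρ a * meanCrossing ρ b := by
  have ia := (h.memLp_fluctuation hρ a).integrable one_le_two
  have ib := (h.memLp_fluctuation hρ b).integrable one_le_two
  have iab : Integrable (fun ω => fluctuation ρ (y ω) a * fluctuation ρ (y ω) b) P :=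
    (h.memLp_fluctuation hρ a).integrable_mul (h.memLp_fluctuation hρ b)
  have h1 : ∀ ω, crossing (y ω) a * crossing (y ω) b =
      fluctuation ρ (y ω) a * fluctuation ρ (y ω) b +
        (fluctuation ρ (y ω) a * meanCrossing ρ b + fluctuation ρ (y ω) b * meanCrossing ρ a) +
          meanCrossing ρ a * meanCrossing ρ b := fun ω => by
    rw [crossing_eq_fluctuation_add ρ, crossing_eq_fluctuation_add ρ]
    ring
  have i1 : Integrable (fun ω => fluctuation ρ (y ω) a * meanCrossing ρ b +
      fluctuation ρ (y ω) b * meanCrossing ρ a) P := (ia.mul_const _).add (ib.mul_const _)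
  have i2 : Integrable (fun ω => fluctuation ρ (y ω) a * fluctuation ρ (y ω) b +
        (fluctuation ρ (y ω) a * meanCrossing ρ b +
          fluctuation ρ (y ω) b * meanCrossing ρ a)) P := iab.add i1
  simp only [h1]
  rw [integral_add i2 (integrable_const _), integral_add iab i1,
    integral_add (ia.mul_const _) (ib.mul_const _), integral_mul_const, integral_mul_const,
    h.integral_fluctuation hρ, h.integral_fluctuation hρ, h.integral_fluctuation_mul hρ]
  simp

lemma memLp_fluctuation_uncurry (h : IsAnnealedInitial ρ y P) (hρ : 0 < ρ) (hU : Measurable U)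
    (hi : Integrable U P) :
    MemLp (fun p : Ω × Ω => fluctuation ρ (y p.1) (U p.2)) 2 (P.prod P) := by
  have hm := measurable_fluctuation_uncurry ρ h.measurable hU
  rw [memLp_two_iff_integrable_sq hm.aestronglyMeasurable]
  refine ⟨(hm.pow_const 2).aestronglyMeasurable, ?_⟩
  rw [hasFiniteIntegral_iff_ofReal (ae_of_all _ fun _ => sq_nonneg _),
    lintegral_prod_symm _ (hm.pow_const 2).ennreal_ofReal.aemeasurable]
  have h1 : ∀ ω, ∫⁻ ω', ENNReal.ofReal (fluctuation ρ (y ω') (U ω) ^ 2) ∂P =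
      ENNReal.ofReal (ρ * |U ω|) := fun ω => by
    rw [← ofReal_integral_eq_lintegral_ofReal (h.memLp_fluctuation hρ _).integrable_sq
      (ae_of_all _ fun _ => sq_nonneg _), h.integral_fluctuation_sq hρ]
  simp only [h1]
  exact (hasFiniteIntegral_iff_ofReal (ae_of_all _ fun ω => by positivity)).1
    (hi.abs.const_mul ρ).hasFiniteIntegral

lemma integrable_crossing_uncurry (h : IsAnnealedInitial ρ y P) (hρ : 0 < ρ) (hU : Measurable U)
    (hi : Integrable U P) :
    Integrable (fun p : Ω × Ω => crossing (y p.1) (U p.2)) (P.prod P) := by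
  simp only [crossing_eq_fluctuation_add ρ]
  exact ((h.memLp_fluctuation_uncurry hρ hU hi).integrable one_le_two).add
    ((memLp_one_iff_integrable.1 (memLp_meanCrossing hU (memLp_one_iff_integrable.2 hi))).comp_snd
      P)

lemma memLp_crossing_uncurry (h : IsAnnealedInitial ρ y P) (hρ : 0 < ρ) (hU : Measurable U)
    (hi : MemLp U 2 P) :
    MemLp (fun p : Ω × Ω => crossing (y p.1) (U p.2)) 2 (P.prod P) := by
  simp only [crossing_eq_fluctuation_add ρ]
  exact (h.memLp_fluctuation_uncurry hρ hU (hi.integrable one_le_two)).add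
    ((memLp_meanCrossing hU hi).comp_snd P)

lemma integral_integral_crossing (h : IsAnnealedInitial ρ y P) (hρ : 0 < ρ) (hU : Measurable U)
    (hi : Integrable U P) :
    ∫ ω', ∫ ω, crossing (y ω') (U ω) ∂P ∂P = ∫ ω, meanCrossing ρ (U ω) ∂P := by
  rw [← integral_prod _ (h.integrable_crossing_uncurry hρ hU hi),
    integral_prod_symm _ (h.integrable_crossing_uncurry hρ hU hi)]
  simp only [h.integral_crossing hρ]

lemma integral_integral_crossing_mul (h : IsAnnealedInitial ρ y P) (hρ : 0 < ρ)
    (hU : Measurable U) (hV : Measurable V) (hi : MemLp U 2 P) (hj : MemLp V 2 P) :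
    ∫ ω', ∫ ω, crossing (y ω') (U ω) * crossing (y ω') (V ω) ∂P ∂P =
      ∫ ω, (ρ / 2 * (|U ω| + |V ω| - |U ω - V ω|) +
        meanCrossing ρ (U ω) * meanCrossing ρ (V ω)) ∂P := by
  have i1 : Integrable (fun p : Ω × Ω => crossing (y p.1) (U p.2) * crossing (y p.1) (V p.2))
      (P.prod P) :=
    (h.memLp_crossing_uncurry hρ hU hi).integrable_mul (h.memLp_crossing_uncurry hρ hV hj)
  rw [← integral_prod _ i1, integral_prod_symm _ i1]
  simp only [h.integral_crossing_mul hρ]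

lemma memLp_freeCrossing_uncurry (h : IsAnnealedInitial ρ y P) (hρ : 0 < ρ)
    (hW : IsBrownianFamily W P)
    (hind : IndepFun y (fun (ω : Ω) (j : ℤ) (t : ℝ≥0) => W j t ω) P) (t : ℝ≥0) (a : ℝ) :
    MemLp (fun p : Ω × Ω => freeCrossing σ (y p.1) W t a p.2) 2 (P.prod P) :=
  (((identDistrib_initial_paths h.measurable hW hind).comp
    (measurable_pathCrossing σ t a)).memLp_iff).1 (h.memLp_freeCrossing hρ hW hind t a)

lemma integral_freeCrossing (h : IsAnnealedInitial ρ y P) (hρ : 0 < ρ)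
    (hW : IsBrownianFamily W P)
    (hind : IndepFun y (fun (ω : Ω) (j : ℤ) (t : ℝ≥0) => W j t ω) P) (t : ℝ≥0) (a : ℝ) :
    ∫ ω, freeCrossing σ (y ω) W t a ω ∂P =
      ∫ ω, meanCrossing ρ (a - displacement σ W t 0 ω) ∂P := by
  have h1 := ((identDistrib_initial_paths h.measurable hW hind).comp
    (measurable_pathCrossing σ t a)).integral_eq
  have h2 : ∫ ω, freeCrossing σ (y ω) W t a ω ∂P =
      ∫ p : Ω × Ω, freeCrossing σ (y p.1) W t a p.2 ∂(P.prod P) := h1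
  rw [h2, integral_prod _ ((h.memLp_freeCrossing_uncurry hρ hW hind t a).integrable one_le_two),
    ← h.integral_integral_crossing hρ ((hW.measurable_displacement t 0).const_sub a)
      ((integrable_const a).sub (hW.integrable_displacement t 0))]
  refine integral_congr_ae ?_
  filter_upwards [h.ae_isNice hρ] with ω' hω'
  exact (hW.isNoisePair t t).integral_crossing hω' a

end IsAnnealedInitial

/-- Law of total covariance. The two minima give the averaged conditional covariance; the first
bracket is the covariance of the conditional means, that is, the Poisson covariance at two levels
moved by independent displacements. -/
theorem IsAnnealedInitial.covariance_freeCrossing (h : IsAnnealedInitial ρ y P) (hρ : 0 < ρ)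
    (hW : IsBrownianFamily W P)
    (hind : IndepFun y (fun (ω : Ω) (j : ℤ) (t : ℝ≥0) => W j t ω) P) (s t : ℝ≥0) :
    cov[fun ω => freeCrossing σ (y ω) W s 0 ω, fun ω => freeCrossing σ (y ω) W t 0 ω; P] =
      ρ / 2 * (∫ ω, |displacement σ W s 0 ω| ∂P + ∫ ω, |displacement σ W t 1 ω| ∂P -
        ∫ ω, |displacement σ W s 0 ω - displacement σ W t 1 ω| ∂P) +
      ∫ ω, meanCrossing ρ (min (0 - displacement σ W s 0 ω) (0 - displacement σ W t 0 ω)) ∂P -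
      ∫ ω, meanCrossing ρ (min (0 - displacement σ W s 0 ω) (0 - displacement σ W t 1 ω)) ∂P := by
  have mU := (hW.measurable_displacement (σ := σ) s 0).const_sub 0
  have mV := fun j => (hW.measurable_displacement (σ := σ) t j).const_sub 0
  have lU : MemLp (fun ω => 0 - displacement σ W s 0 ω) 2 P :=
    (memLp_const 0).sub (hW.memLp_displacement s 0)
  have lV : ∀ j, MemLp (fun ω => 0 - displacement σ W t j ω) 2 P := fun j =>
    (memLp_const 0).sub (hW.memLp_displacement t j)
  set U : Ω → ℝ := fun ω => 0 - displacement σ W s 0 ω with hU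
  set V : ℤ → Ω → ℝ := fun j ω => 0 - displacement σ W t j ω with hV
  have iU := lU.integrable one_le_two
  have iV : ∀ j, Integrable (V j) P := fun j => (lV j).integrable one_le_two
  have mM : ∀ j, Measurable fun ω => min (U ω) (V j ω) := fun j => mU.min (mV j)
  have iM : ∀ j, Integrable (fun ω => min (U ω) (V j ω)) P := fun j => iU.inf (iV j)
  have hUV : IndepFun U (V 1) P :=
    (hW.indep.indepFun (by norm_num : (0 : ℤ) ≠ 1)).comp
      (φ := fun w : ℝ≥0 → ℝ => 0 - σ / √2 * w s) (ψ := fun w : ℝ≥0 → ℝ => 0 - σ / √2 * w t)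
      (by fun_prop) (by fun_prop)
  have hV01 : ∀ f : ℝ → ℝ, Measurable f → ∫ ω, f (V 0 ω) ∂P = ∫ ω, f (V 1 ω) ∂P := fun f hf =>
    (hW.integral_comp_displacement (f := fun x => f (0 - x))
      (hf.comp (measurable_id.const_sub 0)) t 1).symm
  -- For a fixed configuration the product of conditional means is rewritten as one average, using
  -- the independent displacement of particle 1, so that the average over configurations sees a
  -- product of two crossing values.
  have e1 : ∫ ω, freeCrossing σ (y ω) W s 0 ω * freeCrossing σ (y ω) W t 0 ω ∂P =
      ∫ ω', (∫ ω, crossing (y ω') (U ω) * crossing (y ω') (V 1 ω) ∂P +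
        ∫ ω, crossing (y ω') (min (U ω) (V 0 ω)) ∂P -
          ∫ ω, crossing (y ω') (min (U ω) (V 1 ω)) ∂P) ∂P := by
    have i1 : Integrable (fun p : Ω × Ω => freeCrossing σ (y p.1) W s 0 p.2 *
        freeCrossing σ (y p.1) W t 0 p.2) (P.prod P) :=
      (h.memLp_freeCrossing_uncurry hρ hW hind s 0).integrable_mul
        (h.memLp_freeCrossing_uncurry hρ hW hind t 0)
    have h1 := ((identDistrib_initial_paths h.measurable hW hind).comp
      ((measurable_pathCrossing σ s 0).mul (measurable_pathCrossing σ t 0))).integral_eq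
    have h2 : ∫ ω, freeCrossing σ (y ω) W s 0 ω * freeCrossing σ (y ω) W t 0 ω ∂P =
        ∫ p : Ω × Ω, freeCrossing σ (y p.1) W s 0 p.2 * freeCrossing σ (y p.1) W t 0 p.2
          ∂(P.prod P) := h1
    rw [h2, integral_prod _ i1]
    refine integral_congr_ae ?_
    filter_upwards [h.ae_isNice hρ] with ω' hω'
    have hnp := hW.isNoisePair (σ := σ) s t
    have hmc := hω'.monotone_crossing.measurable
    have h3 := hnp.covariance_crossing hω' 0 0
    have h4 : ∫ ω, crossing (fun j => y ω' j + displacement σ W s j ω) 0 ∂P =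
        ∫ ω, crossing (y ω') (U ω) ∂P := hnp.integral_crossing hω' 0
    have h5 : ∫ ω, crossing (fun j => y ω' j + displacement σ W t j ω) 0 ∂P =
        ∫ ω, crossing (y ω') (V 1 ω) ∂P :=
      (hnp.swap.integral_crossing hω' 0).trans (hV01 _ hmc)
    have h6 : ∫ ω, crossing (y ω') (U ω) * crossing (y ω') (V 1 ω) ∂P =
        (∫ ω, crossing (y ω') (U ω) ∂P) * ∫ ω, crossing (y ω') (V 1 ω) ∂P :=
      (hUV.comp hmc hmc).integral_fun_mul_eq_mul_integral
        (hmc.comp mU).aestronglyMeasurable (hmc.comp (mV 1)).aestronglyMeasurable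
    rw [h4, h5, ← h6] at h3
    change ∫ ω, crossing (fun j => y ω' j + displacement σ W s j ω) 0 *
      crossing (fun j => y ω' j + displacement σ W t j ω) 0 ∂P = _
    linarith
  have j1 : Integrable (fun ω' => ∫ ω, crossing (y ω') (U ω) * crossing (y ω') (V 1 ω) ∂P) P := by
    have i1 : Integrable (fun p : Ω × Ω => crossing (y p.1) (U p.2) * crossing (y p.1) (V 1 p.2))
        (P.prod P) :=
      (h.memLp_crossing_uncurry hρ mU lU).integrable_mul (h.memLp_crossing_uncurry hρ (mV 1) (lV 1))
    exact i1.integral_prod_left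
  have j2 : ∀ j, Integrable (fun ω' => ∫ ω, crossing (y ω') (min (U ω) (V j ω)) ∂P) P := fun j =>
    (h.integrable_crossing_uncurry hρ (mM j) (iM j)).integral_prod_left
  have j3 : Integrable (fun ω' => ∫ ω, crossing (y ω') (U ω) * crossing (y ω') (V 1 ω) ∂P +
      ∫ ω, crossing (y ω') (min (U ω) (V 0 ω)) ∂P) P := j1.add (j2 0)
  have k1 : Integrable (fun ω => meanCrossing ρ (U ω) * meanCrossing ρ (V 1 ω)) P :=
    (memLp_meanCrossing mU lU).integrable_mul (memLp_meanCrossing (mV 1) (lV 1))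
  have k2 : Integrable (fun ω => |U ω - V 1 ω|) P := (iU.sub (iV 1)).abs
  have k3 : Integrable (fun ω => |U ω| + |V 1 ω|) P := iU.abs.add (iV 1).abs
  have k4 : Integrable (fun ω => |U ω| + |V 1 ω| - |U ω - V 1 ω|) P := k3.sub k2
  have e2 : ∫ ω, meanCrossing ρ (U ω) * meanCrossing ρ (V 1 ω) ∂P =
      (∫ ω, meanCrossing ρ (U ω) ∂P) * ∫ ω, meanCrossing ρ (V 1 ω) ∂P :=
    (hUV.comp (measurable_meanCrossing ρ)
      (measurable_meanCrossing ρ)).integral_fun_mul_eq_mul_integral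
        ((measurable_meanCrossing ρ).comp mU).aestronglyMeasurable
        ((measurable_meanCrossing ρ).comp (mV 1)).aestronglyMeasurable
  have e3 : ∫ ω, freeCrossing σ (y ω) W s 0 ω ∂P = ∫ ω, meanCrossing ρ (U ω) ∂P :=
    h.integral_freeCrossing hρ hW hind s 0
  have e4 : ∫ ω, freeCrossing σ (y ω) W t 0 ω ∂P = ∫ ω, meanCrossing ρ (V 1 ω) ∂P :=
    (h.integral_freeCrossing hρ hW hind t 0).trans (hV01 _ (measurable_meanCrossing ρ))
  have e5 := covariance_eq_sub (h.memLp_freeCrossing (σ := σ) hρ hW hind s 0)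
    (h.memLp_freeCrossing (σ := σ) hρ hW hind t 0)
  simp only [Pi.mul_apply] at e5
  rw [e5, e1, e3, e4, integral_sub j3 (j2 1), integral_add j1 (j2 0),
    h.integral_integral_crossing_mul hρ mU (mV 1) lU (lV 1),
    h.integral_integral_crossing hρ (mM 0) (iM 0), h.integral_integral_crossing hρ (mM 1) (iM 1),
    integral_add (k4.const_mul _) k1, e2, integral_const_mul, integral_sub k3 k2,
    integral_add iU.abs (iV 1).abs]
  have a1 : ∀ ω, |U ω| = |displacement σ W s 0 ω| := fun ω => by simp [hU]
  have a2 : ∀ ω, |V 1 ω| = |displacement σ W t 1 ω| := fun ω => by simp [hV]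
  have a3 : ∀ ω, |U ω - V 1 ω| = |displacement σ W s 0 ω - displacement σ W t 1 ω| := fun ω => by
    rw [abs_sub_comm]; simp only [hU, hV]; ring_nf
  simp only [a1, a2, a3]
  simp only [hU, hV]
  ring

end Annealed

end SingleFile

/-! ### Asymptotics of the annealed correlations -/

namespace SingleFile

section Annealed

variable {Ω : Type*} [MeasurableSpace Ω] {P : Measure Ω} [IsProbabilityMeasure P]
  {σ ρ : ℝ} {y : Ω → ℤ → ℝ} {W : ℤ → ℝ≥0 → Ω → ℝ}

/-- The mean initial count is within 1 of a linear function and the displacements are centred, so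
the only main term comes from the absolute difference in the minimum. -/
lemma IsBrownianFamily.abs_integral_meanCrossing_min_le (hW : IsBrownianFamily W P)
    (s t : ℝ≥0) (j : ℤ) :
    |∫ ω, meanCrossing ρ (min (0 - displacement σ W s 0 ω) (0 - displacement σ W t j ω)) ∂P +
      ρ / 2 * ∫ ω, |displacement σ W s 0 ω - displacement σ W t j ω| ∂P| ≤ 1 := by
  have mM := ((hW.measurable_displacement (σ := σ) s 0).const_sub 0).min
    ((hW.measurable_displacement (σ := σ) t j).const_sub 0)
  have i1 := hW.integrable_displacement (σ := σ) s 0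
  have i2 := hW.integrable_displacement (σ := σ) t j
  have i3 : Integrable (fun ω => 0 - displacement σ W s 0 ω) P := (integrable_const 0).sub i1
  have i4 : Integrable (fun ω => 0 - displacement σ W t j ω) P := (integrable_const 0).sub i2
  have i5 : Integrable (fun ω => 0 - displacement σ W s 0 ω + (0 - displacement σ W t j ω)) P :=
    i3.add i4
  have i6 : Integrable (fun ω => |displacement σ W s 0 ω - displacement σ W t j ω|) P :=
    (i1.sub i2).abs
  have e1 : ∫ ω, min (0 - displacement σ W s 0 ω) (0 - displacement σ W t j ω) ∂P =
      -(∫ ω, |displacement σ W s 0 ω - displacement σ W t j ω| ∂P) / 2 := by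
    have e2 : ∀ ω, min (0 - displacement σ W s 0 ω) (0 - displacement σ W t j ω) =
        (0 - displacement σ W s 0 ω + (0 - displacement σ W t j ω) -
          |displacement σ W s 0 ω - displacement σ W t j ω|) / 2 := fun ω => by
      rw [min_eq_half_add_sub_abs, abs_sub_comm (displacement σ W s 0 ω)]
      ring_nf
    simp only [e2]
    rw [integral_div, integral_sub i5 i6, integral_add i3 i4,
      integral_sub (integrable_const 0) i1, integral_sub (integrable_const 0) i2,
      hW.integral_displacement, hW.integral_displacement]
    simp
  have := abs_integral_meanCrossing_sub_le (ρ := ρ) mM (i3.inf i4)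
  rw [e1] at this
  convert this using 2
  ring

/-- The mean absolute difference of independent displacements occurs in the Poisson part and, with
opposite sign, in the conditional covariance. It cancels, leaving √s + √t - √|t-s| up to a bounded
error. -/
theorem IsAnnealedInitial.abs_covariance_sub_le (h : IsAnnealedInitial ρ y P) (hσ : 0 < σ)
    (hρ : 0 < ρ) (hW : IsBrownianFamily W P)
    (hind : IndepFun y (fun (ω : Ω) (j : ℤ) (t : ℝ≥0) => W j t ω) P) (s t : ℝ≥0) :
    |cov[fun ω => freeCrossing σ (y ω) W s 0 ω, fun ω => freeCrossing σ (y ω) W t 0 ω; P] -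
      ρ ^ 2 * annealedCorr σ ρ s t| ≤ 2 := by
  have h0 := hW.abs_integral_meanCrossing_min_le (σ := σ) (ρ := ρ) s t 0
  have h1 := hW.abs_integral_meanCrossing_min_le (σ := σ) (ρ := ρ) s t 1
  rw [h.covariance_freeCrossing hρ hW hind, annealedCorr]
  rw [hW.integral_abs_displacement_sub_self hσ hρ] at h0
  rw [hW.integral_abs_displacement hσ hρ, hW.integral_abs_displacement hσ hρ]
  have := (abs_sub _ _).trans (add_le_add h0 h1)
  refine le_trans (le_of_eq ?_) (this.trans (by norm_num))
  congr 1
  ring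

theorem IsAnnealedInitial.tendsto_covariance_count (h : IsAnnealedInitial ρ y P) (hσ : 0 < σ)
    (hρ : 0 < ρ) (hW : IsBrownianFamily W P)
    (hind : IndepFun y (fun (ω : Ω) (j : ℤ) (t : ℝ≥0) => W j t ω) P) (τ₁ τ₂ : ℝ≥0) :
    Tendsto (fun t : ℝ≥0 => cov[fun ω => freeCrossing σ (y ω) W (τ₁ * t) 0 ω,
      fun ω => freeCrossing σ (y ω) W (τ₂ * t) 0 ω; P] / √(t : ℝ)) atTop
      (𝓝 (ρ ^ 2 * annealedCorr σ ρ τ₁ τ₂)) := by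
  refine tendsto_div_sqrt_of_eventually_le fun δ hδ => ?_
  filter_upwards [eventually_const_le_mul_sqrt 2 hδ] with t ht
  have := h.abs_covariance_sub_le hσ hρ hW hind (τ₁ * t) (τ₂ * t)
  rw [NNReal.coe_mul, NNReal.coe_mul, annealedCorr_mul, ← mul_assoc] at this
  exact this.trans ht

theorem IsAnnealedInitial.tracer_correlations {X : ℤ → ℝ≥0 → Ω → ℝ}
    (h : IsAnnealedInitial ρ y P) (hσ : 0 < σ) (hρ : 0 < ρ) (hW : IsBrownianFamily W P)
    (hind : IndepFun y (fun (ω : Ω) (j : ℤ) (t : ℝ≥0) => W j t ω) P)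
    (hX : IsSingleFileSystem σ y W X P) {τ₁ τ₂ : ℝ≥0} (h1 : 0 < τ₁) (h2 : 0 < τ₂) :
    ((fun t : ℝ≥0 => cov[X 0 (τ₁ * t), X 0 (τ₂ * t); P]) ~[atTop]
      fun t : ℝ≥0 => annealedCorr σ ρ (τ₁ * t) (τ₂ * t)) ∧
    ((fun t : ℝ≥0 => ∫ ω, X 0 (τ₁ * t) ω * X 0 (τ₂ * t) ω ∂P) ~[atTop]
      fun t : ℝ≥0 => annealedCorr σ ρ (τ₁ * t) (τ₂ * t)) := by
  have hexp := h.isTracerExpansion hσ hρ hW hind hX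
  have hcov := hexp.tendsto_covariance hρ h1 h2
    (h.tendsto_covariance_count hσ hρ hW hind τ₁ τ₁)
    (h.tendsto_covariance_count hσ hρ hW hind τ₂ τ₂)
    (h.tendsto_covariance_count hσ hρ hW hind τ₁ τ₂)
  have hpos := annealedCorr_pos hσ hρ h1 h2
  simp only [annealedCorr_mul]
  refine ⟨isEquivalent_of_tendsto_div_sqrt hpos hcov,
    isEquivalent_of_tendsto_div_sqrt hpos (hexp.tendsto_integral_mul h1 h2 (B := 1 / ρ)
      (Eventually.of_forall fun t => ?_) hcov)⟩
  -- The mean count at level 0 is at most 1 in modulus, since the displacement is centred; with q =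
  -- 0 this gives B = 1/ρ.
  have i1 := hW.integrable_displacement (σ := σ) t 0
  have hb := abs_integral_meanCrossing_sub_le (ρ := ρ)
    ((hW.measurable_displacement (σ := σ) t 0).const_sub 0) ((integrable_const 0).sub i1)
  rw [integral_sub (integrable_const 0) i1, hW.integral_displacement,
    ← h.integral_freeCrossing hρ hW hind] at hb
  simp only [integral_zero, sub_zero, mul_zero] at hb
  rw [zero_sub, abs_neg, abs_div, abs_of_pos hρ]
  gcongr

end Annealed

end SingleFile

theorem mainTheorem4 {Ω : Type*} [MeasurableSpace Ω] (P : Measure Ω) [IsProbabilityMeasure P]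
    (σ ρ : ℝ) (hσ : 0 < σ) (hρ : 0 < ρ)
    (W : ℤ → ℝ≥0 → Ω → ℝ) (hW : SingleFile.IsBrownianFamily W P) :
    -- annealed case
    (∀ (y : Ω → ℤ → ℝ) (X : ℤ → ℝ≥0 → Ω → ℝ),
      SingleFile.IsAnnealedInitial ρ y P →
      IndepFun y (fun (ω : Ω) (j : ℤ) (t : ℝ≥0) => W j t ω) P →
      SingleFile.IsSingleFileSystem σ y W X P →
      (∀ t, MemLp (X 0 t) 2 P) ∧
      ∀ τ₁ τ₂ : ℝ≥0, 0 < τ₁ → 0 < τ₂ →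
        (fun t : ℝ≥0 => cov[X 0 (τ₁ * t), X 0 (τ₂ * t); P]) ~[atTop]
          (fun t : ℝ≥0 => SingleFile.annealedCorr σ ρ (τ₁ * t) (τ₂ * t)) ∧
        (fun t : ℝ≥0 => ∫ ω, X 0 (τ₁ * t) ω * X 0 (τ₂ * t) ω ∂P) ~[atTop]
          (fun t : ℝ≥0 => SingleFile.annealedCorr σ ρ (τ₁ * t) (τ₂ * t))) ∧
    -- quenched case
    (∀ (y : ℤ → ℝ) (X : ℤ → ℝ≥0 → Ω → ℝ),
      SingleFile.IsQuenchedInitial ρ y →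
      SingleFile.IsSingleFileSystem σ (fun _ => y) W X P →
      (∀ t, MemLp (X 0 t) 2 P) ∧
      ∀ τ₁ τ₂ : ℝ≥0, 0 < τ₁ → 0 < τ₂ →
        (fun t : ℝ≥0 => cov[X 0 (τ₁ * t), X 0 (τ₂ * t); P]) ~[atTop]
          (fun t : ℝ≥0 => SingleFile.quenchedCorr σ ρ (τ₁ * t) (τ₂ * t)) ∧
        -- for equally spaced particles the mean displacement vanishes as well
        ((∀ j : ℤ, y j = j / ρ) →
          (fun t : ℝ≥0 => ∫ ω, X 0 (τ₁ * t) ω * X 0 (τ₂ * t) ω ∂P) ~[atTop]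
            (fun t : ℝ≥0 => SingleFile.quenchedCorr σ ρ (τ₁ * t) (τ₂ * t)))) :=
  ⟨fun _ _ hy hind hX => ⟨hy.memLp_tracer hρ hW hind hX, fun _ _ h1 h2 =>
      hy.tracer_correlations hσ hρ hW hind hX h1 h2⟩,
    fun _ _ hy hX => ⟨hy.memLp_tracer hρ hW hX, fun _ _ h1 h2 =>
      hy.tracer_correlations hσ hρ hW hX h1 h2⟩⟩
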